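/- Let $M$ be a connected smooth manifold (without boundary) of dimension $d\ge 3$, $g$ a smooth Riemannian metric on $M$ with Levi-Civita connection $\nabla$, and let $P$, with metric trace $J$, be its Schouten tensor, given by $\mathrm{Ric}=(d-2)P+Jg$. Let $s\in C^\infty(M)$ be not identically zero and such that $(M,g,s)$ is directed almost Einstein, that is, the trace-free part of $\nabla\nabla s+sP$ vanishes. Put $\Sigma=\{s=0\}$, $M^{\pm}=\{\pm s>0\}$, $g^o=s^{-2}g$ on $M\setminus\Sigma$, and $$S(g,s)=\tfrac2d\,s\,(Js-\Delta s)-|ds|_g^2,\qquad \Delta=-g^{ab}\nabla_a\nabla_b .$$ Then $M\setminus\Sigma$ is open and dense in $M$; the function $S(g,s)$ is constant, that is, $(M,g,s)$ is almost scalar constant; and on $M\setminus\Sigma$ the metric $g^o$ is Einstein with scalar curvature $d(d-1)S(g,s)$. Moreover: 1. If $S(g,s)>0$, then $\Sigma=\emptyset$. 2. If $S(g,s)=0$, then $\Sigma$ is empty or consists of isolated points, and these are critical points of $s$. For each $p\in\Sigma$ the metric $g^o$ is asymptotically locally Euclidean near $p$, and the Weyl tensor $C_{abce}$, the Cotton tensor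 $A_{abc}=\nabla_bP_{ca}-\nabla_cP_{ba}$ and the Bach tensor $B_{ab}=\nabla^cA_{acb}+P^{ec}C_{eacb}$ of $g$ vanish at $p$. Here asymptotically locally Euclidean near $p$ means that some punctured neighbourhood of $p$ is diffeomorphic to $\{y\in\mathbb R^d:|y|>R\}/\Gamma$, with $\Gamma$ a finite group of linear isometries acting freely on $\mathbb R^d\setminus\{0\}$ and $p$ corresponding to $|y|\to\infty$, such that for some $\tau>0$ and all $k\ge0$ the components of the metric lifted to $\{|y|>R\}$ satisfy $\partial^k(g^o_{ij}-\delta_{ij})=O(|y|^{-\tau-k})$. 3. If $S(g,s)<0$, then $\Sigma$ is empty or a totally umbilic (embedded) hypersurface of $(M,g)$. 4. If $M$ is compact and $S(g,s)=-1$, then $M\setminus M^-$ is a disjoint union of finitely many connected Poincaré–Einstein manifolds with interior metric $g^o$, and so is $M\setminus M^+$. The boundary of each piece $K$ is $K\cap\Sigma$, and it is non-empty if $\Sigma\neq\emptyset$. Here a Poincaré–Einstein manifold is a compact smooth manifold $K$ with (possibly empty) boundary and a metric $g^o$ on its interior with $\mathrm{Ric}(g^o)=-(d-1)g^o$, such that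 $r^2g^o$ extends to a smooth Riemannian metric on $K$ for some smooth function $r\ge0$ on $K$ that vanishes exactly on $\partial K$ and satisfies $dr\neq0$ along $\partial K$. -/

import Mathlib

open scoped Manifold ContDiff Topology

namespace AlmostEinstein

noncomputable section

/-! ### Tensor calculus on open subsets of coordinate space

Components of tensors are written with respect to the standard coordinates of `ℝ^d`; `G` stands
for the matrix of components of a metric and `u` for a function. -/

/-- The coordinate space `ℝ^d`. -/
abbrev Coord (d : ℕ) : Type := EuclideanSpace ℝ (Fin d)

section LocalFormulas

variable {d : ℕ}

/-- The `i`-th partial derivative. -/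
def pd (i : Fin d) (f : Coord d → ℝ) (x : Coord d) : ℝ :=
  fderiv ℝ f x (EuclideanSpace.single i (1 : ℝ))

/-- Christoffel symbols `Γ^k_{ij}` of the Levi-Civita connection. -/
def christoffel (G : Coord d → Matrix (Fin d) (Fin d) ℝ) (k i j : Fin d) (x : Coord d) : ℝ :=
  (1 / 2) * ∑ l, (G x)⁻¹ k l *
    (pd i (fun y => G y j l) x + pd j (fun y => G y i l) x - pd l (fun y => G y i j) x)

/-- Riemann curvature `R_{ab}{}^c{}_e`, where `(∇_a ∇_b - ∇_b ∇_a) V^c = R_{ab}{}^c{}_e V^e`. -/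
def riemannUp (G : Coord d → Matrix (Fin d) (Fin d) ℝ) (a b c e : Fin d) (x : Coord d) : ℝ :=
  pd a (christoffel G c b e) x - pd b (christoffel G c a e) x
    + ∑ m, (christoffel G c a m x * christoffel G m b e x
      - christoffel G c b m x * christoffel G m a e x)

/-- Riemann curvature with all indices lowered, `R_{abce} = g_{cm} R_{ab}{}^m{}_e`. -/
def riemann (G : Coord d → Matrix (Fin d) (Fin d) ℝ) (a b c e : Fin d) (x : Coord d) : ℝ :=
  ∑ m, G x c m * riemannUp G a b m e x

/-- Ricci curvature `Ric_{ab} = R_{ca}{}^c{}_b`. -/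
def ricci (G : Coord d → Matrix (Fin d) (Fin d) ℝ) (a b : Fin d) (x : Coord d) : ℝ :=
  ∑ c, riemannUp G c a c b x

/-- Metric trace `g^{ab} T_{ab}`. -/
def trace (G : Coord d → Matrix (Fin d) (Fin d) ℝ) (T : Fin d → Fin d → Coord d → ℝ)
    (x : Coord d) : ℝ :=
  ∑ a, ∑ b, (G x)⁻¹ a b * T a b x

/-- Scalar curvature. -/
def scal (G : Coord d → Matrix (Fin d) (Fin d) ℝ) (x : Coord d) : ℝ :=
  trace G (ricci G) x

/-- `J = Sc / (2(d-1))`, the metric trace of the Schouten tensor. -/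
def schoutenTrace (G : Coord d → Matrix (Fin d) (Fin d) ℝ) (x : Coord d) : ℝ :=
  scal G x / (2 * ((d : ℝ) - 1))

/-- Schouten tensor, given by `Ric = (d-2) P + J g`. -/
def schouten (G : Coord d → Matrix (Fin d) (Fin d) ℝ) (a b : Fin d) (x : Coord d) : ℝ :=
  (ricci G a b x - schoutenTrace G x * G x a b) / ((d : ℝ) - 2)

/-- Weyl curvature,
`C_{abce} = R_{abce} - (g_{ca} P_{be} - g_{cb} P_{ae}) - (g_{eb} P_{ac} - g_{ea} P_{bc})`. -/
def weyl (G : Coord d → Matrix (Fin d) (Fin d) ℝ) (a b c e : Fin d) (x : Coord d) : ℝ :=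
  riemann G a b c e x
    - (G x c a * schouten G b e x - G x c b * schouten G a e x)
    - (G x e b * schouten G a c x - G x e a * schouten G b c x)

/-- Covariant derivative `∇_a T_{bc}` of a covariant 2-tensor. -/
def cov2 (G : Coord d → Matrix (Fin d) (Fin d) ℝ) (T : Fin d → Fin d → Coord d → ℝ)
    (a b c : Fin d) (x : Coord d) : ℝ :=
  pd a (T b c) x - ∑ m, (christoffel G m a b x * T m c x + christoffel G m a c x * T b m x)

/-- Covariant derivative `∇_a T_{bce}` of a covariant 3-tensor. -/
def cov3 (G : Coord d → Matrix (Fin d) (Fin d) ℝ) (T : Fin d → Fin d → Fin d → Coord d → ℝ)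
    (a b c e : Fin d) (x : Coord d) : ℝ :=
  pd a (T b c e) x - ∑ m, (christoffel G m a b x * T m c e x + christoffel G m a c x * T b m e x
    + christoffel G m a e x * T b c m x)

/-- Cotton tensor `A_{abc} = ∇_b P_{ca} - ∇_c P_{ba}`. -/
def cotton (G : Coord d → Matrix (Fin d) (Fin d) ℝ) (a b c : Fin d) (x : Coord d) : ℝ :=
  cov2 G (schouten G) b c a x - cov2 G (schouten G) c b a x

/-- Bach tensor `B_{ab} = ∇^c A_{acb} + P^{ec} C_{eacb}`. -/
def bach (G : Coord d → Matrix (Fin d) (Fin d) ℝ) (a b : Fin d) (x : Coord d) : ℝ :=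
  (∑ c, ∑ f, (G x)⁻¹ c f * cov3 G (cotton G) f a c b x)
    + ∑ e, ∑ c, ∑ p, ∑ q,
        (G x)⁻¹ e p * (G x)⁻¹ c q * schouten G p q x * weyl G e a c b x

/-- Hessian `∇_a ∇_b u`. -/
def hess (G : Coord d → Matrix (Fin d) (Fin d) ℝ) (u : Coord d → ℝ) (a b : Fin d)
    (x : Coord d) : ℝ :=
  pd a (pd b u) x - ∑ m, christoffel G m a b x * pd m u x

/-- Trace-free part of a covariant 2-tensor. -/
def traceFree (G : Coord d → Matrix (Fin d) (Fin d) ℝ) (T : Fin d → Fin d → Coord d → ℝ)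
    (a b : Fin d) (x : Coord d) : ℝ :=
  T a b x - trace G T x / (d : ℝ) * G x a b

/-- The tensor `A(g,u)`, the trace-free part of `∇∇u + u P`. -/
def localA (G : Coord d → Matrix (Fin d) (Fin d) ℝ) (u : Coord d → ℝ) (a b : Fin d)
    (x : Coord d) : ℝ :=
  traceFree G (fun i j y => hess G u i j y + u y * schouten G i j y) a b x

/-- The positive Laplacian `Δ u = - g^{ab} ∇_a ∇_b u`. -/
def laplacian (G : Coord d → Matrix (Fin d) (Fin d) ℝ) (u : Coord d → ℝ) (x : Coord d) : ℝ :=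
  -trace G (hess G u) x

/-- `|du|²_g`. -/
def gradSq (G : Coord d → Matrix (Fin d) (Fin d) ℝ) (u : Coord d → ℝ) (x : Coord d) : ℝ :=
  trace G (fun a b y => pd a u y * pd b u y) x

/-- `S(g,u) = (2/d) u (J - Δ) u - |du|²`. -/
def localS (G : Coord d → Matrix (Fin d) (Fin d) ℝ) (u : Coord d → ℝ) (x : Coord d) : ℝ :=
  2 / (d : ℝ) * u x * (schoutenTrace G x * u x - laplacian G u x) - gradSq G u x

end LocalFormulas

/-! ### Manifolds -/

section Global

variable {d : ℕ} {M : Type*} [TopologicalSpace M] [ChartedSpace (EuclideanSpace ℝ (Fin d)) M]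

variable (d M) in
/-- Fields of bilinear forms on the tangent spaces of a `d`-manifold. -/
abbrev BilinField : Type _ :=
  (p : M) → TangentSpace (𝓡 d) p →L[ℝ] TangentSpace (𝓡 d) p →L[ℝ] ℝ

variable (d M) in
/-- Smooth Riemannian (positive definite) metrics on a smooth `d`-manifold. -/
abbrev Metric [IsManifold (𝓡 d) ∞ M] : Type _ :=
  Bundle.ContMDiffRiemannianMetric (𝓡 d) ∞ (EuclideanSpace ℝ (Fin d))
    (TangentSpace (𝓡 d) : M → Type _)

/-- The matrix of components of the pull-back `F^* h` of `h` under a map `F : ℝ^d → M`. -/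
def pullback (h : BilinField d M) (F : Coord d → M) (y : Coord d) :
    Matrix (Fin d) (Fin d) ℝ :=
  fun i j => h (F y) (mfderiv (𝓡 d) (𝓡 d) F y (EuclideanSpace.single i (1 : ℝ) : Coord d))
    (mfderiv (𝓡 d) (𝓡 d) F y (EuclideanSpace.single j (1 : ℝ) : Coord d))

/-- The components `h(∂_i, ∂_j)` of `h` in the coordinates `φ`. -/
def coeff (h : BilinField d M) (φ : OpenPartialHomeomorph M (EuclideanSpace ℝ (Fin d)))
    (x : Coord d) : Matrix (Fin d) (Fin d) ℝ :=
  pullback h φ.symm x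

/-- `φ` is a smooth chart of `M` around `p`. -/
def IsChartAround (φ : OpenPartialHomeomorph M (EuclideanSpace ℝ (Fin d))) (p : M) : Prop :=
  φ ∈ IsManifold.maximalAtlas (𝓡 d) ∞ M ∧ p ∈ φ.source

/-- The function `S(g,s)` on `M`. It is a scalar invariant, so that any chart around `p` may be
used to compute it at `p`. -/
def scalarS (g : BilinField d M) (s : M → ℝ) (p : M) : ℝ :=
  localS (coeff g (chartAt (EuclideanSpace ℝ (Fin d)) p))
    (s ∘ (chartAt (EuclideanSpace ℝ (Fin d)) p).symm) (chartAt (EuclideanSpace ℝ (Fin d)) p p)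

/-- The scalar curvature as a function on `M`. -/
def scalarCurvature (h : BilinField d M) (p : M) : ℝ :=
  scal (coeff h (chartAt (EuclideanSpace ℝ (Fin d)) p)) (chartAt (EuclideanSpace ℝ (Fin d)) p p)

/-- `Ric^h = l h` on the set `U`. -/
def RicciEqOn (h : BilinField d M) (l : ℝ) (U : Set M) : Prop :=
  ∀ p ∈ U, ∀ φ, IsChartAround φ p → ∀ a b,
    ricci (coeff h φ) a b (φ p) = l * coeff h φ (φ p) a b

/-- `h` is an Einstein metric on `U`. -/
def IsEinsteinOn (h : BilinField d M) (U : Set M) : Prop :=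
  ∃ l : ℝ, RicciEqOn h l U

/-- The Weyl curvature of `h` vanishes at `p`. -/
def WeylVanishesAt (h : BilinField d M) (p : M) : Prop :=
  ∀ φ, IsChartAround φ p → ∀ a b c e, weyl (coeff h φ) a b c e (φ p) = 0

/-- The Cotton curvature of `h` vanishes at `p`. -/
def CottonVanishesAt (h : BilinField d M) (p : M) : Prop :=
  ∀ φ, IsChartAround φ p → ∀ a b c, cotton (coeff h φ) a b c (φ p) = 0

/-- The Bach curvature of `h` vanishes at `p`. -/
def BachVanishesAt (h : BilinField d M) (p : M) : Prop :=
  ∀ φ, IsChartAround φ p → ∀ a b, bach (coeff h φ) a b (φ p) = 0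

/-- `(M,g,s)` is a directed almost Einstein structure: `s` is smooth, not identically zero, and
`A(g,s) = 0`. -/
structure IsAlmostEinstein [IsManifold (𝓡 d) ∞ M] (g : Metric d M) (s : M → ℝ) : Prop where
  smooth : ContMDiff (𝓡 d) 𝓘(ℝ) ∞ s
  nontrivial : ∃ p, s p ≠ 0
  equation : ∀ p φ, IsChartAround φ p → ∀ a b,
    localA (coeff g.inner φ) (s ∘ φ.symm) a b (φ p) = 0

/-- `(M,g,s)` is a directed almost scalar constant structure with `S(g,s)` equal to the
constant `c`. -/
structure IsAlmostScalarConstant [IsManifold (𝓡 d) ∞ M] (g : Metric d M) (s : M → ℝ) (c : ℝ) :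
    Prop where
  smooth : ContMDiff (𝓡 d) 𝓘(ℝ) ∞ s
  nontrivial : ∃ p, s p ≠ 0
  equation : ∀ p, scalarS g.inner s p = c

/-- The scale singularity set, the zero set of `s`. -/
def singularSet (s : M → ℝ) : Set M := {p | s p = 0}

/-- The metric `g° = s⁻² g`, which is meaningful off the zero set of `s`. -/
def rescaled (g : BilinField d M) (s : M → ℝ) : BilinField d M :=
  fun p => ((s p) ^ 2)⁻¹ • g p

/-- In the smooth chart `φ` the set `N` is the coordinate hyperplane `x_i = 0`. -/
def IsSliceChart (N : Set M) (φ : OpenPartialHomeomorph M (EuclideanSpace ℝ (Fin d)))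
    (i : Fin d) : Prop :=
  φ ∈ IsManifold.maximalAtlas (𝓡 d) ∞ M ∧ ∀ q ∈ φ.source, q ∈ N ↔ φ q i = 0

/-- `N` is an embedded hypersurface (submanifold of codimension one). -/
def IsHypersurface (d : ℕ) {M : Type*} [TopologicalSpace M]
    [ChartedSpace (EuclideanSpace ℝ (Fin d)) M] (N : Set M) : Prop :=
  ∀ p ∈ N, ∃ (φ : OpenPartialHomeomorph M (EuclideanSpace ℝ (Fin d))) (i : Fin d),
    IsSliceChart N φ i ∧ p ∈ φ.source

/-- The component `II(∂_j, ∂_k) = g(∇_{∂_j} ∂_k, ν) = Γ^i_{jk} / √(g^{ii})` (for `j, k ≠ i`) of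
the second fundamental form of the hyperplane `x_i = 0` with unit normal
`ν = grad x_i / |grad x_i|`. -/
def secondFundamentalForm (G : Coord d → Matrix (Fin d) (Fin d) ℝ) (i j k : Fin d)
    (x : Coord d) : ℝ :=
  christoffel G i j k x / Real.sqrt ((G x)⁻¹ i i)

/-- `N` is a totally umbilic hypersurface: at each of its points the second fundamental form is
a multiple of the induced metric. -/
def IsTotallyUmbilicHypersurface (g : BilinField d M) (N : Set M) : Prop :=
  IsHypersurface d N ∧
    ∀ (φ : OpenPartialHomeomorph M (EuclideanSpace ℝ (Fin d))) (i : Fin d), IsSliceChart N φ i →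
      ∀ q ∈ N ∩ φ.source, ∃ H : ℝ, ∀ j k, j ≠ i → k ≠ i →
        secondFundamentalForm (coeff g φ) i j k (φ q) = H * coeff g φ (φ q) j k

/-- The metric `h`, defined on a punctured neighbourhood of `p`, is asymptotically locally
Euclidean near `p`: a punctured neighbourhood of `p` is diffeomorphic, via `F`, to the quotient of
`{y ∈ ℝ^d : |y| > R}` by a finite group `Γ` of linear isometries that acts freely off the origin,
with `p` corresponding to infinity, and on `{|y| > R}` the components of the lifted metric satisfy
`∂^k (h_{ij} - δ_{ij}) = O(|y|^{-τ-k})` for some `τ > 0` and all `k ≥ 0`. -/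
def IsALENear (h : BilinField d M) (p : M) : Prop :=
  ∃ (Γ : Subgroup (EuclideanSpace ℝ (Fin d) ≃ₗᵢ[ℝ] EuclideanSpace ℝ (Fin d))) (R τ : ℝ)
    (F : EuclideanSpace ℝ (Fin d) → M),
    Finite Γ ∧ (∀ γ ∈ Γ, ∀ y, y ≠ 0 → γ y = y → γ = 1) ∧ 0 < R ∧ 0 < τ ∧
    IsLocalDiffeomorphOn (𝓡 d) (𝓡 d) ∞ F {y | R < ‖y‖} ∧
    (∀ y z, R < ‖y‖ → R < ‖z‖ → (F y = F z ↔ ∃ γ ∈ Γ, γ y = z)) ∧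
    p ∉ F '' {y | R < ‖y‖} ∧ insert p (F '' {y | R < ‖y‖}) ∈ 𝓝 p ∧
    Filter.Tendsto F (Bornology.cobounded (EuclideanSpace ℝ (Fin d))) (𝓝 p) ∧
    ∀ (i j : Fin d) (k : ℕ), ∃ C : ℝ, ∀ y : EuclideanSpace ℝ (Fin d), R < ‖y‖ →
      ‖iteratedFDeriv ℝ k
        (fun z => pullback h F z i j - (1 : Matrix (Fin d) (Fin d) ℝ) i j) y‖
        ≤ C * ‖y‖ ^ (-τ - (k : ℝ))

/-- `K` is a regular domain: near each point it is a neighbourhood of the point or, in a smooth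
chart of `M`, a half-space `x_i ≥ 0` whose boundary passes through the point. Together with the
induced smooth structure, `K` is then a smooth manifold with boundary `frontier K` and interior
`interior K`. -/
def IsRegularDomain (d : ℕ) {M : Type*} [TopologicalSpace M]
    [ChartedSpace (EuclideanSpace ℝ (Fin d)) M] (K : Set M) : Prop :=
  ∀ p ∈ K, p ∈ interior K ∨
    ∃ (φ : OpenPartialHomeomorph M (EuclideanSpace ℝ (Fin d))) (i : Fin d),
      IsChartAround φ p ∧ φ p i = 0 ∧ ∀ q ∈ φ.source, q ∈ K ↔ 0 ≤ φ q i

/-- `K`, a compact manifold with (possibly empty) boundary `frontier K`, is a Poincaré-Einstein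
manifold with interior metric `g° = r⁻² g`. Here `g` is a Riemannian metric that is smooth up to
the boundary, and `r` is a non-negative defining function for the boundary. -/
structure IsPoincareEinstein [IsManifold (𝓡 d) ∞ M] (g : Metric d M) (r : M → ℝ) (K : Set M) :
    Prop where
  compact : IsCompact K
  regular : IsRegularDomain d K
  smooth : ContMDiff (𝓡 d) 𝓘(ℝ) ∞ r
  nonneg : ∀ p ∈ K, 0 ≤ r p
  zero_iff : ∀ p ∈ K, r p = 0 ↔ p ∈ frontier K
  deriv_ne_zero : ∀ p ∈ frontier K, mfderiv (𝓡 d) 𝓘(ℝ) r p ≠ 0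
  einstein : RicciEqOn (rescaled g.inner r) (-((d : ℝ) - 1)) (interior K)

/-- `N` is a disjoint union of finitely many connected Poincaré-Einstein manifolds with interior
metric `r⁻² g`; if `Z` is non-empty then each of them has a non-empty boundary, and the boundary is
always the part of `Z` that it contains. -/
def IsFiniteUnionOfPoincareEinstein [IsManifold (𝓡 d) ∞ M] (g : Metric d M) (r : M → ℝ)
    (N Z : Set M) : Prop :=
  ∃ 𝒦 : Set (Set M), 𝒦.Finite ∧ 𝒦.PairwiseDisjoint id ∧ ⋃₀ 𝒦 = N ∧
    ∀ K ∈ 𝒦, IsConnected K ∧ IsPoincareEinstein g r K ∧ frontier K = K ∩ Z ∧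
      (Z.Nonempty → (frontier K).Nonempty)

end Global

end

end AlmostEinstein

/-! Put `ρ = (Δs - Js)/d` and `V = grad s`. The almost Einstein equation says `∇∇s = -sP - ρg`
(`IsSolutionOn.hess_eq`). Commuting derivatives of `V` and tracing, with the contracted Bianchi
identity in the form `div P = dJ`, gives `dρ = P(V)` (`IsSolutionOn.pd_rho`). So `(s, V, ρ)` solves
a closed linear first order system, in other words it is a parallel section of a linear connection,
and everything follows from this.

Unique continuation: the triple vanishes near a point where it vanishes, so on a connected manifold
`s` vanishes on no open set, and at a zero of `s` with `ds = 0` one has `ρ ≠ 0`. Constancy: `S =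
-2sρ - |ds|²` is the quadratic invariant of the triple, and its derivative is zero
(`IsSolutionOn.pd_localS`). Einstein condition: where `s ≠ 0`, inserting the Hessian into the
conformal change of curvature gives `Ric(g°) = (d-1) S g°` (`IsSolutionOn.ricci_rescale`).

On `Σ` one has `S = -|ds|²`, so the sign of `S` separates the cases. `S > 0` excludes zeros.

If `S = 0`, every zero `p` is critical and the derivative of `V` there is `-ρ` times the identity,
so `V` and hence `s` have no other zero near `p`. The commutator identity reads `C(V) = -sA`
(`IsSolutionOn.weyl_grad`). Differentiating it at `p` gives `C = 0`. Contracting it once more with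
`V` gives `A(V) = 0` near `p`, whose first derivatives give `A = 0` and whose second derivatives
show `∂A` to be skew, which makes the Bach tensor a trace of a trace-free tensor. In a chart with `g
= δ` at `p`, `s` is `-(ρ/2)|x|²` to leading order, so an inversion of suitable radius turns `s⁻²g`
into `δ + O(1/|y|)`, with trivial group.

If `S < 0`, then `ds ≠ 0` on `Σ`, so `s` can be used as a coordinate, and the tangential part of the
Hessian equation is umbilicity. On a compact manifold the pieces are the connected components of `{s
≥ 0}` and of `{s ≤ 0}`. -/

namespace AlmostEinstein

/-! ### Partial derivatives of functions, vectors and matrices -/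

section Calculus

variable {d : ℕ} {U : Set (Coord d)} {x : Coord d}

/-- Smooth real functions on a set. -/
abbrev SmoothOn (U : Set (Coord d)) (f : Coord d → ℝ) : Prop := ContDiffOn ℝ ∞ f U

theorem SmoothOn.differentiableAt {f : Coord d → ℝ} (hf : SmoothOn U f) (hU : IsOpen U)
    (hx : x ∈ U) : DifferentiableAt ℝ f x :=
  (hf.contDiffAt (hU.mem_nhds hx)).differentiableAt (by simp)

theorem SmoothOn.pd {f : Coord d → ℝ} (hf : SmoothOn U f) (hU : IsOpen U) (a : Fin d) :
    SmoothOn U (pd a f) :=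
  (hf.fderiv_of_isOpen hU (m := ∞) (by simp)).clm_apply contDiffOn_const

theorem SmoothOn.sum {ι : Type*} {s : Finset ι} {f : ι → Coord d → ℝ}
    (h : ∀ i ∈ s, SmoothOn U (f i)) : SmoothOn U (fun x => ∑ i ∈ s, f i x) :=
  ContDiffOn.sum h

theorem pd_congr {f g : Coord d → ℝ} (h : f =ᶠ[𝓝 x] g) (a : Fin d) : pd a f x = pd a g x := by
  simp only [pd, h.fderiv_eq]

theorem pd_congr_of_eqOn {f g : Coord d → ℝ} (hU : IsOpen U) (hx : x ∈ U) (h : Set.EqOn f g U)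
    (a : Fin d) : pd a f x = pd a g x :=
  pd_congr (h.eventuallyEq_of_mem (hU.mem_nhds hx)) a

@[simp] theorem pd_const (a : Fin d) (c : ℝ) : pd a (fun _ => c) x = 0 := by
  simp [pd]

theorem pd_add {f g : Coord d → ℝ} (hf : DifferentiableAt ℝ f x) (hg : DifferentiableAt ℝ g x)
    (a : Fin d) : pd a (fun y => f y + g y) x = pd a f x + pd a g x := by
  simp [pd, fderiv_fun_add hf hg]

theorem pd_sub {f g : Coord d → ℝ} (hf : DifferentiableAt ℝ f x) (hg : DifferentiableAt ℝ g x)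
    (a : Fin d) : pd a (fun y => f y - g y) x = pd a f x - pd a g x := by
  simp [pd, fderiv_fun_sub hf hg]

theorem pd_neg (f : Coord d → ℝ) (a : Fin d) : pd a (fun y => -f y) x = -pd a f x := by
  simp [pd, fderiv_fun_neg]

theorem pd_mul {f g : Coord d → ℝ} (hf : DifferentiableAt ℝ f x) (hg : DifferentiableAt ℝ g x)
    (a : Fin d) : pd a (fun y => f y * g y) x = pd a f x * g x + f x * pd a g x := by
  simp [pd, fderiv_fun_mul hf hg]; ring

theorem pd_const_mul {f : Coord d → ℝ} (hf : DifferentiableAt ℝ f x) (c : ℝ)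
    (a : Fin d) : pd a (fun y => c * f y) x = c * pd a f x := by
  rw [pd_mul (by fun_prop) hf]; simp

theorem pd_sum {ι : Type*} {s : Finset ι} {f : ι → Coord d → ℝ}
    (h : ∀ i ∈ s, DifferentiableAt ℝ (f i) x) (a : Fin d) :
    pd a (fun y => ∑ i ∈ s, f i y) x = ∑ i ∈ s, pd a (f i) x := by
  simp [pd, fderiv_fun_sum h]

theorem pd_inv {f : Coord d → ℝ} (hf : DifferentiableAt ℝ f x) (h0 : f x ≠ 0) (a : Fin d) :
    pd a (fun y => (f y)⁻¹) x = -pd a f x / f x ^ 2 := by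
  have := (hasDerivAt_inv h0).comp_hasFDerivAt x hf.hasFDerivAt
  rw [pd, HasFDerivAt.fderiv (f := fun y => (f y)⁻¹) this]
  simp [pd]; ring

theorem pd_comm {f : Coord d → ℝ} (hf : SmoothOn U f) (hU : IsOpen U) (hx : x ∈ U)
    (a b : Fin d) : pd a (pd b f) x = pd b (pd a f) x := by
  have h2 : ContDiffAt ℝ ∞ f x := hf.contDiffAt (hU.mem_nhds hx)
  have hsym : IsSymmSndFDerivAt ℝ f x := h2.isSymmSndFDerivAt
    (by simp; exact ENat.LEInfty.out)
  have hd : DifferentiableAt ℝ (fderiv ℝ f) x :=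
    (h2.fderiv_right (m := ∞) (by simp)).differentiableAt (by simp)
  have key : ∀ a b : Fin d, pd a (pd b f) x =
      fderiv ℝ (fderiv ℝ f) x (EuclideanSpace.single a 1) (EuclideanSpace.single b 1) := by
    intro a b
    unfold pd
    rw [fderiv_clm_apply hd (by fun_prop)]
    simp
  rw [key, key]
  exact hsym _ _

theorem fderiv_apply_eq_sum_pd (f : Coord d → ℝ) (v : Coord d) :
    fderiv ℝ f x v = ∑ i, v i * pd i f x := by
  conv_lhs => rw [← (EuclideanSpace.basisFun (Fin d) ℝ).sum_repr v]
  simp [pd, map_sum]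

theorem fderiv_eq_zero_of_pd {f : Coord d → ℝ} (h : ∀ a, pd a f x = 0) : fderiv ℝ f x = 0 := by
  ext v
  simp [fderiv_apply_eq_sum_pd, h]

/-- The partial derivative of a matrix valued function. -/
noncomputable def mpd (a : Fin d) (F : Coord d → Matrix (Fin d) (Fin d) ℝ) (x : Coord d) :
    Matrix (Fin d) (Fin d) ℝ :=
  Matrix.of fun i j => pd a (fun y => F y i j) x

/-- The partial derivative of a function with values in `Fin d → ℝ`. -/
noncomputable def vpd (a : Fin d) (v : Coord d → Fin d → ℝ) (x : Coord d) : Fin d → ℝ :=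
  fun i => pd a (fun y => v y i) x

@[simp] theorem mpd_apply (a : Fin d) (F : Coord d → Matrix (Fin d) (Fin d) ℝ) (i j : Fin d) :
    mpd a F x i j = pd a (fun y => F y i j) x := rfl

@[simp] theorem vpd_apply (a : Fin d) (F : Coord d → Fin d → ℝ) (i : Fin d) :
    vpd a F x i = pd a (fun y => F y i) x := rfl

/-- Matrix valued functions with smooth entries. -/
def MSmoothOn (U : Set (Coord d)) (F : Coord d → Matrix (Fin d) (Fin d) ℝ) : Prop :=
  ∀ i j, SmoothOn U (fun y => F y i j)

/-- Vector valued functions with smooth entries. -/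
def VSmoothOn (U : Set (Coord d)) (v : Coord d → Fin d → ℝ) : Prop :=
  ∀ i, SmoothOn U (fun y => v y i)

variable {F H : Coord d → Matrix (Fin d) (Fin d) ℝ} {v w : Coord d → Fin d → ℝ}

theorem MSmoothOn.mpd (hF : MSmoothOn U F) (hU : IsOpen U) (a : Fin d) : MSmoothOn U (mpd a F) :=
  fun i j => (hF i j).pd hU a

theorem VSmoothOn.vpd (hF : VSmoothOn U v) (hU : IsOpen U) (a : Fin d) : VSmoothOn U (vpd a v) :=
  fun i => (hF i).pd hU a

theorem MSmoothOn.sub (hF : MSmoothOn U F) (hH : MSmoothOn U H) :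
    MSmoothOn U (fun y => F y - H y) := fun i j => (hF i j).sub (hH i j)

theorem MSmoothOn.mul (hF : MSmoothOn U F) (hH : MSmoothOn U H) :
    MSmoothOn U (fun y => F y * H y) := by
  intro i j
  simp only [Matrix.mul_apply]
  exact SmoothOn.sum fun k _ => (hF i k).mul (hH k j)

theorem MSmoothOn.transpose (hF : MSmoothOn U F) : MSmoothOn U (fun y => (F y).transpose) :=
  fun i j => hF j i

theorem MSmoothOn.mulVec (hF : MSmoothOn U F) (hv : VSmoothOn U v) :
    VSmoothOn U (fun y => (F y).mulVec (v y)) := by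
  intro i
  simp only [Matrix.mulVec, dotProduct]
  exact SmoothOn.sum fun k _ => (hF i k).mul (hv k)

theorem mpd_congr_of_eqOn (hU : IsOpen U) (hx : x ∈ U) (h : Set.EqOn F H U) (a : Fin d) :
    mpd a F x = mpd a H x := by
  ext i j
  exact pd_congr_of_eqOn hU hx (fun y hy => by simp only [h hy]) a

theorem vpd_congr_of_eqOn (hU : IsOpen U) (hx : x ∈ U) (h : Set.EqOn v w U) (a : Fin d) :
    vpd a v x = vpd a w x := by
  ext i
  exact pd_congr_of_eqOn hU hx (fun y hy => by simp only [h hy]) a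

theorem mpd_add (hU : IsOpen U) (hx : x ∈ U) (hF : MSmoothOn U F) (hH : MSmoothOn U H)
    (a : Fin d) : mpd a (fun y => F y + H y) x = mpd a F x + mpd a H x := by
  ext i j
  exact pd_add ((hF i j).differentiableAt hU hx) ((hH i j).differentiableAt hU hx) a

theorem mpd_sub (hU : IsOpen U) (hx : x ∈ U) (hF : MSmoothOn U F) (hH : MSmoothOn U H)
    (a : Fin d) : mpd a (fun y => F y - H y) x = mpd a F x - mpd a H x := by
  ext i j
  exact pd_sub ((hF i j).differentiableAt hU hx) ((hH i j).differentiableAt hU hx) a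

theorem mpd_mul (hU : IsOpen U) (hx : x ∈ U) (hF : MSmoothOn U F) (hH : MSmoothOn U H)
    (a : Fin d) : mpd a (fun y => F y * H y) x = mpd a F x * H x + F x * mpd a H x := by
  ext i j
  have h1 := fun k => (hF i k).differentiableAt hU hx
  have h2 := fun k => (hH k j).differentiableAt hU hx
  simp only [mpd_apply, Matrix.mul_apply, Matrix.add_apply]
  rw [pd_sum (fun k _ => (h1 k).fun_mul (h2 k)), ← Finset.sum_add_distrib]
  exact Finset.sum_congr rfl fun k _ => pd_mul (h1 k) (h2 k) a

theorem mpd_transpose (a : Fin d) :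
    mpd a (fun y => (F y).transpose) x = (mpd a F x).transpose := rfl

theorem mpd_const (a : Fin d) (A : Matrix (Fin d) (Fin d) ℝ) : mpd a (fun _ => A) x = 0 := by
  ext i j; simp

theorem mpd_comm (hU : IsOpen U) (hx : x ∈ U) (hF : MSmoothOn U F) (a b : Fin d) :
    mpd a (mpd b F) x = mpd b (mpd a F) x := by
  ext i j
  exact pd_comm (hF i j) hU hx a b

theorem vpd_add (hU : IsOpen U) (hx : x ∈ U) (hv : VSmoothOn U v) (hw : VSmoothOn U w)
    (a : Fin d) : vpd a (fun y => v y + w y) x = vpd a v x + vpd a w x := by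
  ext i
  exact pd_add ((hv i).differentiableAt hU hx) ((hw i).differentiableAt hU hx) a

theorem vpd_mulVec (hU : IsOpen U) (hx : x ∈ U) (hF : MSmoothOn U F) (hv : VSmoothOn U v)
    (a : Fin d) : vpd a (fun y => (F y).mulVec (v y)) x
      = (mpd a F x).mulVec (v x) + (F x).mulVec (vpd a v x) := by
  ext i
  have h1 := fun k => (hF i k).differentiableAt hU hx
  have h2 := fun k => (hv k).differentiableAt hU hx
  simp only [vpd_apply, Matrix.mulVec, dotProduct, Pi.add_apply, mpd_apply]
  rw [pd_sum (fun k _ => (h1 k).fun_mul (h2 k)), ← Finset.sum_add_distrib]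
  exact Finset.sum_congr rfl fun k _ => pd_mul (h1 k) (h2 k) a

theorem pd_dotProduct (hU : IsOpen U) (hx : x ∈ U) (hv : VSmoothOn U v) (hw : VSmoothOn U w)
    (a : Fin d) : pd a (fun y => dotProduct (v y) (w y)) x
      = dotProduct (vpd a v x) (w x) + dotProduct (v x) (vpd a w x) := by
  have h1 := fun k => (hv k).differentiableAt hU hx
  have h2 := fun k => (hw k).differentiableAt hU hx
  simp only [dotProduct]
  rw [pd_sum (fun k _ => (h1 k).fun_mul (h2 k)), ← Finset.sum_add_distrib]
  exact Finset.sum_congr rfl fun k _ => pd_mul (h1 k) (h2 k) a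

theorem vpd_comm (hU : IsOpen U) (hx : x ∈ U) (hv : VSmoothOn U v) (a b : Fin d) :
    vpd a (vpd b v) x = vpd b (vpd a v) x := by
  ext i
  exact pd_comm (hv i) hU hx a b

theorem MSmoothOn.det {n : ℕ} {K : Coord d → Matrix (Fin n) (Fin n) ℝ}
    (hK : ∀ i j, SmoothOn U (fun y => K y i j)) : SmoothOn U (fun y => (K y).det) := by
  simp only [Matrix.det_apply']
  exact SmoothOn.sum fun σ _ => contDiffOn_const.mul (contDiffOn_prod fun i _ => hK _ _)

theorem MSmoothOn.inv (hF : MSmoothOn U F) (h0 : ∀ y ∈ U, (F y).det ≠ 0) :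
    MSmoothOn U (fun y => (F y)⁻¹) := by
  intro i j
  simp only [Matrix.inv_def, Ring.inverse_eq_inv', Matrix.smul_apply, smul_eq_mul,
    Matrix.adjugate_apply]
  refine (ContDiffOn.inv (MSmoothOn.det hF) h0).mul (MSmoothOn.det fun k l => ?_)
  simp only [Matrix.updateRow_apply]
  split_ifs
  · exact contDiffOn_const
  · exact hF k l

end Calculus

/-! ### The Levi-Civita connection and its curvature -/

section Connection

variable {d : ℕ} {U : Set (Coord d)} {x : Coord d} {G : Coord d → Matrix (Fin d) (Fin d) ℝ}

/-- `G` is the matrix of components of a smooth Riemannian metric on `U`. -/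
structure IsMetricOn (G : Coord d → Matrix (Fin d) (Fin d) ℝ) (U : Set (Coord d)) : Prop where
  smooth : MSmoothOn U G
  posDef : ∀ x ∈ U, (G x).PosDef

theorem IsMetricOn.transpose_eq (hG : IsMetricOn G U) (hx : x ∈ U) : (G x).transpose = G x := by
  simpa [Matrix.IsHermitian] using (hG.posDef x hx).isHermitian

theorem IsMetricOn.symm (hG : IsMetricOn G U) (hx : x ∈ U) (i j : Fin d) : G x i j = G x j i :=
  congrFun (congrFun (hG.transpose_eq hx).symm i) j

theorem IsMetricOn.det_ne_zero (hG : IsMetricOn G U) (hx : x ∈ U) : (G x).det ≠ 0 :=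
  (hG.posDef x hx).det_pos.ne'

theorem IsMetricOn.mul_inv (hG : IsMetricOn G U) (hx : x ∈ U) : G x * (G x)⁻¹ = 1 :=
  Matrix.mul_nonsing_inv _ (hG.det_ne_zero hx).isUnit

theorem IsMetricOn.inv_mul (hG : IsMetricOn G U) (hx : x ∈ U) : (G x)⁻¹ * G x = 1 :=
  Matrix.nonsing_inv_mul _ (hG.det_ne_zero hx).isUnit

theorem IsMetricOn.inv_transpose (hG : IsMetricOn G U) (hx : x ∈ U) :
    ((G x)⁻¹).transpose = (G x)⁻¹ := by
  rw [Matrix.transpose_nonsing_inv, hG.transpose_eq hx]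

theorem IsMetricOn.inv_symm (hG : IsMetricOn G U) (hx : x ∈ U) (i j : Fin d) :
    (G x)⁻¹ i j = (G x)⁻¹ j i :=
  congrFun (congrFun (hG.inv_transpose hx).symm i) j

theorem IsMetricOn.smooth_inv (hG : IsMetricOn G U) : MSmoothOn U (fun y => (G y)⁻¹) :=
  hG.smooth.inv fun _ hy => hG.det_ne_zero hy

theorem IsMetricOn.mono {U' : Set (Coord d)} (hG : IsMetricOn G U) (h : U' ⊆ U) :
    IsMetricOn G U' :=
  ⟨fun i j => (hG.smooth i j).mono h, fun x hx => hG.posDef x (h hx)⟩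

theorem IsMetricOn.mul_left_cancel (hG : IsMetricOn G U) (hx : x ∈ U)
    {A B : Matrix (Fin d) (Fin d) ℝ} (h : G x * A = G x * B) : A = B := by
  have := congrArg ((G x)⁻¹ * ·) h
  simpa only [← mul_assoc, hG.inv_mul hx, one_mul] using this

theorem IsMetricOn.mulVec_left_cancel (hG : IsMetricOn G U) (hx : x ∈ U)
    {v w : Fin d → ℝ} (h : (G x).mulVec v = (G x).mulVec w) : v = w := by
  have := congrArg (((G x)⁻¹).mulVec ·) h
  simpa only [Matrix.mulVec_mulVec, hG.inv_mul hx, Matrix.one_mulVec] using this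

/-- The matrix `(Γ^c_{ae})_{ce}` of the connection in the direction `a`. -/
noncomputable def conn (G : Coord d → Matrix (Fin d) (Fin d) ℝ) (a : Fin d) (x : Coord d) :
    Matrix (Fin d) (Fin d) ℝ :=
  Matrix.of fun c e => christoffel G c a e x

/-- The matrix `(R_{ab}{}^c{}_e)_{ce}` of the curvature. -/
noncomputable def curv (G : Coord d → Matrix (Fin d) (Fin d) ℝ) (a b : Fin d) (x : Coord d) :
    Matrix (Fin d) (Fin d) ℝ :=
  Matrix.of fun c e => riemannUp G a b c e x

@[simp] theorem conn_apply (a c e : Fin d) : conn G a x c e = christoffel G c a e x := rfl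

@[simp] theorem curv_apply (a b c e : Fin d) : curv G a b x c e = riemannUp G a b c e x := rfl

/-- The structure equation `R = dΓ + Γ ∧ Γ` in matrix form. It reduces the Bianchi identities and
the transformation laws below to identities in a noncommutative ring. -/
theorem curv_eq (a b : Fin d) :
    curv G a b x = mpd a (conn G b) x - mpd b (conn G a) x
      + (conn G a x * conn G b x - conn G b x * conn G a x) := by
  ext c e
  simp [riemannUp, Matrix.mul_apply, Finset.sum_sub_distrib]

theorem curv_swap (a b : Fin d) : curv G b a x = -curv G a b x := by
  rw [curv_eq, curv_eq]; abel

theorem riemannUp_swap (a b c e : Fin d) : riemannUp G b a c e x = -riemannUp G a b c e x :=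
  congrFun (congrFun (curv_swap (G := G) (x := x) a b) c) e

theorem IsMetricOn.christoffel_symm (hG : IsMetricOn G U) (hU : IsOpen U) (hx : x ∈ U)
    (k i j : Fin d) : christoffel G k i j x = christoffel G k j i x := by
  unfold christoffel
  congr 1
  refine Finset.sum_congr rfl fun l _ => ?_
  rw [pd_congr_of_eqOn hU hx (f := fun y => G y i j) (g := fun y => G y j i)
    (fun y hy => hG.symm hy i j) l]
  ring

theorem IsMetricOn.lower_christoffel (hG : IsMetricOn G U) (hx : x ∈ U) (c i j : Fin d) :
    ∑ m, G x c m * christoffel G m i j x =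
      (1 / 2) * (pd i (fun y => G y j c) x + pd j (fun y => G y i c) x
        - pd c (fun y => G y i j) x) := by
  set K : Fin d → ℝ := fun l => (1 / 2) * (pd i (fun y => G y j l) x + pd j (fun y => G y i l) x
        - pd l (fun y => G y i j) x)
  have h1 : (fun m => christoffel G m i j x) = ((G x)⁻¹).mulVec K := by
    ext m
    simp only [christoffel, Matrix.mulVec, dotProduct, K, Finset.mul_sum]
    exact Finset.sum_congr rfl fun l _ => by ring
  have h2 : (G x).mulVec (fun m => christoffel G m i j x) = K := by
    rw [h1, Matrix.mulVec_mulVec, hG.mul_inv hx, Matrix.one_mulVec]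
  exact congrFun h2 c

/-- Compatibility `∇g = 0`; together with symmetry in the lower indices it characterises the
connection. -/
theorem IsMetricOn.mpd_metric (hG : IsMetricOn G U) (hU : IsOpen U) (hx : x ∈ U) (a : Fin d) :
    mpd a G x = (conn G a x).transpose * G x + G x * conn G a x := by
  have hs : ∀ a i j, pd a (fun y => G y i j) x = pd a (fun y => G y j i) x := fun a i j =>
    pd_congr_of_eqOn hU hx (fun y hy => hG.symm hy i j) a
  ext b c
  have h1 : ((conn G a x).transpose * G x) b c = ∑ m, G x c m * christoffel G m a b x := by
    simp only [Matrix.mul_apply, Matrix.transpose_apply, conn_apply]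
    exact Finset.sum_congr rfl fun m _ => by rw [hG.symm hx m c]; ring
  have h2 : (G x * conn G a x) b c = ∑ m, G x b m * christoffel G m a c x := rfl
  rw [Matrix.add_apply, h1, h2, hG.lower_christoffel hx, hG.lower_christoffel hx, mpd_apply,
    hs a c b]
  ring

/-- Uniqueness of the Levi-Civita connection. -/
theorem IsMetricOn.conn_unique (hG : IsMetricOn G U) (hx : x ∈ U)
    {Γ : Fin d → Matrix (Fin d) (Fin d) ℝ} (hsymm : ∀ a c e, Γ a c e = Γ e c a)
    (hmetric : ∀ a, mpd a G x = (Γ a).transpose * G x + G x * Γ a) (a : Fin d) :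
    conn G a x = Γ a := by
  have hm : ∀ a b c, pd a (fun y => G y b c) x
      = ∑ m, G x c m * Γ a m b + ∑ m, G x b m * Γ a m c := by
    intro a b c
    have := congrFun (congrFun (hmetric a) b) c
    rw [mpd_apply, Matrix.add_apply, Matrix.mul_apply, Matrix.mul_apply] at this
    rw [this]
    congr 1
    exact Finset.sum_congr rfl fun m _ => by rw [hG.symm hx m c, Matrix.transpose_apply]; ring
  have key : G x * conn G a x = G x * Γ a := by
    ext c e
    have h2 : (G x * conn G a x) c e = ∑ m, G x c m * christoffel G m a e x := rfl
    rw [h2, hG.lower_christoffel hx, hm, hm, hm, Matrix.mul_apply]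
    have e1 : ∀ i j k : Fin d, ∑ m, G x k m * Γ i m j = ∑ m, G x k m * Γ j m i :=
      fun i j k => Finset.sum_congr rfl fun m _ => by rw [hsymm]
    rw [e1 e a c, e1 e c a, e1 c a e]
    ring
  exact hG.mul_left_cancel hx key

theorem IsMetricOn.smooth_christoffel (hG : IsMetricOn G U) (hU : IsOpen U) (k i j : Fin d) :
    SmoothOn U (christoffel G k i j) := by
  unfold christoffel
  refine contDiffOn_const.mul (SmoothOn.sum fun l _ => (hG.smooth_inv k l).mul ?_)
  exact (((hG.smooth _ _).pd hU _).add ((hG.smooth _ _).pd hU _)).sub ((hG.smooth _ _).pd hU _)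

theorem IsMetricOn.smooth_conn (hG : IsMetricOn G U) (hU : IsOpen U) (a : Fin d) :
    MSmoothOn U (conn G a) := fun c e => hG.smooth_christoffel hU c a e

theorem IsMetricOn.smooth_riemannUp (hG : IsMetricOn G U) (hU : IsOpen U) (a b c e : Fin d) :
    SmoothOn U (riemannUp G a b c e) := by
  unfold riemannUp
  have h := hG.smooth_christoffel hU
  exact (((h _ _ _).pd hU _).sub ((h _ _ _).pd hU _)).add
    (SmoothOn.sum fun m _ => ((h _ _ _).mul (h _ _ _)).sub ((h _ _ _).mul (h _ _ _)))

theorem IsMetricOn.smooth_curv (hG : IsMetricOn G U) (hU : IsOpen U) (a b : Fin d) :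
    MSmoothOn U (curv G a b) := fun c e => hG.smooth_riemannUp hU a b c e

theorem IsMetricOn.smooth_ricci (hG : IsMetricOn G U) (hU : IsOpen U) (a b : Fin d) :
    SmoothOn U (ricci G a b) :=
  SmoothOn.sum fun _ _ => hG.smooth_riemannUp hU _ _ _ _

theorem IsMetricOn.smooth_trace (hG : IsMetricOn G U)
    {T : Fin d → Fin d → Coord d → ℝ} (hT : ∀ a b, SmoothOn U (T a b)) :
    SmoothOn U (trace G T) :=
  SmoothOn.sum fun _ _ => SmoothOn.sum fun _ _ => (hG.smooth_inv _ _).mul (hT _ _)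

theorem IsMetricOn.smooth_scal (hG : IsMetricOn G U) (hU : IsOpen U) :
    SmoothOn U (scal G) :=
  hG.smooth_trace (hG.smooth_ricci hU)

theorem IsMetricOn.smooth_schoutenTrace (hG : IsMetricOn G U) (hU : IsOpen U) :
    SmoothOn U (schoutenTrace G) :=
  (hG.smooth_scal hU).div_const _

theorem IsMetricOn.smooth_schouten (hG : IsMetricOn G U) (hU : IsOpen U) (a b : Fin d) :
    SmoothOn U (schouten G a b) :=
  ((hG.smooth_ricci hU a b).sub ((hG.smooth_schoutenTrace hU).mul (hG.smooth a b))).div_const _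

/-- The curvature endomorphisms are skew with respect to the metric. -/
theorem IsMetricOn.curv_skew (hG : IsMetricOn G U) (hU : IsOpen U) (hx : x ∈ U) (a b : Fin d) :
    G x * curv G a b x = -((curv G a b x).transpose * G x) := by
  have hc := hG.smooth_conn hU
  -- Compatibility applied twice expresses second derivatives of `G` through the connection. Their
  -- antisymmetrisation is zero, and what it leaves is the curvature acting on both slots of `G`.
  have h2 : ∀ a b, mpd a (mpd b G) x =
      (mpd a (conn G b) x).transpose * G x
        + (conn G b x).transpose * ((conn G a x).transpose * G x + G x * conn G a x)
      + (((conn G a x).transpose * G x + G x * conn G a x) * conn G b x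
        + G x * mpd a (conn G b) x) := by
    intro a b
    rw [mpd_congr_of_eqOn hU hx (fun y hy => hG.mpd_metric hU hy b) a,
      mpd_add hU hx ((hc b).transpose.mul hG.smooth) (hG.smooth.mul (hc b)),
      mpd_mul hU hx (hc b).transpose hG.smooth, mpd_mul hU hx hG.smooth (hc b),
      hG.mpd_metric hU hx a, mpd_transpose]
  have h3 := mpd_comm hU hx hG.smooth a b
  rw [h2 a b, h2 b a, ← sub_eq_zero] at h3
  rw [eq_neg_iff_add_eq_zero, ← h3, curv_eq]
  simp only [Matrix.transpose_add, Matrix.transpose_sub, Matrix.transpose_mul]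
  noncomm_ring

/-- The second Bianchi identity. -/
theorem IsMetricOn.second_bianchi (hG : IsMetricOn G U) (hU : IsOpen U) (hx : x ∈ U)
    (a b c : Fin d) :
    (mpd a (curv G b c) x + conn G a x * curv G b c x - curv G b c x * conn G a x)
    + (mpd b (curv G c a) x + conn G b x * curv G c a x - curv G c a x * conn G b x)
    + (mpd c (curv G a b) x + conn G c x * curv G a b x - curv G a b x * conn G c x) = 0 := by
  have hc := hG.smooth_conn hU
  have h1 : ∀ a b c, mpd a (curv G b c) x = mpd a (mpd b (conn G c)) x
      - mpd a (mpd c (conn G b)) x + ((mpd a (conn G b) x * conn G c x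
        + conn G b x * mpd a (conn G c) x) - (mpd a (conn G c) x * conn G b x
        + conn G c x * mpd a (conn G b) x)) := by
    intro a b c
    rw [mpd_congr_of_eqOn hU hx (fun y _ => curv_eq b c) a,
      mpd_add hU hx (((hc c).mpd hU b).sub ((hc b).mpd hU c))
        (((hc b).mul (hc c)).sub ((hc c).mul (hc b))),
      mpd_sub hU hx ((hc c).mpd hU b) ((hc b).mpd hU c),
      mpd_sub hU hx ((hc b).mul (hc c)) ((hc c).mul (hc b)),
      mpd_mul hU hx (hc b) (hc c), mpd_mul hU hx (hc c) (hc b)]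
  -- Second derivatives of `Γ` cancel by symmetry of partials, the cubic terms by the Jacobi
  -- identity.
  rw [h1, h1, h1, curv_eq, curv_eq, curv_eq, mpd_comm hU hx (hc c) b a,
    mpd_comm hU hx (hc b) c a, mpd_comm hU hx (hc a) c b]
  noncomm_ring

/-- The first Bianchi identity. -/
theorem IsMetricOn.first_bianchi (hG : IsMetricOn G U) (hU : IsOpen U) (hx : x ∈ U)
    (a b c e : Fin d) :
    riemannUp G a b c e x + riemannUp G b e c a x + riemannUp G e a c b x = 0 := by
  have hp : ∀ a k i j, pd a (christoffel G k i j) x = pd a (christoffel G k j i) x :=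
    fun a k i j => pd_congr_of_eqOn hU hx (fun y hy => hG.christoffel_symm hU hy k i j) a
  unfold riemannUp
  rw [hp a c b e, hp b c a e, hp e c a b]
  simp only [Finset.sum_sub_distrib]
  have hs : ∀ a b e : Fin d, ∑ m, christoffel G c a m x * christoffel G m b e x
      = ∑ m, christoffel G c a m x * christoffel G m e b x := fun a b e =>
    Finset.sum_congr rfl fun m _ => by rw [hG.christoffel_symm hU hx m b e]
  rw [hs a b e, hs b a e, hs e b a]
  ring

/-- `mpd` of the inverse metric. -/
theorem IsMetricOn.mpd_inv (hG : IsMetricOn G U) (hU : IsOpen U) (hx : x ∈ U) (a : Fin d) :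
    mpd a (fun y => (G y)⁻¹) x =
      -(conn G a x * (G x)⁻¹ + (G x)⁻¹ * (conn G a x).transpose) := by
  have h := mpd_mul hU hx hG.smooth hG.smooth_inv a
  rw [mpd_congr_of_eqOn hU hx (fun y hy => hG.mul_inv hy) a, mpd_const,
    hG.mpd_metric hU hx a] at h
  apply hG.mul_left_cancel hx
  have h' := eq_neg_of_add_eq_zero_right h.symm
  rw [h', add_mul, mul_assoc, hG.mul_inv hx, mul_neg, mul_add, ← mul_assoc, ← mul_assoc (G x),
    hG.mul_inv hx]
  noncomm_ring

end Connection

/-! ### The contracted Bianchi identity -/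

section Bianchi

variable {d : ℕ} {U : Set (Coord d)} {x : Coord d} {G : Coord d → Matrix (Fin d) (Fin d) ℝ}

theorem sum_sum_eq_zero_of_skew {ι : Type*} [Fintype ι] {A : ι → ι → ℝ}
    (h : ∀ i j, A j i = -A i j) : ∑ i, ∑ j, A i j = 0 := by
  have h1 : ∑ i, ∑ j, A i j = -∑ i, ∑ j, A i j := by
    conv_lhs => rw [Finset.sum_comm]
    simp only [← Finset.sum_neg_distrib]
    exact Finset.sum_congr rfl fun i _ => Finset.sum_congr rfl fun j _ => h i j
  linarith

/-- The algebra behind the contracted Bianchi identity: `w` stands for the curvature with two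
indices raised, `dw` for its derivatives and `γ` for the Christoffel symbols. -/
theorem contract_bianchi {ι : Type*} [Fintype ι] {w : ι → ι → ι → ι → ℝ}
    {dw : ι → ι → ι → ι → ι → ℝ} {γ : ι → ι → ι → ℝ}
    (hw1 : ∀ a b i j, w b a i j = -w a b i j) (hw2 : ∀ a b i j, w a b j i = -w a b i j)
    (hdw1 : ∀ f a b i j, dw f b a i j = -dw f a b i j)
    (hdw2 : ∀ f a b i j, dw f a b j i = -dw f a b i j)
    (hγ : ∀ k i j, γ k i j = γ k j i)
    (hB : ∀ f a b i j,
      (dw f a b i j + ∑ m, γ i f m * w a b m j + ∑ m, w a b i m * γ j f m)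
      + (dw a b f i j + ∑ m, γ i a m * w b f m j + ∑ m, w b f i m * γ j a m)
      + (dw b f a i j + ∑ m, γ i b m * w f a m j + ∑ m, w f a i m * γ j b m) = 0) (a : ι) :
    2 * (∑ f, ∑ b, dw f b a b f + ∑ f, ∑ m, γ f f m * ∑ b, w b a b m
      - ∑ f, ∑ m, γ f a m * ∑ b, w b f b m) = ∑ f, ∑ b, dw a b f b f := by
  -- The Bianchi identity contracted with `i = f` and `j = b`. Terms pairing a symmetric `γ` with a
  -- skew `w` vanish; of the rest, the first and third groups each give the divergence of Ricci and
  -- the middle one minus the derivative of its trace.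
  have hS : ∑ f, ∑ b, ((dw f a b f b + ∑ m, γ f f m * w a b m b + ∑ m, w a b f m * γ b f m)
      + (dw a b f f b + ∑ m, γ f a m * w b f m b + ∑ m, w b f f m * γ b a m)
      + (dw b f a f b + ∑ m, γ f b m * w f a m b + ∑ m, w f a f m * γ b b m)) = 0 :=
    Finset.sum_eq_zero fun f _ => Finset.sum_eq_zero fun b _ => hB f a b f b
  simp only [Finset.sum_add_distrib] at hS
  have t1 : ∑ f, ∑ b, dw f a b f b = ∑ f, ∑ b, dw f b a b f :=
    Finset.sum_congr rfl fun f _ => Finset.sum_congr rfl fun b _ => by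
      rw [hdw1 f b a, hdw2 f b a b f, neg_neg]
  have t1' : ∑ f, ∑ b, ∑ m, γ f f m * w a b m b = ∑ f, ∑ m, γ f f m * ∑ b, w b a b m := by
    refine Finset.sum_congr rfl fun f _ => ?_
    rw [Finset.sum_comm]
    refine Finset.sum_congr rfl fun m _ => ?_
    rw [Finset.mul_sum]
    exact Finset.sum_congr rfl fun b _ => by rw [hw1 b a, hw2 b a b m, neg_neg]
  have t1'' : ∑ f, ∑ b, ∑ m, w a b f m * γ b f m = 0 := by
    rw [Finset.sum_comm]
    refine Finset.sum_eq_zero fun b _ => sum_sum_eq_zero_of_skew fun f m => ?_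
    rw [hw2 a b f m, hγ b m f]; ring
  have t2 : ∑ f, ∑ b, dw a b f f b = -∑ f, ∑ b, dw a b f b f := by
    simp only [← Finset.sum_neg_distrib]
    exact Finset.sum_congr rfl fun f _ => Finset.sum_congr rfl fun b _ => hdw2 _ _ _ _ _
  have t2' : ∑ f, ∑ b, ∑ m, γ f a m * w b f m b = -∑ f, ∑ m, γ f a m * ∑ b, w b f b m := by
    simp only [← Finset.sum_neg_distrib]
    refine Finset.sum_congr rfl fun f _ => ?_
    rw [Finset.sum_comm]
    refine Finset.sum_congr rfl fun m _ => ?_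
    rw [Finset.mul_sum, ← Finset.sum_neg_distrib]
    exact Finset.sum_congr rfl fun b _ => by rw [hw2 b f b m]; ring
  have t2'' : ∑ f, ∑ b, ∑ m, w b f f m * γ b a m = -∑ f, ∑ m, γ f a m * ∑ b, w b f b m := by
    rw [Finset.sum_comm]
    simp only [← Finset.sum_neg_distrib]
    refine Finset.sum_congr rfl fun f _ => ?_
    rw [Finset.sum_comm]
    refine Finset.sum_congr rfl fun m _ => ?_
    rw [Finset.mul_sum, ← Finset.sum_neg_distrib]
    exact Finset.sum_congr rfl fun b _ => by rw [hw1 b f b m]; ring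
  have t3 : ∑ f, ∑ b, dw b f a f b = ∑ f, ∑ b, dw f b a b f := Finset.sum_comm
  have t3' : ∑ f, ∑ b, ∑ m, γ f b m * w f a m b = 0 := by
    refine Finset.sum_eq_zero fun f _ => sum_sum_eq_zero_of_skew fun b m => ?_
    rw [hw2 f a b m, hγ f m b]; ring
  have t3'' : ∑ f, ∑ b, ∑ m, w f a f m * γ b b m = ∑ f, ∑ m, γ f f m * ∑ b, w b a b m := by
    rw [Finset.sum_comm]
    refine Finset.sum_congr rfl fun f _ => ?_
    rw [Finset.sum_comm]
    refine Finset.sum_congr rfl fun m _ => ?_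
    rw [Finset.mul_sum]
    exact Finset.sum_congr rfl fun b _ => by ring
  rw [t1, t1', t1'', t2, t2', t2'', t3, t3', t3''] at hS
  linarith

/-- By skewness the curvature endomorphism is conjugate to minus its transpose, so its trace is its
own negative. -/
theorem IsMetricOn.trace_curv (hG : IsMetricOn G U) (hU : IsOpen U) (hx : x ∈ U) (a b : Fin d) :
    ∑ c, riemannUp G a b c c x = 0 := by
  have h : curv G a b x = -((G x)⁻¹ * (curv G a b x).transpose * G x) := by
    apply hG.mul_left_cancel hx
    rw [hG.curv_skew hU hx, mul_neg, ← mul_assoc, ← mul_assoc, hG.mul_inv hx, one_mul]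
  have h2 := congrArg Matrix.trace h
  rw [Matrix.trace_neg, Matrix.trace_mul_comm, ← mul_assoc, hG.mul_inv hx, one_mul,
    Matrix.trace_transpose] at h2
  have : Matrix.trace (curv G a b x) = 0 := by linarith
  exact this

/-- Contraction of the first Bianchi identity; the middle term is the trace of a curvature
endomorphism and drops out. -/
theorem IsMetricOn.ricci_symm (hG : IsMetricOn G U) (hU : IsOpen U) (hx : x ∈ U) (a b : Fin d) :
    ricci G a b x = ricci G b a x := by
  have h := Finset.sum_eq_zero (s := Finset.univ) fun c _ => hG.first_bianchi hU hx c a c b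
  simp only [Finset.sum_add_distrib] at h
  rw [hG.trace_curv hU hx] at h
  have h3 : ∑ c, riemannUp G b c c a x = -ricci G b a x := by
    rw [ricci, ← Finset.sum_neg_distrib]
    exact Finset.sum_congr rfl fun c _ => riemannUp_swap c b c a
  rw [h3] at h
  change ricci G a b x + 0 + -ricci G b a x = 0 at h
  linarith

theorem IsMetricOn.schouten_symm (hG : IsMetricOn G U) (hU : IsOpen U) (hx : x ∈ U)
    (a b : Fin d) : schouten G a b x = schouten G b a x := by
  rw [schouten, schouten, hG.ricci_symm hU hx a b, hG.symm hx a b]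

/-- The matrix of the Ricci tensor. -/
noncomputable def ricciMat (G : Coord d → Matrix (Fin d) (Fin d) ℝ) (x : Coord d) :
    Matrix (Fin d) (Fin d) ℝ := Matrix.of fun a b => ricci G a b x

/-- The divergence `∇_f T_a{}^f` of a tensor with one index up. -/
noncomputable def divMixed (G : Coord d → Matrix (Fin d) (Fin d) ℝ)
    (Q : Coord d → Matrix (Fin d) (Fin d) ℝ) (a : Fin d) (x : Coord d) : ℝ :=
  ∑ f, pd f (fun y => Q y a f) x + ∑ f, ∑ m, christoffel G f f m x * Q x a m
    - ∑ f, ∑ m, christoffel G f a m x * Q x f m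

/-- The contracted Bianchi identity. -/
theorem IsMetricOn.contracted_bianchi (hG : IsMetricOn G U) (hU : IsOpen U) (hx : x ∈ U)
    (a : Fin d) :
    2 * divMixed G (fun y => ricciMat G y * (G y)⁻¹) a x = pd a (scal G) x := by
  -- Raising the second endomorphism index makes the curvature skew in both pairs, as
  -- `contract_bianchi` requires.
  set W : Fin d → Fin d → Coord d → Matrix (Fin d) (Fin d) ℝ :=
    fun a b y => curv G a b y * (G y)⁻¹ with hW
  have hWs : ∀ a b, MSmoothOn U (W a b) := fun a b => (hG.smooth_curv hU a b).mul hG.smooth_inv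
  have hWT : ∀ a b, ∀ y ∈ U, (W a b y).transpose = -W a b y := by
    intro a b y hy
    apply hG.mul_left_cancel hy
    simp only [hW]
    rw [Matrix.transpose_mul, hG.inv_transpose hy, ← mul_assoc, hG.mul_inv hy, one_mul, mul_neg,
      ← mul_assoc, hG.curv_skew hU hy, neg_mul, neg_neg, mul_assoc, hG.mul_inv hy, mul_one]
  have hW1 : ∀ a b i j, ∀ y, W b a y i j = -W a b y i j := by
    intro a b i j y
    simp only [hW, curv_swap a b, neg_mul, Matrix.neg_apply]
  have hW2 : ∀ a b i j, ∀ y ∈ U, W a b y j i = -W a b y i j := by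
    intro a b i j y hy
    exact congrFun (congrFun (hWT a b y hy) i) j
  -- The inverse metric is parallel, so raising the index commutes with covariant differentiation
  -- and the second Bianchi identity passes to `W`.
  have hWB : ∀ f a b,
      (mpd f (W a b) x + conn G f x * W a b x + W a b x * (conn G f x).transpose)
      = (mpd f (curv G a b) x + conn G f x * curv G a b x - curv G a b x * conn G f x)
        * (G x)⁻¹ := by
    intro f a b
    simp only [hW]
    rw [mpd_mul hU hx (hG.smooth_curv hU a b) hG.smooth_inv, hG.mpd_inv hU hx]
    noncomm_ring
  have hQ : ∀ a f y, (ricciMat G y * (G y)⁻¹) a f = ∑ b, W b a y b f := by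
    intro a f y
    simp only [hW, Matrix.mul_apply, ricciMat, Matrix.of_apply, ricci, Finset.sum_mul,
      curv_apply]
    exact Finset.sum_comm
  have hscal : Set.EqOn (scal G) (fun y => ∑ f, ∑ b, W b f y b f) U := by
    intro y hy
    simp only [← hQ, Matrix.mul_apply, scal, trace, ricciMat, Matrix.of_apply]
    exact Finset.sum_congr rfl fun f _ => Finset.sum_congr rfl fun b _ => by
      rw [hG.inv_symm hy f b, mul_comm]
  have key := contract_bianchi (w := fun a b i j => W a b x i j)
    (dw := fun f a b i j => pd f (fun y => W a b y i j) x)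
    (γ := fun k i j => christoffel G k i j x)
    (fun a b i j => hW1 a b i j x) (fun a b i j => hW2 a b i j x hx)
    (fun f a b i j => by
      rw [← pd_neg]; exact pd_congr_of_eqOn hU hx (fun y _ => hW1 a b i j y) f)
    (fun f a b i j => by
      rw [← pd_neg]; exact pd_congr_of_eqOn hU hx (fun y hy => hW2 a b i j y hy) f)
    (hG.christoffel_symm hU hx)
    (fun f a b i j => by
      have h := congrArg (· * (G x)⁻¹) (hG.second_bianchi hU hx f a b)
      simp only [add_mul, zero_mul] at h
      rw [← hWB, ← hWB, ← hWB] at h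
      have h' := congrFun (congrFun h i) j
      simpa only [Matrix.add_apply, Matrix.mul_apply, mpd_apply, conn_apply,
        Matrix.transpose_apply, Matrix.zero_apply] using h') a
  have hd : ∀ a b i j, DifferentiableAt ℝ (fun y => W a b y i j) x :=
    fun a b i j => (hWs a b i j).differentiableAt hU hx
  rw [pd_congr_of_eqOn hU hx hscal,
    pd_sum (fun f _ => DifferentiableAt.fun_sum fun b _ => hd _ _ _ _)]
  simp only [divMixed, hQ]
  rw [Finset.sum_congr rfl fun f _ => pd_sum (fun b _ => hd b a b f) f, key]
  exact Finset.sum_congr rfl fun f _ => (pd_sum (fun b _ => hd b f b f) a).symm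

end Bianchi

/-! ### The Schouten tensor and the almost Einstein equation -/

section AlmostEinsteinEquation

variable {d : ℕ} {U : Set (Coord d)} {x : Coord d} {G : Coord d → Matrix (Fin d) (Fin d) ℝ}
  {u : Coord d → ℝ}

/-- The matrix of the Schouten tensor. -/
noncomputable def schoutenMat (G : Coord d → Matrix (Fin d) (Fin d) ℝ) (x : Coord d) :
    Matrix (Fin d) (Fin d) ℝ := Matrix.of fun a b => schouten G a b x

/-- The matrix `(P^k{}_c)_{kc}` of the Schouten endomorphism. -/
noncomputable def schoutenUp (G : Coord d → Matrix (Fin d) (Fin d) ℝ) (x : Coord d) :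
    Matrix (Fin d) (Fin d) ℝ := (G x)⁻¹ * schoutenMat G x

@[simp] theorem schoutenMat_apply (a b : Fin d) : schoutenMat G x a b = schouten G a b x := rfl

theorem IsMetricOn.smooth_schoutenMat (hG : IsMetricOn G U) (hU : IsOpen U) :
    MSmoothOn U (schoutenMat G) := hG.smooth_schouten hU

theorem IsMetricOn.smooth_schoutenUp (hG : IsMetricOn G U) (hU : IsOpen U) :
    MSmoothOn U (schoutenUp G) := hG.smooth_inv.mul (hG.smooth_schoutenMat hU)

theorem IsMetricOn.schoutenMat_transpose (hG : IsMetricOn G U) (hU : IsOpen U) (hx : x ∈ U) :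
    (schoutenMat G x).transpose = schoutenMat G x := by
  ext a b
  exact hG.schouten_symm hU hx b a

theorem IsMetricOn.mul_schoutenUp (hG : IsMetricOn G U) (hx : x ∈ U) :
    G x * schoutenUp G x = schoutenMat G x := by
  rw [schoutenUp, ← mul_assoc, hG.mul_inv hx, one_mul]

theorem IsMetricOn.trace_metric (hG : IsMetricOn G U) (hx : x ∈ U) :
    trace G (fun a b y => G y a b) x = d := by
  have h := congrArg Matrix.trace (hG.inv_mul hx)
  rw [Matrix.trace_one, Fintype.card_fin] at h
  rw [← h]
  simp only [trace, Matrix.trace, Matrix.diag, Matrix.mul_apply]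
  exact Finset.sum_congr rfl fun a _ => Finset.sum_congr rfl fun b _ => by rw [hG.symm hx a b]

theorem trace_add (T T' : Fin d → Fin d → Coord d → ℝ) :
    trace G (fun a b y => T a b y + T' a b y) x = trace G T x + trace G T' x := by
  simp only [trace, mul_add, Finset.sum_add_distrib]

theorem trace_mul (f : Coord d → ℝ) (T : Fin d → Fin d → Coord d → ℝ) :
    trace G (fun a b y => f y * T a b y) x = f x * trace G T x := by
  simp only [trace, Finset.mul_sum]
  exact Finset.sum_congr rfl fun a _ => Finset.sum_congr rfl fun b _ => by ring

theorem scal_eq_schoutenTrace (hd : 3 ≤ d) :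
    scal G x = 2 * ((d : ℝ) - 1) * schoutenTrace G x := by
  have hd' : (3 : ℝ) ≤ d := by exact_mod_cast hd
  rw [schoutenTrace]
  field_simp [show (d : ℝ) - 1 ≠ 0 by linarith]

theorem ricci_eq_schouten (hd : 3 ≤ d) (a b : Fin d) :
    ricci G a b x = ((d : ℝ) - 2) * schouten G a b x + schoutenTrace G x * G x a b := by
  have hd' : (3 : ℝ) ≤ d := by exact_mod_cast hd
  rw [schouten]
  field_simp [show (d : ℝ) - 2 ≠ 0 by linarith]
  ring

/-- The trace of `Ric = (d-2)P + Jg` is `2(d-1)J = (d-2) tr P + dJ`, and `d - 2` cancels. -/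
theorem IsMetricOn.trace_schouten (hG : IsMetricOn G U) (hd : 3 ≤ d) (hx : x ∈ U) :
    trace G (schouten G) x = schoutenTrace G x := by
  have hd' : (3 : ℝ) ≤ d := by exact_mod_cast hd
  have h1 : scal G x = ((d : ℝ) - 2) * trace G (schouten G) x + schoutenTrace G x * d := by
    have e : schoutenTrace G x * d = schoutenTrace G x * trace G (fun a b y => G y a b) x := by
      rw [hG.trace_metric hx]
    rw [e, ← trace_mul (fun _ => (d : ℝ) - 2), ← trace_mul, ← trace_add]
    simp only [scal, trace, ricci_eq_schouten hd]
  rw [scal_eq_schoutenTrace hd] at h1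
  have h2 : ((d : ℝ) - 2) * (trace G (schouten G) x - schoutenTrace G x) = 0 := by linarith
  rcases mul_eq_zero.1 h2 with h | h <;> linarith

theorem IsMetricOn.trace_schoutenUp (hG : IsMetricOn G U) (hU : IsOpen U) (hd : 3 ≤ d)
    (hx : x ∈ U) : ∑ k, schoutenUp G x k k = schoutenTrace G x := by
  rw [← hG.trace_schouten hd hx]
  simp only [trace, schoutenUp, Matrix.mul_apply]
  exact Finset.sum_congr rfl fun a _ => Finset.sum_congr rfl fun b _ => by
    rw [schoutenMat_apply, hG.schouten_symm hU hx b a]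

theorem IsMetricOn.ricciMat_mul_inv (hG : IsMetricOn G U) (hU : IsOpen U) (hd : 3 ≤ d)
    (hx : x ∈ U) : ricciMat G x * (G x)⁻¹
      = ((d : ℝ) - 2) • (schoutenUp G x).transpose + schoutenTrace G x • 1 := by
  have h1 : ricciMat G x = ((d : ℝ) - 2) • schoutenMat G x + schoutenTrace G x • G x := by
    ext a b
    exact ricci_eq_schouten hd a b
  rw [h1, schoutenUp, Matrix.transpose_mul, hG.inv_transpose hx, hG.schoutenMat_transpose hU hx,
    add_mul, smul_mul_assoc, smul_mul_assoc, hG.mul_inv hx]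

/-- The divergence of the Schouten tensor is the differential of its trace. -/
theorem IsMetricOn.div_schoutenUp (hG : IsMetricOn G U) (hU : IsOpen U) (hd : 3 ≤ d) (hx : x ∈ U)
    (a : Fin d) :
    divMixed G (fun y => (schoutenUp G y).transpose) a x = pd a (schoutenTrace G) x := by
  have hd' : (3 : ℝ) ≤ d := by exact_mod_cast hd
  have hP := hG.smooth_schoutenUp hU
  have hJ := hG.smooth_schoutenTrace hU
  have h := hG.contracted_bianchi hU hx a
  have h1 : divMixed G (fun y => ricciMat G y * (G y)⁻¹) a x
      = ((d : ℝ) - 2) * divMixed G (fun y => (schoutenUp G y).transpose) a x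
        + pd a (schoutenTrace G) x := by
    have e : ∀ y ∈ U, ∀ a f, (ricciMat G y * (G y)⁻¹) a f
        = ((d : ℝ) - 2) * schoutenUp G y f a
          + schoutenTrace G y * (1 : Matrix (Fin d) (Fin d) ℝ) a f := by
      intro y hy a f
      rw [hG.ricciMat_mul_inv hU hd hy]
      simp
    have e1 : ∀ f, pd f (fun y => (ricciMat G y * (G y)⁻¹) a f) x
        = ((d : ℝ) - 2) * pd f (fun y => schoutenUp G y f a) x
          + pd f (schoutenTrace G) x * (1 : Matrix (Fin d) (Fin d) ℝ) a f := by
      intro f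
      rw [pd_congr_of_eqOn hU hx (fun y hy => e y hy a f), pd_add, pd_const_mul, pd_mul]
      · simp
      · exact hJ.differentiableAt hU hx
      · fun_prop
      · exact (hP f a).differentiableAt hU hx
      · exact ((hP f a).differentiableAt hU hx).const_mul _
      · exact (hJ.differentiableAt hU hx).mul_const _
    simp only [divMixed, e1, e x hx, Matrix.transpose_apply, mul_add, Finset.sum_add_distrib,
      Matrix.one_apply, mul_ite, mul_one, mul_zero, Finset.sum_ite_eq, Finset.mem_univ, if_true,
      mul_sub, Finset.mul_sum]
    -- The part `Jδ` contributes exactly `dJ` to the divergence: its two Christoffel terms cancel by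
    -- symmetry in the lower indices.
    have e2 : ∑ f, ∑ m, christoffel G f a m x * (if f = m then schoutenTrace G x else 0)
        = ∑ f, christoffel G f f a x * schoutenTrace G x := by
      refine Finset.sum_congr rfl fun f _ => ?_
      rw [hG.christoffel_symm hU hx f f a]
      simp
    simp only [mul_ite, mul_zero, Finset.sum_ite_eq, Finset.mem_univ, if_true] at e2 ⊢
    rw [e2]
    have e3 : ∀ F : Fin d → Fin d → ℝ, ∀ H : Fin d → Fin d → ℝ,
        ∑ f, ∑ m, F f m * (((d : ℝ) - 2) * H f m) = ∑ f, ∑ m, ((d : ℝ) - 2) * (F f m * H f m) :=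
      fun F H => Finset.sum_congr rfl fun f _ => Finset.sum_congr rfl fun m _ => by ring
    rw [e3 (fun f m => christoffel G f f m x) (fun f m => schoutenUp G x m a),
      e3 (fun f m => christoffel G f a m x) (fun f m => schoutenUp G x m f)]
    ring
  have h2 : pd a (scal G) x = 2 * ((d : ℝ) - 1) * pd a (schoutenTrace G) x := by
    rw [pd_congr_of_eqOn hU hx (fun y _ => scal_eq_schoutenTrace hd) a,
      pd_const_mul (hJ.differentiableAt hU hx)]
  -- The contracted Bianchi identity now reads `2((d-2) div P + dJ) = 2(d-1) dJ`; cancelling `d - 2`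
  -- gives the claim.
  rw [h1, h2] at h
  have h3 : ((d : ℝ) - 2) * (divMixed G (fun y => (schoutenUp G y).transpose) a x
      - pd a (schoutenTrace G) x) = 0 := by linarith
  rcases mul_eq_zero.1 h3 with h | h <;> linarith

/-- The Cotton tensor with its first index raised. -/
noncomputable def cottonUp (G : Coord d → Matrix (Fin d) (Fin d) ℝ) (k a b : Fin d)
    (x : Coord d) : ℝ :=
  (mpd a (schoutenUp G) x + conn G a x * schoutenUp G x) k b
    - (mpd b (schoutenUp G) x + conn G b x * schoutenUp G x) k a

/-- Lowering commutes with `∇` because the metric is parallel. The Christoffel term missing from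
`cottonUp` is symmetric in the two skew indices and would cancel anyway. -/
theorem IsMetricOn.lower_cottonUp (hG : IsMetricOn G U) (hU : IsOpen U) (hx : x ∈ U)
    (c a b : Fin d) : ∑ k, G x c k * cottonUp G k a b x = cotton G c a b x := by
  have hP := hG.smooth_schoutenUp hU
  have h1 : ∀ a, G x * (mpd a (schoutenUp G) x + conn G a x * schoutenUp G x)
      = mpd a (schoutenMat G) x - (conn G a x).transpose * schoutenMat G x := by
    intro a
    have h := mpd_mul hU hx hG.smooth hP a
    rw [mpd_congr_of_eqOn hU hx (fun y hy => hG.mul_schoutenUp hy) a, hG.mpd_metric hU hx] at h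
    rw [h, ← hG.mul_schoutenUp hx]
    noncomm_ring
  have h2 : ∑ k, G x c k * cottonUp G k a b x
      = (mpd a (schoutenMat G) x - (conn G a x).transpose * schoutenMat G x) c b
        - (mpd b (schoutenMat G) x - (conn G b x).transpose * schoutenMat G x) c a := by
    rw [← h1, ← h1, Matrix.mul_apply, Matrix.mul_apply, ← Finset.sum_sub_distrib]
    exact Finset.sum_congr rfl fun k _ => by rw [cottonUp]; ring
  rw [h2, cotton, cov2, cov2]
  simp only [Matrix.sub_apply, mpd_apply, schoutenMat_apply, Matrix.mul_apply,
    Matrix.transpose_apply, conn_apply, Finset.sum_add_distrib]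
  have hs : ∀ f a b, pd f (schouten G a b) x = pd f (schouten G b a) x := fun f a b =>
    pd_congr_of_eqOn hU hx (fun y hy => hG.schouten_symm hU hy a b) f
  have e1 : ∀ a b c, ∑ m, christoffel G m a b x * schouten G m c x
      = ∑ m, christoffel G m a b x * schouten G c m x := fun a b c =>
    Finset.sum_congr rfl fun m _ => by rw [hG.schouten_symm hU hx]
  have e2 : ∑ m, christoffel G m b a x * schouten G m c x
      = ∑ m, christoffel G m a b x * schouten G m c x :=
    Finset.sum_congr rfl fun m _ => by rw [hG.christoffel_symm hU hx]
  rw [e2, e1 a c b, e1 b c a, hs a b c, hs b a c]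
  ring

/-- A restatement of `div P = dJ` with `J = tr P`. It removes the Cotton term from the trace that
determines `dρ`, and returns in the proof that the Bach tensor vanishes. -/
theorem IsMetricOn.trace_cottonUp (hG : IsMetricOn G U) (hU : IsOpen U) (hd : 3 ≤ d) (hx : x ∈ U)
    (b : Fin d) : ∑ k, cottonUp G k k b x = 0 := by
  have hP := hG.smooth_schoutenUp hU
  have h1 := hG.div_schoutenUp hU hd hx b
  rw [pd_congr_of_eqOn hU hx (fun y hy => (hG.trace_schoutenUp hU hd hy).symm) b,
    pd_sum (fun k _ => (hP k k).differentiableAt hU hx)] at h1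
  simp only [cottonUp, Finset.sum_sub_distrib, Matrix.add_apply, Finset.sum_add_distrib,
    mpd_apply, Matrix.mul_apply, conn_apply]
  simp only [divMixed, Matrix.transpose_apply] at h1
  linarith

/-- The function `ρ = (Δu - Ju)/d`. -/
noncomputable def rho (G : Coord d → Matrix (Fin d) (Fin d) ℝ) (u : Coord d → ℝ)
    (x : Coord d) : ℝ :=
  (laplacian G u x - schoutenTrace G x * u x) / d

/-- The components `g^{ab} ∂_b u` of the gradient. -/
noncomputable def grad (G : Coord d → Matrix (Fin d) (Fin d) ℝ) (u : Coord d → ℝ)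
    (x : Coord d) : Fin d → ℝ :=
  ((G x)⁻¹).mulVec (fun b => pd b u x)

/-- `u` is a smooth solution of the almost Einstein equation on `U` for the metric `G`. -/
structure IsSolutionOn (G : Coord d → Matrix (Fin d) (Fin d) ℝ) (u : Coord d → ℝ)
    (U : Set (Coord d)) : Prop extends IsMetricOn G U where
  isOpen : IsOpen U
  three_le : 3 ≤ d
  smooth_u : SmoothOn U u
  equation : ∀ x ∈ U, ∀ a b, localA G u a b x = 0

theorem IsSolutionOn.three_le_cast (h : IsSolutionOn G u U) : (3 : ℝ) ≤ d := by
  exact_mod_cast h.three_le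

theorem IsSolutionOn.smooth_hess (h : IsSolutionOn G u U) (a b : Fin d) :
    SmoothOn U (hess G u a b) :=
  ((h.smooth_u.pd h.isOpen b).pd h.isOpen a).sub
    (SmoothOn.sum fun m _ => (h.smooth_christoffel h.isOpen m a b).mul (h.smooth_u.pd h.isOpen m))

theorem IsSolutionOn.smooth_rho (h : IsSolutionOn G u U) : SmoothOn U (rho G u) :=
  (((h.smooth_trace h.smooth_hess).neg).sub
    ((h.smooth_schoutenTrace h.isOpen).mul h.smooth_u)).div_const _

theorem IsSolutionOn.smooth_du (h : IsSolutionOn G u U) : VSmoothOn U (fun y b => pd b u y) :=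
  fun b => h.smooth_u.pd h.isOpen b

theorem IsSolutionOn.smooth_grad (h : IsSolutionOn G u U) : VSmoothOn U (grad G u) :=
  h.smooth_inv.mulVec h.smooth_du

theorem IsMetricOn.lower_grad (hG : IsMetricOn G U) (hx : x ∈ U) :
    (G x).mulVec (grad G u x) = fun b => pd b u x := by
  rw [grad, Matrix.mulVec_mulVec, hG.mul_inv hx, Matrix.one_mulVec]

/-- The trace of `∇∇u + uP` is `-Δu + Ju = -dρ`, which is what the trace-free equation leaves free.
-/
theorem IsSolutionOn.hess_eq (h : IsSolutionOn G u U) (hx : x ∈ U) (a b : Fin d) :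
    hess G u a b x = -(u x * schouten G a b x) - rho G u x * G x a b := by
  have hd := h.three_le_cast
  have h1 := h.equation x hx a b
  rw [localA, traceFree, trace_add, trace_mul, h.trace_schouten h.three_le hx] at h1
  rw [rho, laplacian]
  field_simp at h1 ⊢
  linarith

/-- The covariant derivative of the gradient. -/
theorem IsSolutionOn.cov_grad (h : IsSolutionOn G u U) (hx : x ∈ U) (a : Fin d) :
    vpd a (grad G u) x + (conn G a x).mulVec (grad G u x)
      = fun k => -(u x * schoutenUp G x k a) - rho G u x * (1 : Matrix (Fin d) (Fin d) ℝ) k a := by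
  apply h.mulVec_left_cancel hx
  have h1 := vpd_mulVec h.isOpen hx h.smooth h.smooth_grad a
  rw [vpd_congr_of_eqOn h.isOpen hx (fun y hy => h.lower_grad hy) a,
    h.mpd_metric h.isOpen hx, Matrix.add_mulVec, ← Matrix.mulVec_mulVec,
    ← Matrix.mulVec_mulVec, h.lower_grad hx] at h1
  -- By metric compatibility, lowering the index turns `∇ grad u` into the Hessian, where
  -- `IsSolutionOn.hess_eq` applies.
  have h2 : (G x).mulVec (vpd a (grad G u) x + (conn G a x).mulVec (grad G u x))
      = vpd a (fun y b => pd b u y) x - (conn G a x).transpose.mulVec (fun b => pd b u x) := by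
    rw [h1, Matrix.mulVec_add]
    abel
  rw [h2]
  ext b
  have h3 := h.hess_eq hx a b
  rw [hess] at h3
  have h4 : (vpd a (fun y b => pd b u y) x
      - (conn G a x).transpose.mulVec (fun b => pd b u x)) b
      = pd a (pd b u) x - ∑ m, christoffel G m a b x * pd m u x := rfl
  rw [h4, h3]
  have h5 : (G x).mulVec (fun k => -(u x * schoutenUp G x k a)
      - rho G u x * (1 : Matrix (Fin d) (Fin d) ℝ) k a) b
      = -(u x * (G x * schoutenUp G x) b a)
        - rho G u x * (G x * (1 : Matrix (Fin d) (Fin d) ℝ)) b a := by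
    simp only [Matrix.mulVec, dotProduct, Matrix.mul_apply, Finset.mul_sum,
      ← Finset.sum_neg_distrib, ← Finset.sum_sub_distrib]
    exact Finset.sum_congr rfl fun k _ => by ring
  rw [h5, h.mul_schoutenUp hx, mul_one, schoutenMat_apply, h.symm hx b a,
    h.schouten_symm h.isOpen hx b a]

/-- The Ricci identity `[∇_a, ∇_b]V = R_{ab}V` along coordinate fields. These commute, so no term
with a derivative of `V` survives. -/
theorem vpd_vpd_add_conn (hG : IsMetricOn G U) (hU : IsOpen U) (hx : x ∈ U)
    {V : Coord d → Fin d → ℝ} (hV : VSmoothOn U V) (a b : Fin d) :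
    (curv G a b x).mulVec (V x)
      = (vpd a (fun y => vpd b V y + (conn G b y).mulVec (V y)) x
          + (conn G a x).mulVec (vpd b V x + (conn G b x).mulVec (V x)))
        - (vpd b (fun y => vpd a V y + (conn G a y).mulVec (V y)) x
          + (conn G b x).mulVec (vpd a V x + (conn G a x).mulVec (V x))) := by
  have hc := hG.smooth_conn hU
  rw [vpd_add hU hx (hV.vpd hU b) ((hc b).mulVec hV), vpd_mulVec hU hx (hc b) hV,
    vpd_add hU hx (hV.vpd hU a) ((hc a).mulVec hV), vpd_mulVec hU hx (hc a) hV,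
    vpd_comm hU hx hV a b, curv_eq]
  simp only [Matrix.add_mulVec, Matrix.sub_mulVec, Matrix.mulVec_add, ← Matrix.mulVec_mulVec]
  abel

/-- The curvature acting on the gradient. -/
theorem IsSolutionOn.curv_grad (h : IsSolutionOn G u U) (hx : x ∈ U) (a b k : Fin d) :
    (curv G a b x).mulVec (grad G u x) k
      = -(pd a u x * schoutenUp G x k b - pd b u x * schoutenUp G x k a)
        - u x * cottonUp G k a b x
        - (pd a (rho G u) x * (1 : Matrix (Fin d) (Fin d) ℝ) k b
          - pd b (rho G u) x * (1 : Matrix (Fin d) (Fin d) ℝ) k a) := by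
  have hU := h.isOpen
  have hP := h.smooth_schoutenUp hU
  -- One more covariant derivative of `IsSolutionOn.cov_grad`. The last term `ρ Γ^k_{ab}` is
  -- symmetric in `a, b` and leaves the commutator.
  have key : ∀ a b, (vpd a (fun y => vpd b (grad G u) y + (conn G b y).mulVec (grad G u y)) x
          + (conn G a x).mulVec (vpd b (grad G u) x + (conn G b x).mulVec (grad G u x))) k
      = -(pd a u x * schoutenUp G x k b)
        - u x * (mpd a (schoutenUp G) x + conn G a x * schoutenUp G x) k b
        - pd a (rho G u) x * (1 : Matrix (Fin d) (Fin d) ℝ) k b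
        - rho G u x * christoffel G k a b x := by
    intro a b
    have d1 := h.smooth_u.differentiableAt hU hx
    have d2 := (hP k b).differentiableAt hU hx
    have d3 := h.smooth_rho.differentiableAt hU hx
    rw [vpd_congr_of_eqOn hU hx (fun y hy => h.cov_grad hy b) a, h.cov_grad hx b, Pi.add_apply,
      vpd_apply, pd_sub (d1.fun_mul d2).fun_neg (d3.mul_const _), pd_neg, pd_mul d1 d2,
      pd_mul d3 (by fun_prop), pd_const, Matrix.add_apply, mpd_apply]
    have e : (conn G a x).mulVec (fun k => -(u x * schoutenUp G x k b)
        - rho G u x * (1 : Matrix (Fin d) (Fin d) ℝ) k b) k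
        = -(u x * (conn G a x * schoutenUp G x) k b)
          - rho G u x * (conn G a x * (1 : Matrix (Fin d) (Fin d) ℝ)) k b := by
      simp only [Matrix.mulVec, dotProduct, Matrix.mul_apply, Finset.mul_sum,
        ← Finset.sum_neg_distrib, ← Finset.sum_sub_distrib]
      exact Finset.sum_congr rfl fun k _ => by ring
    rw [e, mul_one, conn_apply]
    ring
  rw [vpd_vpd_add_conn h.toIsMetricOn hU hx h.smooth_grad, Pi.sub_apply, key, key, cottonUp,
    h.christoffel_symm hU hx k b a]
  ring

theorem IsSolutionOn.schoutenUp_du (h : IsSolutionOn G u U) (hx : x ∈ U) (a : Fin d) :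
    ∑ k, pd k u x * schoutenUp G x k a = (schoutenMat G x).mulVec (grad G u x) a := by
  have h1 : (schoutenMat G x).mulVec (grad G u x)
      = (schoutenUp G x).transpose.mulVec (fun b => pd b u x) := by
    rw [schoutenUp, Matrix.transpose_mul, h.inv_transpose hx,
      h.schoutenMat_transpose h.isOpen hx, grad, Matrix.mulVec_mulVec]
  rw [h1]
  simp only [Matrix.mulVec, dotProduct, Matrix.transpose_apply]
  exact Finset.sum_congr rfl fun k _ => mul_comm _ _

/-- The differential of `ρ`. -/
theorem IsSolutionOn.pd_rho (h : IsSolutionOn G u U) (hx : x ∈ U) (a : Fin d) :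
    pd a (rho G u) x = (schoutenMat G x).mulVec (grad G u x) a := by
  have hd := h.three_le_cast
  -- The trace of `IsSolutionOn.curv_grad`: on the left `Ric(V) = (d-2)P(V) + J du`, on the right
  -- `-P(V) + J du + (d-1)dρ`, since the Cotton trace is zero.
  have h1 := Finset.sum_congr (rfl : (Finset.univ : Finset (Fin d)) = Finset.univ)
    fun k _ => h.curv_grad hx k a k
  have hl : ∑ k, (curv G k a x).mulVec (grad G u x) k
      = ((d : ℝ) - 2) * (schoutenMat G x).mulVec (grad G u x) a
        + schoutenTrace G x * pd a u x := by
    have e1 : ∑ k, (curv G k a x).mulVec (grad G u x) k = (ricciMat G x).mulVec (grad G u x) a := by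
      simp only [Matrix.mulVec, dotProduct, ricciMat, Matrix.of_apply, ricci, Finset.sum_mul,
        curv_apply]
      exact Finset.sum_comm
    have e2 : ricciMat G x = ((d : ℝ) - 2) • schoutenMat G x + schoutenTrace G x • G x := by
      ext a b
      exact ricci_eq_schouten h.three_le a b
    rw [e1, e2, Matrix.add_mulVec, Matrix.smul_mulVec, Matrix.smul_mulVec, h.lower_grad hx]
    simp
  rw [hl] at h1
  simp only [Finset.sum_sub_distrib, Finset.sum_neg_distrib, ← Finset.mul_sum,
    h.trace_cottonUp h.isOpen h.three_le hx, h.trace_schoutenUp h.isOpen h.three_le hx,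
    h.schoutenUp_du hx, Matrix.one_apply, mul_ite, mul_one, mul_zero, Finset.sum_ite_eq',
    Finset.mem_univ, if_true, Finset.sum_const, Finset.card_univ,
    Fintype.card_fin, nsmul_eq_mul] at h1
  have h2 : ((d : ℝ) - 1) * (pd a (rho G u) x - (schoutenMat G x).mulVec (grad G u x) a) = 0 := by
    linarith
  rcases mul_eq_zero.1 h2 with h | h <;> linarith

theorem IsMetricOn.gradSq_eq (x : Coord d) :
    gradSq G u x = dotProduct (fun b => pd b u x) (grad G u x) := by
  simp only [gradSq, trace, grad, dotProduct, Matrix.mulVec, Finset.mul_sum]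
  exact Finset.sum_congr rfl fun a _ => Finset.sum_congr rfl fun b _ => by ring

/-- `S` as a quadratic form in the parallel triple `(u, grad u, ρ)`. This form shows both its
constancy and its value `-|du|²` at zeros of `u`. -/
theorem localS_eq (hd : 3 ≤ d) : localS G u x = -2 * u x * rho G u x - gradSq G u x := by
  have hd' : (3 : ℝ) ≤ d := by exact_mod_cast hd
  rw [localS, rho]
  field_simp
  ring

/-- Both factors of `⟨du, grad u⟩` contribute the Hessian applied to the gradient; the connection
terms cancel because the connection is metric. -/
theorem IsSolutionOn.pd_gradSq (h : IsSolutionOn G u U) (hx : x ∈ U) (a : Fin d) :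
    pd a (gradSq G u) x
      = -2 * (u x * (schoutenMat G x).mulVec (grad G u x) a + rho G u x * pd a u x) := by
  have hU := h.isOpen
  rw [pd_congr_of_eqOn hU hx (fun y _ => IsMetricOn.gradSq_eq y) a,
    pd_dotProduct hU hx h.smooth_du h.smooth_grad]
  have e1 : vpd a (grad G u) x = (fun k => -(u x * schoutenUp G x k a)
      - rho G u x * (1 : Matrix (Fin d) (Fin d) ℝ) k a)
      - (conn G a x).mulVec (grad G u x) := by
    rw [← h.cov_grad hx a]; abel
  have e2 : vpd a (fun y b => pd b u y) x = (fun b => -(u x * schouten G a b x)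
      - rho G u x * G x a b) + (conn G a x).transpose.mulVec (fun b => pd b u x) := by
    ext b
    have h3 := h.hess_eq hx a b
    rw [hess] at h3
    simp only [Pi.add_apply, vpd_apply, ← h3, Matrix.mulVec, dotProduct, Matrix.transpose_apply,
      conn_apply]
    ring
  rw [e1, e2, add_dotProduct, dotProduct_sub, Matrix.mulVec_transpose,
    ← Matrix.dotProduct_mulVec]
  have e3 : dotProduct (fun b => -(u x * schouten G a b x) - rho G u x * G x a b) (grad G u x)
      = -(u x * (schoutenMat G x).mulVec (grad G u x) a)
        - rho G u x * (G x).mulVec (grad G u x) a := by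
    simp only [Matrix.mulVec, dotProduct, Finset.mul_sum, schoutenMat_apply,
      ← Finset.sum_neg_distrib, ← Finset.sum_sub_distrib]
    exact Finset.sum_congr rfl fun k _ => by ring
  have e4 : dotProduct (fun b => pd b u x) (fun k => -(u x * schoutenUp G x k a)
      - rho G u x * (1 : Matrix (Fin d) (Fin d) ℝ) k a)
      = -(u x * (schoutenMat G x).mulVec (grad G u x) a) - rho G u x * pd a u x := by
    rw [← h.schoutenUp_du hx]
    have : rho G u x * pd a u x
        = ∑ k, rho G u x * (pd k u x * (1 : Matrix (Fin d) (Fin d) ℝ) k a) := by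
      simp [Matrix.one_apply]
    rw [this]
    simp only [dotProduct, Finset.mul_sum,
      ← Finset.sum_neg_distrib, ← Finset.sum_sub_distrib]
    exact Finset.sum_congr rfl fun k _ => by ring
  rw [e3, e4, h.lower_grad hx]
  ring

theorem IsSolutionOn.smooth_gradSq (h : IsSolutionOn G u U) : SmoothOn U (gradSq G u) :=
  h.smooth_trace fun a b => (h.smooth_u.pd h.isOpen a).mul (h.smooth_u.pd h.isOpen b)

theorem IsSolutionOn.smooth_localS (h : IsSolutionOn G u U) : SmoothOn U (localS G u) :=
  (((contDiffOn_const.mul h.smooth_u).mul h.smooth_rho).sub h.smooth_gradSq).congr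
    fun _ _ => localS_eq h.three_le

/-- The function `S(g,u)` of an almost Einstein structure is locally constant. -/
theorem IsSolutionOn.pd_localS (h : IsSolutionOn G u U) (hx : x ∈ U) (a : Fin d) :
    pd a (localS G u) x = 0 := by
  have hU := h.isOpen
  have d1 := h.smooth_u.differentiableAt hU hx
  have d2 := h.smooth_rho.differentiableAt hU hx
  rw [pd_congr_of_eqOn hU hx (fun y _ => localS_eq h.three_le) a,
    pd_sub ((d1.const_mul _).fun_mul d2) (h.smooth_gradSq.differentiableAt hU hx),
    pd_mul (d1.const_mul _) d2, pd_const_mul d1, h.pd_gradSq hx, h.pd_rho hx]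
  ring

/-- The Weyl curvature acting on the gradient. -/
theorem IsSolutionOn.weyl_grad (h : IsSolutionOn G u U) (hx : x ∈ U) (a b c : Fin d) :
    ∑ e, weyl G a b c e x * grad G u x e = -(u x * cotton G c a b x) := by
  have hU := h.isOpen
  have h1 : ∑ e, riemann G a b c e x * grad G u x e
      = (G x).mulVec ((curv G a b x).mulVec (grad G u x)) c := by
    simp only [riemann, Matrix.mulVec, dotProduct, Finset.mul_sum, Finset.sum_mul, curv_apply]
    rw [Finset.sum_comm]
    exact Finset.sum_congr rfl fun e _ => Finset.sum_congr rfl fun m _ => by ring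
  have h2 : (G x).mulVec ((curv G a b x).mulVec (grad G u x)) c
      = -(pd a u x * (G x * schoutenUp G x) c b - pd b u x * (G x * schoutenUp G x) c a)
        - u x * (∑ k, G x c k * cottonUp G k a b x)
        - (pd a (rho G u) x * (G x * (1 : Matrix (Fin d) (Fin d) ℝ)) c b
          - pd b (rho G u) x * (G x * (1 : Matrix (Fin d) (Fin d) ℝ)) c a) := by
    rw [Matrix.mulVec, dotProduct]
    simp only [h.curv_grad hx, Matrix.mul_apply, Finset.mul_sum, ← Finset.sum_neg_distrib,
      ← Finset.sum_sub_distrib]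
    exact Finset.sum_congr rfl fun k _ => by ring
  have h3 : ∑ e, weyl G a b c e x * grad G u x e
      = ∑ e, riemann G a b c e x * grad G u x e
        - (G x c a * (schoutenMat G x).mulVec (grad G u x) b
          - G x c b * (schoutenMat G x).mulVec (grad G u x) a)
        - ((G x).mulVec (grad G u x) b * schouten G a c x
          - (G x).mulVec (grad G u x) a * schouten G b c x) := by
    simp only [weyl, Matrix.mulVec, dotProduct, Finset.mul_sum, Finset.sum_mul,
      ← Finset.sum_sub_distrib, schoutenMat_apply]
    exact Finset.sum_congr rfl fun e _ => by rw [h.symm hx e b, h.symm hx e a]; ring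
  -- With `dρ = P(V)`, the Schouten terms separating Riemann from Weyl cancel all of
  -- `IsSolutionOn.curv_grad` except its Cotton term.
  rw [h3, h1, h2, h.lower_cottonUp hU hx, h.mul_schoutenUp hx, mul_one, h.pd_rho hx, h.pd_rho hx,
    h.lower_grad hx, schoutenMat_apply, schoutenMat_apply, h.schouten_symm hU hx c a,
    h.schouten_symm hU hx c b]
  ring

end AlmostEinsteinEquation

/-! ### The conformally rescaled metric -/

section Conformal

variable {d : ℕ} {U : Set (Coord d)} {x : Coord d} {G : Coord d → Matrix (Fin d) (Fin d) ℝ}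
  {u : Coord d → ℝ}

/-- The components of the metric `u⁻² G`. -/
noncomputable def rescale (G : Coord d → Matrix (Fin d) (Fin d) ℝ) (u : Coord d → ℝ)
    (x : Coord d) : Matrix (Fin d) (Fin d) ℝ := ((u x) ^ 2)⁻¹ • G x

/-- The difference of the Levi-Civita connections of `u⁻² G` and `G`. -/
noncomputable def connDiff (G : Coord d → Matrix (Fin d) (Fin d) ℝ) (u : Coord d → ℝ)
    (a : Fin d) (x : Coord d) : Matrix (Fin d) (Fin d) ℝ :=
  Matrix.of fun k e => -((u x)⁻¹ * (pd a u x * (1 : Matrix (Fin d) (Fin d) ℝ) k e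
    + (1 : Matrix (Fin d) (Fin d) ℝ) k a * pd e u x - G x a e * grad G u x k))

theorem connDiff_apply (a k e : Fin d) : connDiff G u a x k e
    = -((u x)⁻¹ * (pd a u x * (1 : Matrix (Fin d) (Fin d) ℝ) k e
      + (1 : Matrix (Fin d) (Fin d) ℝ) k a * pd e u x - G x a e * grad G u x k)) := rfl

theorem mul_connDiff (A : Matrix (Fin d) (Fin d) ℝ) (b k e : Fin d) :
    (A * connDiff G u b x) k e = -((u x)⁻¹ * (pd b u x * A k e + A k b * pd e u x
      - G x b e * A.mulVec (grad G u x) k)) := by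
  have h1 : ∀ c, A k c = ∑ m, A k m * (1 : Matrix (Fin d) (Fin d) ℝ) m c := fun c => by
    rw [← Matrix.mul_apply, mul_one]
  rw [h1 e, h1 b, Matrix.mul_apply, Matrix.mulVec, dotProduct]
  simp only [connDiff_apply, Finset.mul_sum, Finset.sum_mul, ← Finset.sum_neg_distrib,
    ← Finset.sum_sub_distrib, ← Finset.sum_add_distrib]
  exact Finset.sum_congr rfl fun m _ => by ring

theorem connDiff_mul (A : Matrix (Fin d) (Fin d) ℝ) (b k e : Fin d) :
    (connDiff G u b x * A) k e = -((u x)⁻¹ * (pd b u x * A k e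
      + (1 : Matrix (Fin d) (Fin d) ℝ) k b * (∑ m, pd m u x * A m e)
      - (G x * A) b e * grad G u x k)) := by
  have h1 : A k e = ∑ m, (1 : Matrix (Fin d) (Fin d) ℝ) k m * A m e := by
    rw [← Matrix.mul_apply, one_mul]
  rw [h1, Matrix.mul_apply, Matrix.mul_apply]
  simp only [connDiff_apply, Finset.mul_sum, Finset.sum_mul, ← Finset.sum_neg_distrib,
    ← Finset.sum_sub_distrib, ← Finset.sum_add_distrib]
  exact Finset.sum_congr rfl fun m _ => by ring

/-- The two terms containing `du ⊗ grad u` cancel. This keeps the quadratic part of the curvature of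
`u⁻² G` short. -/
theorem IsMetricOn.connDiff_mulVec_grad (hG : IsMetricOn G U) (hx : x ∈ U) (a k : Fin d) :
    (connDiff G u a x).mulVec (grad G u x) k
      = -((u x)⁻¹ * ((1 : Matrix (Fin d) (Fin d) ℝ) k a * gradSq G u x)) := by
  have h1 : grad G u x k = ∑ m, (1 : Matrix (Fin d) (Fin d) ℝ) k m * grad G u x m := by
    have : ((1 : Matrix (Fin d) (Fin d) ℝ).mulVec (grad G u x)) k = grad G u x k := by
      rw [Matrix.one_mulVec]
    exact this.symm
  have h2 : pd a u x = ∑ m, G x a m * grad G u x m :=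
    (congrFun (hG.lower_grad (u := u) hx) a).symm
  have h3 : (connDiff G u a x).mulVec (grad G u x) k
      = -((u x)⁻¹ * (pd a u x * (∑ m, (1 : Matrix (Fin d) (Fin d) ℝ) k m * grad G u x m)
        + (1 : Matrix (Fin d) (Fin d) ℝ) k a * gradSq G u x
        - (∑ m, G x a m * grad G u x m) * grad G u x k)) := by
    rw [IsMetricOn.gradSq_eq]
    simp only [Matrix.mulVec, dotProduct, connDiff_apply, Finset.mul_sum, Finset.sum_mul,
      ← Finset.sum_neg_distrib, ← Finset.sum_sub_distrib, ← Finset.sum_add_distrib]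
    exact Finset.sum_congr rfl fun m _ => by ring
  rw [h3, ← h1, ← h2]
  ring

/-- The part of the domain where `u` does not vanish. -/
theorem IsSolutionOn.isOpen_ne (h : IsSolutionOn G u U) : IsOpen (U ∩ {y | u y ≠ 0}) :=
  h.smooth_u.continuousOn.isOpen_inter_preimage h.isOpen _root_.isOpen_ne

theorem IsSolutionOn.restrict {U' : Set (Coord d)} (h : IsSolutionOn G u U) (hU' : IsOpen U')
    (hs : U' ⊆ U) : IsSolutionOn G u U' :=
  ⟨h.toIsMetricOn.mono hs, hU', h.three_le, h.smooth_u.mono hs, fun x hx => h.equation x (hs hx)⟩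

theorem IsSolutionOn.isMetricOn_rescale (h : IsSolutionOn G u U) (h0 : ∀ y ∈ U, u y ≠ 0) :
    IsMetricOn (rescale G u) U := by
  refine ⟨fun i j => ?_, fun y hy => ?_⟩
  · exact ((h.smooth_u.pow 2).inv fun y hy => pow_ne_zero _ (h0 y hy)).mul (h.smooth i j)
  · exact (h.posDef y hy).smul (by have := h0 y hy; positivity)

theorem IsSolutionOn.smooth_connDiff (h : IsSolutionOn G u U) (h0 : ∀ y ∈ U, u y ≠ 0)
    (a : Fin d) : MSmoothOn U (connDiff G u a) := by
  intro k e
  simp only [connDiff_apply]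
  exact ((h.smooth_u.inv h0).mul ((((h.smooth_du a).mul contDiffOn_const).add
    (contDiffOn_const.mul (h.smooth_du e))).sub ((h.smooth a e).mul (h.smooth_grad k)))).neg

theorem IsMetricOn.mul_connDiff_metric (hG : IsMetricOn G U) (hx : x ∈ U) (a c e : Fin d) :
    (G x * connDiff G u a x) c e = -((u x)⁻¹ * (pd a u x * G x c e + G x c a * pd e u x
      - G x a e * pd c u x)) := by
  rw [mul_connDiff, hG.lower_grad hx]

/-- By uniqueness of the Levi-Civita connection it is enough that `connDiff` is symmetric and that
its failure to preserve `G` is `-2u⁻¹ du`, the logarithmic derivative of `u⁻²`. -/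
theorem IsSolutionOn.conn_rescale (h : IsSolutionOn G u U) (h0 : ∀ y ∈ U, u y ≠ 0) (hx : x ∈ U)
    (a : Fin d) : conn (rescale G u) a x = conn G a x + connDiff G u a x := by
  refine (h.isMetricOn_rescale h0).conn_unique hx
    (Γ := fun a => conn G a x + connDiff G u a x) ?_ ?_ a
  · intro a c e
    simp only [Matrix.add_apply, conn_apply, connDiff_apply, h.christoffel_symm h.isOpen hx c a e,
      h.symm hx a e, Matrix.one_apply]
    ring
  · intro a
    have hux := h0 x hx
    have e1 : (connDiff G u a x).transpose * G x = (G x * connDiff G u a x).transpose := by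
      rw [Matrix.transpose_mul, h.transpose_eq hx]
    have e2 : mpd a (rescale G u) x
        = ((u x) ^ 2)⁻¹ • (mpd a G x) - (2 * pd a u x * ((u x) ^ 3)⁻¹) • G x := by
      ext c e
      have d1 := h.smooth_u.differentiableAt h.isOpen hx
      have d2 := (h.smooth c e).differentiableAt h.isOpen hx
      have hr : (fun y => rescale G u y c e) = fun y => (u y * u y)⁻¹ * G y c e := by
        ext y; simp [rescale, sq]
      have hne : u x * u x ≠ 0 := mul_ne_zero hux hux
      have d3 : DifferentiableAt ℝ (fun y => (u y * u y)⁻¹) x := (d1.fun_mul d1).inv hne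
      rw [mpd_apply, hr, pd_mul d3 d2, pd_inv (d1.fun_mul d1) hne,
        pd_mul d1 d1]
      simp only [Matrix.sub_apply, Matrix.smul_apply, mpd_apply, smul_eq_mul]
      field_simp
      ring
    rw [e2, h.mpd_metric h.isOpen hx, rescale, Matrix.transpose_add, add_mul, mul_add,
      Matrix.mul_smul, Matrix.mul_smul, Matrix.smul_mul, Matrix.smul_mul, e1]
    ext c e
    simp only [Matrix.add_apply, Matrix.sub_apply, Matrix.smul_apply, Matrix.transpose_apply,
      smul_eq_mul, h.mul_connDiff_metric hx]
    rw [h.symm hx e c, h.symm hx a e, h.symm hx a c]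
    field_simp
    ring

/-- The covariant derivative of the difference tensor, without the term that is symmetric in the
two directions. -/
theorem IsSolutionOn.deriv_connDiff (h : IsSolutionOn G u U) (h0 : ∀ y ∈ U, u y ≠ 0) (hx : x ∈ U)
    (a b k e : Fin d) :
    (mpd a (connDiff G u b) x + conn G a x * connDiff G u b x
      - connDiff G u b x * conn G a x) k e
    = ((u x) ^ 2)⁻¹ * pd a u x * (pd b u x * (1 : Matrix (Fin d) (Fin d) ℝ) k e
        + (1 : Matrix (Fin d) (Fin d) ℝ) k b * pd e u x - G x b e * grad G u x k)
      - (u x)⁻¹ * (pd a (pd b u) x * (1 : Matrix (Fin d) (Fin d) ℝ) k e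
        + (1 : Matrix (Fin d) (Fin d) ℝ) k b * hess G u a e x
        - (∑ m, christoffel G m a b x * G x m e) * grad G u x k
        - G x b e * (-(u x * schoutenUp G x k a)
          - rho G u x * (1 : Matrix (Fin d) (Fin d) ℝ) k a)
        + christoffel G k a b x * pd e u x) := by
  have hU := h.isOpen
  have d1 := h.smooth_u.differentiableAt hU hx
  have dp : ∀ b, DifferentiableAt ℝ (pd b u) x := fun b => (h.smooth_du b).differentiableAt hU hx
  have di : DifferentiableAt ℝ (fun y => (u y)⁻¹) x := d1.inv (h0 x hx)
  have dg := (h.smooth b e).differentiableAt hU hx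
  have dV := (h.smooth_grad k).differentiableAt hU hx
  have hg := congrFun (congrFun (h.mpd_metric hU hx a) b) e
  have hV := congrFun (h.cov_grad hx a) k
  simp only [Pi.add_apply, vpd_apply] at hV
  have hV' := eq_sub_of_add_eq hV
  have hp : pd a (fun y => connDiff G u b y k e) x
      = ((u x) ^ 2)⁻¹ * pd a u x * (pd b u x * (1 : Matrix (Fin d) (Fin d) ℝ) k e
        + (1 : Matrix (Fin d) (Fin d) ℝ) k b * pd e u x - G x b e * grad G u x k)
      - (u x)⁻¹ * (pd a (pd b u) x * (1 : Matrix (Fin d) (Fin d) ℝ) k e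
        + (1 : Matrix (Fin d) (Fin d) ℝ) k b * pd a (pd e u) x
        - (pd a (fun y => G y b e) x * grad G u x k
          + G x b e * pd a (fun y => grad G u y k) x)) := by
    simp only [connDiff_apply]
    rw [pd_neg, pd_mul di ((((dp b).mul_const _).fun_add ((dp e).const_mul _)).fun_sub
        (dg.fun_mul dV)), pd_inv d1 (h0 x hx),
      pd_sub (((dp b).mul_const _).fun_add ((dp e).const_mul _)) (dg.fun_mul dV),
      pd_add ((dp b).mul_const _) ((dp e).const_mul _), pd_mul dg dV, pd_const_mul (dp e),
      pd_mul (dp b) (by fun_prop), pd_const]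
    ring
  rw [Matrix.sub_apply, Matrix.add_apply, mpd_apply, hp, mul_connDiff, connDiff_mul, hV']
  rw [mpd_apply] at hg
  rw [hg, Matrix.add_apply, hess]
  have e1 : ((conn G a x).transpose * G x) b e = ∑ m, christoffel G m a b x * G x m e := rfl
  have e2 : ∑ m, pd m u x * conn G a x m e = ∑ m, christoffel G m a e x * pd m u x :=
    Finset.sum_congr rfl fun m _ => mul_comm _ _
  rw [e1, e2]
  simp only [conn_apply]
  ring

/-- The curvature of `u⁻² G` for a solution `u` of the almost Einstein equation. -/
theorem IsSolutionOn.riemannUp_rescale (h : IsSolutionOn G u U) (h0 : ∀ y ∈ U, u y ≠ 0)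
    (hx : x ∈ U) (a b k e : Fin d) :
    riemannUp (rescale G u) a b k e x = riemannUp G a b k e x
      + ((1 : Matrix (Fin d) (Fin d) ℝ) k b * schouten G a e x
        - (1 : Matrix (Fin d) (Fin d) ℝ) k a * schouten G b e x
        - G x b e * schoutenUp G x k a + G x a e * schoutenUp G x k b)
      + ((u x) ^ 2)⁻¹ * localS G u x * ((1 : Matrix (Fin d) (Fin d) ℝ) k a * G x b e
        - (1 : Matrix (Fin d) (Fin d) ℝ) k b * G x a e) := by
  have hU := h.isOpen
  have hux := h0 x hx
  have hc := h.smooth_conn hU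
  have hq := h.smooth_connDiff h0
  -- The curvature of `Γ + Q` is `R + (∇_a Q_b - ∇_b Q_a) + [Q_a, Q_b]`.
  have h1 : curv (rescale G u) a b x = curv G a b x
      + ((mpd a (connDiff G u b) x + conn G a x * connDiff G u b x
          - connDiff G u b x * conn G a x)
        - (mpd b (connDiff G u a) x + conn G b x * connDiff G u a x
          - connDiff G u a x * conn G b x))
      + (connDiff G u a x * connDiff G u b x - connDiff G u b x * connDiff G u a x) := by
    rw [curv_eq, curv_eq, mpd_congr_of_eqOn hU hx (fun y hy => h.conn_rescale h0 hy b) a,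
      mpd_congr_of_eqOn hU hx (fun y hy => h.conn_rescale h0 hy a) b, h.conn_rescale h0 hx,
      h.conn_rescale h0 hx, mpd_add hU hx (hc b) (hq b), mpd_add hU hx (hc a) (hq a)]
    noncomm_ring
  have h2 := congrFun (congrFun h1 k) e
  rw [curv_apply, Matrix.add_apply, Matrix.add_apply, curv_apply, Matrix.sub_apply,
    h.deriv_connDiff h0 hx, h.deriv_connDiff h0 hx, Matrix.sub_apply, mul_connDiff, mul_connDiff,
    h.connDiff_mulVec_grad hx, h.connDiff_mulVec_grad hx] at h2
  have e1 : ∑ m, christoffel G m b a x * G x m e = ∑ m, christoffel G m a b x * G x m e :=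
    Finset.sum_congr rfl fun m _ => by rw [h.christoffel_symm hU hx]
  -- Terms symmetric in `a, b` cancel. Replacing the Hessians leaves Schouten terms, while `ρ` and
  -- `|du|²` combine into `u⁻² S`.
  rw [h2, e1, pd_comm h.smooth_u hU hx b a, h.christoffel_symm hU hx k b a, h.hess_eq hx,
    h.hess_eq hx, localS_eq h.three_le]
  simp only [connDiff_apply]
  rw [h.symm hx b a]
  field_simp
  ring

/-- If `u` solves the almost Einstein equation, then `u⁻² G` is Einstein. -/
theorem IsSolutionOn.ricci_rescale (h : IsSolutionOn G u U) (hx : x ∈ U) (hux : u x ≠ 0)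
    (a b : Fin d) :
    ricci (rescale G u) a b x = ((d : ℝ) - 1) * localS G u x * rescale G u x a b := by
  have h' := h.restrict h.isOpen_ne Set.inter_subset_left
  have hx' : x ∈ U ∩ {y | u y ≠ 0} := ⟨hx, hux⟩
  rw [ricci, Finset.sum_congr rfl fun c _ => h'.riemannUp_rescale (fun y hy => hy.2) hx' c a c b]
  -- The Schouten terms trace to `-(d-2)P - JG`, which cancels `Ric(G)`; the `S` term traces to
  -- `(d-1) S u⁻² G`.
  have e1 : ∑ c, (1 : Matrix (Fin d) (Fin d) ℝ) c a * schouten G c b x = schouten G a b x := by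
    simp [Matrix.one_apply]
  have e2 : ∑ c, (1 : Matrix (Fin d) (Fin d) ℝ) c c * schouten G a b x
      = d * schouten G a b x := by
    simp
  have e3 : ∑ c, G x a b * schoutenUp G x c c = G x a b * schoutenTrace G x := by
    rw [← Finset.mul_sum, h.trace_schoutenUp h.isOpen h.three_le hx]
  have e4 : ∑ c, G x c b * schoutenUp G x c a = schouten G a b x := by
    have := congrFun (congrFun (h.mul_schoutenUp hx) b) a
    rw [Matrix.mul_apply, schoutenMat_apply, h.schouten_symm h.isOpen hx] at this
    rw [← this]
    exact Finset.sum_congr rfl fun c _ => by rw [h.symm hx]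
  have e5 : ∑ c, (1 : Matrix (Fin d) (Fin d) ℝ) c c * G x a b = d * G x a b := by
    simp
  have e6 : ∑ c, (1 : Matrix (Fin d) (Fin d) ℝ) c a * G x c b = G x a b := by
    simp [Matrix.one_apply]
  simp only [Finset.sum_add_distrib, Finset.sum_sub_distrib, ← Finset.mul_sum]
  rw [e1, e2, e4, e5, e6, ← Finset.mul_sum] at *
  rw [e3]
  change ricci G a b x + _ + _ = _
  rw [ricci_eq_schouten h.three_le, rescale, Matrix.smul_apply, smul_eq_mul]
  ring

theorem IsSolutionOn.scal_rescale (h : IsSolutionOn G u U) (hx : x ∈ U) (hux : u x ≠ 0) :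
    scal (rescale G u) x = d * ((d : ℝ) - 1) * localS G u x := by
  have h' := h.restrict h.isOpen_ne Set.inter_subset_left
  have hx' : x ∈ U ∩ {y | u y ≠ 0} := ⟨hx, hux⟩
  have h1 : scal (rescale G u) x = trace (rescale G u)
      (fun a b y => ((d : ℝ) - 1) * localS G u y * rescale G u y a b) x := by
    simp only [scal, trace, h.ricci_rescale hx hux]
  rw [h1, trace_mul, (h'.isMetricOn_rescale fun y hy => hy.2).trace_metric hx']
  ring

end Conformal

/-! ### Change of coordinates -/

section ChangeOfCoordinates

variable {d : ℕ} {U U' : Set (Coord d)} {x : Coord d} {G G' : Coord d → Matrix (Fin d) (Fin d) ℝ}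
  {f : Coord d → Coord d}

/-- The Jacobian matrix of a map. -/
noncomputable def jacobian (f : Coord d → Coord d) (x : Coord d) : Matrix (Fin d) (Fin d) ℝ :=
  Matrix.of fun i a => pd a (fun y => f y i) x

@[simp] theorem jacobian_apply (i a : Fin d) : jacobian f x i a = pd a (fun y => f y i) x := rfl

theorem pd_comp {h : Coord d → ℝ} (hh : DifferentiableAt ℝ h (f x)) (hf : DifferentiableAt ℝ f x)
    (a : Fin d) : pd a (fun y => h (f y)) x = ∑ m, jacobian f x m a * pd m h (f x) := by
  have h1 : fderiv ℝ (fun y => h (f y)) x = (fderiv ℝ h (f x)).comp (fderiv ℝ f x) :=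
    fderiv_comp x hh hf
  rw [pd, h1, ContinuousLinearMap.comp_apply, fderiv_apply_eq_sum_pd]
  refine Finset.sum_congr rfl fun m _ => ?_
  congr 1
  have h2 : HasFDerivAt (fun y => f y m)
      ((EuclideanSpace.proj m : Coord d →L[ℝ] ℝ).comp (fderiv ℝ f x)) x :=
    (EuclideanSpace.proj m : Coord d →L[ℝ] ℝ).hasFDerivAt.comp x hf.hasFDerivAt
  rw [jacobian_apply, pd, h2.fderiv]
  rfl

theorem smoothOn_comp {h : Coord d → ℝ} (hh : SmoothOn U h) (hf : ContDiffOn ℝ ∞ f U')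
    (hm : Set.MapsTo f U' U) : SmoothOn U' (fun y => h (f y)) :=
  hh.comp hf hm

theorem smoothOn_coord (hf : ContDiffOn ℝ ∞ f U') (i : Fin d) : SmoothOn U' (fun y => f y i) :=
  (EuclideanSpace.proj i : Coord d →L[ℝ] ℝ).contDiff.comp_contDiffOn hf

theorem smooth_jacobian (hU' : IsOpen U') (hf : ContDiffOn ℝ ∞ f U') :
    MSmoothOn U' (jacobian f) := fun i a => (smoothOn_coord hf i).pd hU' a

/-- The pull-back of the connection form of `G`. -/
noncomputable def pullConn (G : Coord d → Matrix (Fin d) (Fin d) ℝ) (f : Coord d → Coord d)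
    (a : Fin d) (x : Coord d) : Matrix (Fin d) (Fin d) ℝ :=
  Matrix.of fun i j => ∑ m, jacobian f x m a * christoffel G i m j (f x)

/-- `G'` is the pull-back of the metric `G` on `U` under `f : U' → U`. -/
structure IsPullback (G' G : Coord d → Matrix (Fin d) (Fin d) ℝ) (f : Coord d → Coord d)
    (U' U : Set (Coord d)) : Prop where
  isOpen' : IsOpen U'
  isOpen : IsOpen U
  metric' : IsMetricOn G' U'
  metric : IsMetricOn G U
  smooth : ContDiffOn ℝ ∞ f U'
  mapsTo : Set.MapsTo f U' U
  eq : ∀ x ∈ U', G' x = (jacobian f x).transpose * G (f x) * jacobian f x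

theorem IsPullback.differentiableAt (h : IsPullback G' G f U' U) (hx : x ∈ U') :
    DifferentiableAt ℝ f x :=
  (h.smooth.contDiffAt (h.isOpen'.mem_nhds hx)).differentiableAt (by simp)

theorem IsPullback.det_ne_zero (h : IsPullback G' G f U' U) (hx : x ∈ U') :
    (jacobian f x).det ≠ 0 := by
  have h1 := h.metric'.det_ne_zero hx
  rw [h.eq x hx, Matrix.det_mul] at h1
  exact right_ne_zero_of_mul h1

theorem IsPullback.mul_inv (h : IsPullback G' G f U' U) (hx : x ∈ U') :
    jacobian f x * (jacobian f x)⁻¹ = 1 :=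
  Matrix.mul_nonsing_inv _ (h.det_ne_zero hx).isUnit

theorem IsPullback.inv_mul (h : IsPullback G' G f U' U) (hx : x ∈ U') :
    (jacobian f x)⁻¹ * jacobian f x = 1 :=
  Matrix.nonsing_inv_mul _ (h.det_ne_zero hx).isUnit

theorem IsPullback.smooth_jac (h : IsPullback G' G f U' U) : MSmoothOn U' (jacobian f) :=
  smooth_jacobian h.isOpen' h.smooth

theorem IsPullback.smooth_pullConn (h : IsPullback G' G f U' U) (a : Fin d) :
    MSmoothOn U' (pullConn G f a) := fun i j =>
  SmoothOn.sum (s := Finset.univ) fun m _ => (h.smooth_jac m a).mul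
    (smoothOn_comp (h.metric.smooth_christoffel h.isOpen i m j) h.smooth h.mapsTo)

theorem IsPullback.mpd_jacobian_symm (h : IsPullback G' G f U' U) (hx : x ∈ U') (a e i : Fin d) :
    mpd a (jacobian f) x i e = mpd e (jacobian f) x i a :=
  pd_comm (smoothOn_coord h.smooth i) h.isOpen' hx a e

theorem IsPullback.mpd_metric_comp (h : IsPullback G' G f U' U) (hx : x ∈ U') (a : Fin d) :
    mpd a (fun y => G (f y)) x
      = (pullConn G f a x).transpose * G (f x) + G (f x) * pullConn G f a x := by
  have hfx := h.mapsTo hx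
  ext i j
  have h1 : mpd a (fun y => G (f y)) x i j
      = ∑ m, jacobian f x m a * mpd m G (f x) i j :=
    pd_comp ((h.metric.smooth i j).differentiableAt h.isOpen hfx) (h.differentiableAt hx) a
  rw [h1]
  simp only [h.metric.mpd_metric h.isOpen hfx, Matrix.add_apply, Matrix.mul_apply,
    Matrix.transpose_apply, conn_apply, pullConn, Matrix.of_apply, mul_add,
    Finset.sum_add_distrib, Finset.mul_sum, Finset.sum_mul]
  congr 1
  · rw [Finset.sum_comm]
    exact Finset.sum_congr rfl fun k _ => Finset.sum_congr rfl fun m _ => by ring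
  · rw [Finset.sum_comm]
    exact Finset.sum_congr rfl fun k _ => Finset.sum_congr rfl fun m _ => by ring

/-- The transformation law of the Levi-Civita connection. -/
theorem IsPullback.jacobian_mul_conn (h : IsPullback G' G f U' U) (hx : x ∈ U') (a : Fin d) :
    jacobian f x * conn G' a x = mpd a (jacobian f) x + pullConn G f a x * jacobian f x := by
  have hfx := h.mapsTo hx
  set L := jacobian f x with hL
  have hLL : L * L⁻¹ = 1 := h.mul_inv hx
  have hinv : ∀ X : Matrix (Fin d) (Fin d) ℝ, L * (L⁻¹ * X) = X := fun X => by
    rw [← mul_assoc, hLL, one_mul]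
  -- The candidate `L⁻¹(∂L + ΓL)` is symmetric because second derivatives commute, and compatible
  -- with `G'` by differentiating `G' = LᵀGL`.
  have key := h.metric'.conn_unique hx
    (Γ := fun a => L⁻¹ * (mpd a (jacobian f) x + pullConn G f a x * L)) ?_ ?_ a
  · rw [key, hinv]
  · intro a c e
    have hs : ∀ i, (mpd a (jacobian f) x + pullConn G f a x * L) i e
        = (mpd e (jacobian f) x + pullConn G f e x * L) i a := by
      intro i
      rw [Matrix.add_apply, Matrix.add_apply, h.mpd_jacobian_symm hx a e i]
      congr 1
      simp only [Matrix.mul_apply, pullConn, Matrix.of_apply, Finset.sum_mul]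
      rw [Finset.sum_comm]
      exact Finset.sum_congr rfl fun m _ => Finset.sum_congr rfl fun n _ => by
        rw [h.metric.christoffel_symm h.isOpen hfx i m n, hL]; ring
    rw [Matrix.mul_apply, Matrix.mul_apply]
    exact Finset.sum_congr rfl fun i _ => by rw [hs]
  · intro a
    have hGf : MSmoothOn U' (fun y => G (f y)) := fun i j =>
      smoothOn_comp (h.metric.smooth i j) h.smooth h.mapsTo
    have hJ := h.smooth_jac
    have e1 : ∀ X : Matrix (Fin d) (Fin d) ℝ, (L⁻¹ * X).transpose * G' x
        = X.transpose * G (f x) * L := by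
      intro X
      rw [h.eq x hx, ← hL, ← mul_assoc, ← mul_assoc, ← Matrix.transpose_mul, hinv]
    have e2 : ∀ X : Matrix (Fin d) (Fin d) ℝ, G' x * (L⁻¹ * X)
        = L.transpose * G (f x) * X := by
      intro X
      rw [h.eq x hx, ← hL, mul_assoc, hinv]
    rw [e1, e2, mpd_congr_of_eqOn h.isOpen' hx (fun y hy => h.eq y hy) a,
      mpd_mul h.isOpen' hx (hJ.transpose.mul hGf) hJ, mpd_mul h.isOpen' hx hJ.transpose hGf,
      h.mpd_metric_comp hx, mpd_transpose, ← hL, Matrix.transpose_add, Matrix.transpose_mul]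
    noncomm_ring

/-- The pull-back of the curvature form of `G`. -/
noncomputable def pullCurv (G : Coord d → Matrix (Fin d) (Fin d) ℝ) (f : Coord d → Coord d)
    (a b : Fin d) (x : Coord d) : Matrix (Fin d) (Fin d) ℝ :=
  ∑ m, ∑ n, (jacobian f x m a * jacobian f x n b) • curv G m n (f x)

theorem IsPullback.mpd_pullConn (h : IsPullback G' G f U' U) (hx : x ∈ U') (a b i j : Fin d) :
    mpd a (pullConn G f b) x i j
      = ∑ m, mpd a (jacobian f) x m b * christoffel G i m j (f x)
        + ∑ m, ∑ n, jacobian f x m a * jacobian f x n b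
          * pd m (christoffel G i n j) (f x) := by
  have hfx := h.mapsTo hx
  have d1 := fun m => (h.smooth_jac m b).differentiableAt h.isOpen' hx
  have d2 := fun m => (smoothOn_comp (h.metric.smooth_christoffel h.isOpen i m j)
    h.smooth h.mapsTo).differentiableAt h.isOpen' hx
  have d3 := fun m => (h.metric.smooth_christoffel h.isOpen i m j).differentiableAt h.isOpen hfx
  have e : mpd a (pullConn G f b) x i j
      = pd a (fun y => ∑ m, jacobian f y m b * christoffel G i m j (f y)) x := rfl
  rw [e, pd_sum (fun m _ => (d1 m).fun_mul (d2 m)),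
    Finset.sum_congr rfl fun m _ => pd_mul (d1 m) (d2 m) a, Finset.sum_add_distrib]
  congr 1
  rw [Finset.sum_comm]
  refine Finset.sum_congr rfl fun n _ => ?_
  rw [pd_comp (d3 n) (h.differentiableAt hx), Finset.mul_sum]
  exact Finset.sum_congr rfl fun m _ => by ring

/-- The structure equation is natural under pull-back: derivatives of the Jacobian occur
symmetrically in `a, b` and cancel. -/
theorem IsPullback.pullCurv_eq (h : IsPullback G' G f U' U) (hx : x ∈ U') (a b : Fin d) :
    pullCurv G f a b x = mpd a (pullConn G f b) x - mpd b (pullConn G f a) x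
      + (pullConn G f a x * pullConn G f b x - pullConn G f b x * pullConn G f a x) := by
  ext i j
  have hp : ∀ a b, (pullConn G f a x * pullConn G f b x) i j
      = ∑ m, ∑ n, jacobian f x m a * jacobian f x n b
        * ∑ k, christoffel G i m k (f x) * christoffel G k n j (f x) := by
    intro a b
    simp only [Matrix.mul_apply, pullConn, Matrix.of_apply, Finset.sum_mul_sum]
    simp only [Finset.mul_sum]
    rw [Finset.sum_comm]
    refine Finset.sum_congr rfl fun m _ => ?_
    rw [Finset.sum_comm]
    exact Finset.sum_congr rfl fun n _ => Finset.sum_congr rfl fun k _ => by ring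
  have hsw : ∀ F : Fin d → Fin d → ℝ,
      ∑ m, ∑ n, jacobian f x m b * jacobian f x n a * F m n
        = ∑ m, ∑ n, jacobian f x m a * jacobian f x n b * F n m := by
    intro F
    rw [Finset.sum_comm]
    exact Finset.sum_congr rfl fun m _ => Finset.sum_congr rfl fun n _ => by ring
  have hj : ∀ m, mpd a (jacobian f) x m b = mpd b (jacobian f) x m a :=
    fun m => h.mpd_jacobian_symm hx a b m
  rw [Matrix.add_apply, Matrix.sub_apply, Matrix.sub_apply, hp, hp, h.mpd_pullConn hx,
    h.mpd_pullConn hx, hsw, hsw (fun m n => ∑ k, christoffel G i m k (f x)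
      * christoffel G k n j (f x))]
  simp only [hj]
  have hl : pullCurv G f a b x i j = ∑ m, ∑ n, jacobian f x m a * jacobian f x n b
      * riemannUp G m n i j (f x) := by
    simp [pullCurv, Matrix.sum_apply]
  rw [hl]
  have hr : ∀ m n, jacobian f x m a * jacobian f x n b * riemannUp G m n i j (f x)
      = jacobian f x m a * jacobian f x n b * pd m (christoffel G i n j) (f x)
        - jacobian f x m a * jacobian f x n b * pd n (christoffel G i m j) (f x)
        + (jacobian f x m a * jacobian f x n b
            * ∑ k, christoffel G i m k (f x) * christoffel G k n j (f x)
          - jacobian f x m a * jacobian f x n b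
            * ∑ k, christoffel G i n k (f x) * christoffel G k m j (f x)) := by
    intro m n
    rw [riemannUp, Finset.sum_sub_distrib]
    ring
  simp only [hr, Finset.sum_add_distrib, Finset.sum_sub_distrib]
  ring

/-- The transformation law of the curvature. -/
theorem IsPullback.jacobian_mul_curv (h : IsPullback G' G f U' U) (hx : x ∈ U') (a b : Fin d) :
    jacobian f x * curv G' a b x = pullCurv G f a b x * jacobian f x := by
  have hJ := h.smooth_jac
  have hc := h.metric'.smooth_conn h.isOpen'
  have hA := h.smooth_pullConn
  have hd : ∀ a b, mpd a (jacobian f) x * conn G' b x + jacobian f x * mpd a (conn G' b) x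
      = mpd a (mpd b (jacobian f)) x + (mpd a (pullConn G f b) x * jacobian f x
        + pullConn G f b x * mpd a (jacobian f) x) := by
    intro a b
    rw [← mpd_mul h.isOpen' hx hJ (hc b),
      mpd_congr_of_eqOn h.isOpen' hx (fun y hy => h.jacobian_mul_conn hy b) a,
      mpd_add h.isOpen' hx (hJ.mpd h.isOpen' b) ((hA b).mul hJ), mpd_mul h.isOpen' hx (hA b) hJ]
  have hd' : ∀ a b, jacobian f x * mpd a (conn G' b) x
      = mpd a (mpd b (jacobian f)) x + (mpd a (pullConn G f b) x * jacobian f x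
        + pullConn G f b x * mpd a (jacobian f) x) - mpd a (jacobian f) x * conn G' b x :=
    fun a b => eq_sub_of_add_eq' (hd a b)
  -- Solving the law of the connection for the derivative of the Jacobian turns the claim into a
  -- noncommutative ring identity.
  have hm : ∀ a, mpd a (jacobian f) x
      = jacobian f x * conn G' a x - pullConn G f a x * jacobian f x := fun a => by
    rw [h.jacobian_mul_conn hx a]; abel
  rw [h.pullCurv_eq hx, curv_eq, mul_add, mul_sub, hd' a b, hd' b a,
    mpd_comm h.isOpen' hx hJ b a, hm a, hm b]
  noncomm_ring

/-- In the contraction over `c` the Jacobian meets its inverse, so only the two free indices are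
transformed. -/
theorem IsPullback.ricciMat_eq (h : IsPullback G' G f U' U) (hx : x ∈ U') :
    ricciMat G' x = (jacobian f x).transpose * ricciMat G (f x) * jacobian f x := by
  ext a e
  have h1 : ∀ c, curv G' c a x
      = ∑ m, ∑ n, (jacobian f x m c * jacobian f x n a)
        • ((jacobian f x)⁻¹ * (curv G m n (f x) * jacobian f x)) := by
    intro c
    have : curv G' c a x = (jacobian f x)⁻¹ * (jacobian f x * curv G' c a x) := by
      rw [← mul_assoc, h.inv_mul hx, one_mul]
    rw [this, h.jacobian_mul_curv hx, pullCurv]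
    simp only [Matrix.sum_mul, Matrix.mul_sum, Matrix.smul_mul, Matrix.mul_smul]
  have h2 : ricciMat G' x a e = ∑ c, ∑ m, ∑ n, jacobian f x m c * jacobian f x n a
        * ((jacobian f x)⁻¹ * (curv G m n (f x) * jacobian f x)) c e := by
    change ∑ c, curv G' c a x c e = _
    exact Finset.sum_congr rfl fun c _ => by rw [h1 c]; simp [Matrix.sum_apply]
  have h3 : ∀ m n, ∑ c, jacobian f x m c
      * ((jacobian f x)⁻¹ * (curv G m n (f x) * jacobian f x)) c e
      = (curv G m n (f x) * jacobian f x) m e := by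
    intro m n
    rw [← Matrix.mul_apply, ← mul_assoc, h.mul_inv hx, one_mul]
  have h4 : ricciMat G' x a e = ∑ n, jacobian f x n a
      * ∑ m, (curv G m n (f x) * jacobian f x) m e := by
    rw [h2, Finset.sum_comm]
    simp only [← h3, Finset.mul_sum]
    conv_rhs => rw [Finset.sum_comm]
    refine Finset.sum_congr rfl fun m _ => ?_
    rw [Finset.sum_comm]
    exact Finset.sum_congr rfl fun n _ => Finset.sum_congr rfl fun c _ => by ring
  rw [h4, mul_assoc, Matrix.mul_apply]
  refine Finset.sum_congr rfl fun n _ => ?_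
  rw [Matrix.transpose_apply]
  congr 1
  simp only [Matrix.mul_apply, ricciMat, Matrix.of_apply, ricci, Finset.sum_mul, curv_apply]
  exact Finset.sum_comm

theorem scal_eq_matrix_trace (G : Coord d → Matrix (Fin d) (Fin d) ℝ) (x : Coord d) :
    scal G x = Matrix.trace ((G x)⁻¹ * (ricciMat G x).transpose) := by
  simp [scal, trace, Matrix.trace, Matrix.mul_apply, ricciMat]

/-- The scalar curvature does not depend on the coordinates. -/
theorem IsPullback.scal_eq (h : IsPullback G' G f U' U) (hx : x ∈ U') :
    scal G' x = scal G (f x) := by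
  have hfx := h.mapsTo hx
  have hi : (G' x)⁻¹ = (jacobian f x)⁻¹ * (G (f x))⁻¹ * ((jacobian f x).transpose)⁻¹ := by
    rw [h.eq x hx, Matrix.mul_inv_rev, Matrix.mul_inv_rev, mul_assoc]
  have hT : ((jacobian f x).transpose)⁻¹ * (jacobian f x).transpose = 1 :=
    Matrix.nonsing_inv_mul _ (by rw [Matrix.det_transpose]; exact (h.det_ne_zero hx).isUnit)
  rw [scal_eq_matrix_trace, scal_eq_matrix_trace, hi, h.ricciMat_eq hx, Matrix.transpose_mul,
    Matrix.transpose_mul, Matrix.transpose_transpose, mul_assoc,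
    ← mul_assoc _ (jacobian f x).transpose, hT, one_mul, mul_assoc, Matrix.trace_mul_comm,
    mul_assoc, mul_assoc, h.mul_inv hx, mul_one]

end ChangeOfCoordinates

/-! ### Coordinate expressions on manifolds -/

section Charts

set_option linter.unusedSectionVars false

variable {d : ℕ} {M : Type*} [TopologicalSpace M] [ChartedSpace (EuclideanSpace ℝ (Fin d)) M]

theorem pullback_congr (h : BilinField d M) {F F' : Coord d → M} {y : Coord d}
    (hF : F =ᶠ[𝓝 y] F') : pullback h F y = pullback h F' y := by
  have key : ∀ (p q : M) (v w : Coord d), p = q →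
      (h p v w : ℝ) = h q v w := by rintro p _ v w rfl; rfl
  ext i j
  have h1 := hF.mfderiv_eq (I := 𝓡 d) (I' := 𝓡 d)
  simp only [pullback]
  rw [h1]
  exact key _ _ _ _ hF.self_of_nhds

theorem pullback_comp (h : BilinField d M) {F : Coord d → M} {k : Coord d → Coord d}
    {y : Coord d} (hF : MDifferentiableAt (𝓡 d) (𝓡 d) F (k y)) (hk : DifferentiableAt ℝ k y) :
    pullback h (F ∘ k) y
      = (jacobian k y).transpose * pullback h F (k y) * jacobian k y := by
  have h1 : ∀ i, mfderiv (𝓡 d) (𝓡 d) (F ∘ k) y (EuclideanSpace.single i (1 : ℝ) : Coord d)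
      = ∑ m, jacobian k y m i •
        mfderiv (𝓡 d) (𝓡 d) F (k y) (EuclideanSpace.single m (1 : ℝ) : Coord d) := by
    intro i
    have h2 : fderiv ℝ k y (EuclideanSpace.single i (1 : ℝ))
        = ∑ m, jacobian k y m i • (EuclideanSpace.single m (1 : ℝ) : Coord d) := by
      ext m
      have h3 : HasFDerivAt (fun z => k z m)
          ((EuclideanSpace.proj m : Coord d →L[ℝ] ℝ).comp (fderiv ℝ k y)) y :=
        (EuclideanSpace.proj m : Coord d →L[ℝ] ℝ).hasFDerivAt.comp y hk.hasFDerivAt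
      have h4 : jacobian k y m i = fderiv ℝ k y (EuclideanSpace.single i (1 : ℝ)) m := by
        rw [jacobian_apply, pd, h3.fderiv]; rfl
      simp [← h4, Finset.sum_apply, Pi.single_apply]
    refine (mfderiv_comp_apply y hF hk.mdifferentiableAt _).trans ?_
    rw [mfderiv_eq_fderiv]
    have h3 : ∀ L : Coord d →L[ℝ] Coord d,
        L (∑ m, jacobian k y m i • (EuclideanSpace.single m (1 : ℝ) : Coord d))
          = ∑ m, jacobian k y m i • L (EuclideanSpace.single m (1 : ℝ) : Coord d) := fun L => by
      rw [map_sum]; simp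
    exact (congrArg (mfderiv (𝓡 d) (𝓡 d) F (k y)) h2).trans (h3 _)
  ext i j
  have h5 : pullback h (F ∘ k) y i j = h (F (k y))
      (mfderiv (𝓡 d) (𝓡 d) (F ∘ k) y (EuclideanSpace.single i (1 : ℝ) : Coord d))
      (mfderiv (𝓡 d) (𝓡 d) (F ∘ k) y (EuclideanSpace.single j (1 : ℝ) : Coord d)) := rfl
  rw [h5, h1, h1, map_sum]
  simp only [sum_apply, map_sum, map_smul, smul_apply,
    Matrix.mul_apply, Matrix.transpose_apply, smul_eq_mul, Finset.sum_mul, Finset.mul_sum]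
  refine Finset.sum_congr rfl fun m _ => Finset.sum_congr rfl fun n _ => ?_
  simp only [pullback]
  ring

variable [IsManifold (𝓡 d) ∞ M]

/-- The coefficients are the smooth section `g` evaluated on the images of constant vector fields
under the tangent map of `F`, and these images depend smoothly on the point. -/
theorem smooth_pullback (g : Metric d M) {F : Coord d → M} {Ω : Set (Coord d)} (hΩ : IsOpen Ω)
    (hF : ContMDiffOn (𝓡 d) (𝓡 d) ∞ F Ω) : MSmoothOn Ω (pullback g.inner F) := by
  have : IsManifold (𝓡 d) 1 M := IsManifold.of_le (n := ∞) (by simp)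
  have hv : ∀ i : Fin d, ContMDiffOn (𝓡 d) (𝓡 d).tangent ∞
      (fun y : Coord d => (⟨F y, mfderiv (𝓡 d) (𝓡 d) F y
        (EuclideanSpace.single i (1 : ℝ) : Coord d)⟩ : TangentBundle (𝓡 d) M)) Ω := by
    intro i
    have h1 := hF.contMDiffOn_tangentMapWithin (m := ∞) (by simp) hΩ.uniqueMDiffOn
    have h2 : ContMDiff (𝓡 d) (𝓡 d).tangent ∞
        (fun y : Coord d => (⟨y, (EuclideanSpace.single i (1 : ℝ) : Coord d)⟩ :
          TangentBundle (𝓡 d) (Coord d))) :=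
      contMDiff_vectorSpace_iff_contDiff.2 contDiff_const
    have h3 := h1.comp h2.contMDiffOn (s := Ω) (fun y hy => hy)
    refine h3.congr fun y hy => ?_
    simp only [Function.comp, tangentMapWithin, mfderivWithin_of_isOpen hΩ hy]
  intro i j y hy
  have h4 : ContMDiffWithinAt (𝓡 d) ((𝓡 d).prod 𝓘(ℝ)) ∞
      (fun m ↦ Bundle.TotalSpace.mk' ℝ (E := Bundle.Trivial M ℝ) (F m)
        (pullback g.inner F m i j)) Ω y := by
    apply ContMDiffWithinAt.clm_bundle_apply₂ (F₁ := EuclideanSpace ℝ (Fin d))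
      (F₂ := EuclideanSpace ℝ (Fin d))
    · exact ContMDiffAt.comp_contMDiffWithinAt y g.contMDiff.contMDiffAt (hF y hy)
    · exact hv i y hy
    · exact hv j y hy
  simp only [Bundle.contMDiffWithinAt_totalSpace] at h4
  exact h4.2.contDiffWithinAt

variable {φ ψ : OpenPartialHomeomorph M (EuclideanSpace ℝ (Fin d))} {x : Coord d}

theorem mdifferentiableAt_symm (hφ : φ ∈ IsManifold.maximalAtlas (𝓡 d) ∞ M) (hx : x ∈ φ.target) :
    MDifferentiableAt (𝓡 d) (𝓡 d) φ.symm x :=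
  (contMDiffAt_symm_of_mem_maximalAtlas hφ hx).mdifferentiableAt (by simp)

theorem mfderiv_symm_injective (hφ : φ ∈ IsManifold.maximalAtlas (𝓡 d) ∞ M) (hx : x ∈ φ.target)
    {v : Coord d} (hv : (mfderiv (𝓡 d) (𝓡 d) φ.symm x v : Coord d) = 0) : v = 0 := by
  have h1 : MDifferentiableAt (𝓡 d) (𝓡 d) φ (φ.symm x) :=
    (contMDiffAt_of_mem_maximalAtlas hφ (φ.map_target hx)).mdifferentiableAt (by simp)
  have h2 : (φ ∘ φ.symm) =ᶠ[𝓝 x] id :=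
    Filter.eventuallyEq_of_mem (φ.open_target.mem_nhds hx) fun y hy => φ.right_inv hy
  have h3 := mfderiv_comp_apply x h1 (mdifferentiableAt_symm hφ hx) v
  rw [h2.mfderiv_eq, mfderiv_id] at h3
  have h4 : ∀ L : Coord d →L[ℝ] Coord d, ∀ w : Coord d, w = 0 → L w = 0 := by
    rintro L w rfl; simp
  exact h3.trans (h4 _ _ hv)

theorem isMetricOn_coeff (g : Metric d M) (hφ : φ ∈ IsManifold.maximalAtlas (𝓡 d) ∞ M) :
    IsMetricOn (coeff g.inner φ) φ.target := by
  refine ⟨smooth_pullback g φ.open_target (contMDiffOn_symm_of_mem_maximalAtlas hφ),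
    fun x hx => Matrix.PosDef.of_dotProduct_mulVec_pos ?_ ?_⟩
  · ext i j
    simp only [Matrix.conjTranspose_apply, star_trivial]
    exact g.symm _ _ _
  · intro v hv
    have key : ∀ B : Coord d →L[ℝ] Coord d →L[ℝ] ℝ, ∀ L : Coord d →L[ℝ] Coord d,
        B (L (WithLp.toLp 2 v)) (L (WithLp.toLp 2 v))
        = ∑ i, v i * ∑ j, B (L (EuclideanSpace.single i (1 : ℝ)))
          (L (EuclideanSpace.single j (1 : ℝ))) * v j := by
      intro B L
      have e : (WithLp.toLp 2 v : Coord d)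
          = ∑ i, v i • (EuclideanSpace.single i (1 : ℝ) : Coord d) := by
        ext m
        simp [Pi.single_apply]
      rw [e]
      simp only [map_sum, map_smul, sum_apply, smul_apply, smul_eq_mul, Finset.mul_sum]
      rw [Finset.sum_comm]
      exact Finset.sum_congr rfl fun i _ => Finset.sum_congr rfl fun j _ => by ring
    have h1 := key (g.inner (φ.symm x)) (mfderiv (𝓡 d) (𝓡 d) φ.symm x)
    have h2 : dotProduct (star v) ((coeff g.inner φ x).mulVec v)
        = g.inner (φ.symm x) (mfderiv (𝓡 d) (𝓡 d) φ.symm x (WithLp.toLp 2 v : Coord d))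
          (mfderiv (𝓡 d) (𝓡 d) φ.symm x (WithLp.toLp 2 v : Coord d)) := by
      rw [star_trivial]
      exact h1.symm
    rw [h2]
    apply g.pos
    intro h0
    apply hv
    have h3 := mfderiv_symm_injective hφ hx h0
    ext i
    exact congrFun (congrArg WithLp.ofLp h3) i

theorem coeff_rescaled (h : BilinField d M) (s : M → ℝ)
    (φ : OpenPartialHomeomorph M (EuclideanSpace ℝ (Fin d))) :
    coeff (rescaled h s) φ = rescale (coeff h φ) (s ∘ φ.symm) := rfl

theorem smoothOn_comp_symm {s : M → ℝ} (hs : ContMDiff (𝓡 d) 𝓘(ℝ) ∞ s)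
    (hφ : φ ∈ IsManifold.maximalAtlas (𝓡 d) ∞ M) : SmoothOn φ.target (s ∘ φ.symm) :=
  (hs.comp_contMDiffOn (contMDiffOn_symm_of_mem_maximalAtlas hφ)).contDiffOn

theorem IsAlmostEinstein.isSolutionOn (hd : 3 ≤ d) {g : Metric d M} {s : M → ℝ}
    (hs : IsAlmostEinstein g s) (hφ : φ ∈ IsManifold.maximalAtlas (𝓡 d) ∞ M) :
    IsSolutionOn (coeff g.inner φ) (s ∘ φ.symm) φ.target where
  toIsMetricOn := isMetricOn_coeff g hφ
  isOpen := φ.open_target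
  three_le := hd
  smooth_u := smoothOn_comp_symm hs.smooth hφ
  equation := fun x hx a b => by
    have h := hs.equation (φ.symm x) φ ⟨hφ, φ.map_target hx⟩ a b
    rwa [φ.right_inv hx] at h

/-- The domain of the coordinate change from `φ` to `ψ`. -/
def transitionDomain (φ ψ : OpenPartialHomeomorph M (EuclideanSpace ℝ (Fin d))) :
    Set (Coord d) := φ.target ∩ φ.symm ⁻¹' ψ.source

theorem isOpen_transitionDomain (φ ψ : OpenPartialHomeomorph M (EuclideanSpace ℝ (Fin d))) :
    IsOpen (transitionDomain φ ψ) :=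
  φ.symm.isOpen_inter_preimage ψ.open_source

theorem contDiffOn_transition (hφ : φ ∈ IsManifold.maximalAtlas (𝓡 d) ∞ M)
    (hψ : ψ ∈ IsManifold.maximalAtlas (𝓡 d) ∞ M) :
    ContDiffOn ℝ ∞ (ψ ∘ φ.symm) (transitionDomain φ ψ) :=
  ((contMDiffOn_of_mem_maximalAtlas hψ).comp
    ((contMDiffOn_symm_of_mem_maximalAtlas hφ).mono Set.inter_subset_left)
    (fun _ hx => hx.2)).contDiffOn

theorem mapsTo_transition : Set.MapsTo (ψ ∘ φ.symm) (transitionDomain φ ψ) ψ.target :=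
  fun _ hx => ψ.map_source hx.2

theorem coeff_transition (h : BilinField d M) (hφ : φ ∈ IsManifold.maximalAtlas (𝓡 d) ∞ M)
    (hψ : ψ ∈ IsManifold.maximalAtlas (𝓡 d) ∞ M) (hx : x ∈ transitionDomain φ ψ) :
    coeff h φ x = (jacobian (ψ ∘ φ.symm) x).transpose * coeff h ψ ((ψ ∘ φ.symm) x)
      * jacobian (ψ ∘ φ.symm) x := by
  have h1 : φ.symm =ᶠ[𝓝 x] (ψ.symm ∘ (ψ ∘ φ.symm)) :=
    Filter.eventuallyEq_of_mem ((isOpen_transitionDomain φ ψ).mem_nhds hx)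
      fun y hy => (ψ.left_inv hy.2).symm
  rw [coeff, pullback_congr h h1,
    pullback_comp h (mdifferentiableAt_symm hψ (mapsTo_transition hx))]
  · rfl
  · exact ((contDiffOn_transition hφ hψ).contDiffAt
      ((isOpen_transitionDomain φ ψ).mem_nhds hx)).differentiableAt (by simp)

theorem isPullback_coeff (g : Metric d M) (hφ : φ ∈ IsManifold.maximalAtlas (𝓡 d) ∞ M)
    (hψ : ψ ∈ IsManifold.maximalAtlas (𝓡 d) ∞ M) :
    IsPullback (coeff g.inner φ) (coeff g.inner ψ) (ψ ∘ φ.symm) (transitionDomain φ ψ)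
      ψ.target where
  isOpen' := isOpen_transitionDomain φ ψ
  isOpen := ψ.open_target
  metric' := (isMetricOn_coeff g hφ).mono Set.inter_subset_left
  metric := isMetricOn_coeff g hψ
  smooth := contDiffOn_transition hφ hψ
  mapsTo := mapsTo_transition
  eq := fun _ hx => coeff_transition g.inner hφ hψ hx

/-- Needed so that invariance of scalar curvature can be applied to `g°`; hence both domains exclude
the zeros of `s`. -/
theorem IsAlmostEinstein.isPullback_rescaled (hd : 3 ≤ d) {g : Metric d M} {s : M → ℝ}
    (hs : IsAlmostEinstein g s) (hφ : φ ∈ IsManifold.maximalAtlas (𝓡 d) ∞ M)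
    (hψ : ψ ∈ IsManifold.maximalAtlas (𝓡 d) ∞ M) :
    IsPullback (coeff (rescaled g.inner s) φ) (coeff (rescaled g.inner s) ψ) (ψ ∘ φ.symm)
      (transitionDomain φ ψ ∩ {y | s (φ.symm y) ≠ 0}) (ψ.target ∩ {y | s (ψ.symm y) ≠ 0}) := by
  have hsφ := hs.isSolutionOn hd hφ
  have hsψ := hs.isSolutionOn hd hψ
  have ho : IsOpen (transitionDomain φ ψ ∩ {y | s (φ.symm y) ≠ 0}) :=
    (hsφ.restrict (isOpen_transitionDomain φ ψ) Set.inter_subset_left).isOpen_ne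
  refine ⟨ho, hsψ.isOpen_ne, ?_, ?_, ?_, ?_, ?_⟩
  · exact (hsφ.restrict ho fun y hy => hy.1.1).isMetricOn_rescale fun y hy => hy.2
  · exact (hsψ.restrict hsψ.isOpen_ne fun y hy => hy.1).isMetricOn_rescale fun y hy => hy.2
  · exact (contDiffOn_transition hφ hψ).mono Set.inter_subset_left
  · intro y hy
    refine ⟨mapsTo_transition hy.1, ?_⟩
    simp only [Set.mem_ofPred_eq, Function.comp, ψ.left_inv hy.1.2]
    exact hy.2
  · intro y hy
    exact coeff_transition _ hφ hψ hy.1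

theorem IsPullback.gradSq_eq {U U' : Set (Coord d)} {G G' : Coord d → Matrix (Fin d) (Fin d) ℝ}
    {f : Coord d → Coord d} (h : IsPullback G' G f U' U) (hx : x ∈ U') {u u' : Coord d → ℝ}
    (hu : SmoothOn U u) (heq : Set.EqOn u' (fun y => u (f y)) U') :
    gradSq G' u' x = gradSq G u (f x) := by
  have hfx := h.mapsTo hx
  have h1 : (fun b => pd b u' x) = (jacobian f x).transpose.mulVec (fun b => pd b u (f x)) := by
    ext b
    rw [pd_congr_of_eqOn h.isOpen' hx heq,
      pd_comp (hu.differentiableAt h.isOpen hfx) (h.differentiableAt hx)]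
    rfl
  have h2 : grad G u (f x) = (jacobian f x).mulVec (grad G' u' x) := by
    apply h.metric.mulVec_left_cancel hfx
    rw [h.metric.lower_grad hfx]
    have h3 := h.metric'.lower_grad (u := u') hx
    rw [h1, h.eq x hx, mul_assoc, ← Matrix.mulVec_mulVec] at h3
    have hT : ((jacobian f x).transpose)⁻¹ * (jacobian f x).transpose = 1 :=
      Matrix.nonsing_inv_mul _ (by rw [Matrix.det_transpose]; exact (h.det_ne_zero hx).isUnit)
    have h4 := congrArg ((((jacobian f x).transpose)⁻¹).mulVec ·) h3
    simp only [Matrix.mulVec_mulVec, hT, Matrix.one_mulVec] at h4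
    rw [← mul_assoc, hT, one_mul] at h4
    rw [Matrix.mulVec_mulVec, h4]
  rw [IsMetricOn.gradSq_eq, IsMetricOn.gradSq_eq, h1, h2, Matrix.mulVec_transpose,
    ← Matrix.dotProduct_mulVec]

/-- The function `S(g,s)` does not depend on the coordinates. -/
theorem IsAlmostEinstein.localS_eq (hd : 3 ≤ d) {g : Metric d M} {s : M → ℝ}
    (hs : IsAlmostEinstein g s) {p : M} (hφ : IsChartAround φ p) (hψ : IsChartAround ψ p) :
    localS (coeff g.inner φ) (s ∘ φ.symm) (φ p) = localS (coeff g.inner ψ) (s ∘ ψ.symm) (ψ p) := by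
  have hd' : (3 : ℝ) ≤ d := by exact_mod_cast hd
  have hsφ := hs.isSolutionOn hd hφ.1
  have hsψ := hs.isSolutionOn hd hψ.1
  have hxφ := φ.map_source hφ.2
  have hxψ := ψ.map_source hψ.2
  have hx : φ p ∈ transitionDomain φ ψ := ⟨hxφ, by simpa [φ.left_inv hφ.2] using hψ.2⟩
  have hf : (ψ ∘ φ.symm) (φ p) = ψ p := by simp [φ.left_inv hφ.2]
  have hu : (s ∘ φ.symm) (φ p) = s p := by simp [φ.left_inv hφ.2]
  have hu' : (s ∘ ψ.symm) (ψ p) = s p := by simp [ψ.left_inv hψ.2]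
  -- Off the zeros `S` is a nonzero constant multiple of the scalar curvature of `g°`, which is
  -- invariant; at a zero it is `-|ds|²`. Thus no transformation law for Hessians is needed.
  by_cases h0 : s p = 0
  · rw [AlmostEinstein.localS_eq hd, AlmostEinstein.localS_eq hd, hu, hu', h0,
      (isPullback_coeff g hφ.1 hψ.1).gradSq_eq hx hsψ.smooth_u (fun y hy => ?_), hf]
    · ring
    · simp [ψ.left_inv hy.2]
  · have h1 := hsφ.scal_rescale hxφ (by rwa [hu])
    have h2 := hsψ.scal_rescale hxψ (by rwa [hu'])
    have h3 := (hs.isPullback_rescaled hd hφ.1 hψ.1).scal_eq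
      ⟨hx, by simpa [φ.left_inv hφ.2] using h0⟩
    rw [hf, coeff_rescaled, coeff_rescaled, h1, h2] at h3
    refine mul_left_cancel₀ (mul_ne_zero ?_ ?_) h3 <;> linarith

end Charts

/-! ### Unique continuation and the constancy of `S(g,s)` -/

section UniqueContinuation

variable {d : ℕ} {U : Set (Coord d)} {x : Coord d} {G : Coord d → Matrix (Fin d) (Fin d) ℝ}
  {u : Coord d → ℝ}

/-- A solution of a linear first order system that vanishes at a point vanishes near it. -/
theorem eventually_eq_zero_of_linear_system {ι : Type*} [Fintype ι] {f : ι → Coord d → ℝ}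
    {c : Fin d → ι → ι → Coord d → ℝ} (hU : IsOpen U) (hf : ∀ i, SmoothOn U (f i))
    (hc : ∀ a i j, ContinuousOn (c a i j) U)
    (h : ∀ x ∈ U, ∀ a i, pd a (f i) x = ∑ j, c a i j x * f j x) (hx : x ∈ U)
    (h0 : ∀ i, f i x = 0) : ∀ᶠ y in 𝓝 x, ∀ i, f i y = 0 := by
  obtain ⟨r, hr, hrU⟩ := Metric.nhds_basis_closedBall.mem_iff.1 (hU.mem_nhds hx)
  have hcont : ContinuousOn (fun y => ∑ a, ∑ i, ∑ j, |c a i j y|) (Metric.closedBall x r) :=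
    continuousOn_finsetSum _ fun a _ => continuousOn_finsetSum _ fun i _ =>
      continuousOn_finsetSum _ fun j _ => ((hc a i j).mono hrU).abs
  obtain ⟨C, hC⟩ := (isCompact_closedBall x r).exists_bound_of_continuousOn hcont
  filter_upwards [Metric.closedBall_mem_nhds x hr] with z hz
  set v := z - x with hv
  have hvr : ‖v‖ ≤ r := by simpa [hv, dist_eq_norm] using hz
  have hseg : ∀ t ∈ Set.Icc (0 : ℝ) 1, x + t • v ∈ Metric.closedBall x r := by
    intro t ht
    rw [Metric.mem_closedBall, dist_eq_norm, add_sub_cancel_left, norm_smul,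
      Real.norm_of_nonneg ht.1]
    nlinarith [ht.1, ht.2, norm_nonneg v]
  -- Along the segment from `x` to `z` the system is a linear ODE with zero initial value. Its
  -- operator norm is at most `r * C`, so Grönwall's inequality forces the solution to vanish.
  have hder : ∀ t ∈ Set.Icc (0 : ℝ) 1, HasDerivAt (fun t : ℝ => fun i => f i (x + t • v))
      (fun i => ∑ a, v a * ∑ j, c a i j (x + t • v) * f j (x + t • v)) t := by
    intro t ht
    rw [hasDerivAt_pi]
    intro i
    have h1 := ((hf i).differentiableAt hU (hrU (hseg t ht))).hasFDerivAt
    have h2 : HasDerivAt (fun t : ℝ => x + t • v) v t := by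
      simpa using ((hasDerivAt_id t).smul_const v).const_add x
    have h3 := h1.comp_hasDerivAt t h2
    rw [fderiv_apply_eq_sum_pd] at h3
    simp only [h _ (hrU (hseg t ht))] at h3
    exact h3
  have hbound : ∀ t ∈ Set.Ico (0 : ℝ) 1,
      ‖fun i => ∑ a, v a * ∑ j, c a i j (x + t • v) * f j (x + t • v)‖
        ≤ (r * C) * ‖fun i => f i (x + t • v)‖ + 0 := by
    intro t ht
    have ht' : t ∈ Set.Icc (0 : ℝ) 1 := ⟨ht.1, ht.2.le⟩
    set N := ‖fun i => f i (x + t • v)‖ with hN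
    have hN0 : 0 ≤ N := norm_nonneg _
    have hCt := hC _ (hseg t ht')
    rw [Real.norm_of_nonneg (by positivity)] at hCt
    have hC0 : 0 ≤ C := le_trans (by positivity) hCt
    rw [add_zero, pi_norm_le_iff_of_nonneg (by positivity)]
    intro i
    have hva : ∀ a, |v a| ≤ r := fun a =>
      (by simpa using PiLp.norm_apply_le v a : |v a| ≤ ‖v‖).trans hvr
    have hfj : ∀ j, |f j (x + t • v)| ≤ N := fun j =>
      norm_le_pi_norm (fun i => f i (x + t • v)) j
    calc ‖∑ a, v a * ∑ j, c a i j (x + t • v) * f j (x + t • v)‖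
        ≤ ∑ a, ‖v a * ∑ j, c a i j (x + t • v) * f j (x + t • v)‖ := norm_sum_le _ _
      _ ≤ ∑ a, r * ∑ j, |c a i j (x + t • v)| * N := by
          refine Finset.sum_le_sum fun a _ => ?_
          rw [norm_mul]
          refine mul_le_mul (hva a) ((norm_sum_le _ _).trans (Finset.sum_le_sum fun j _ => ?_))
            (norm_nonneg _) hr.le
          rw [norm_mul]
          exact mul_le_mul_of_nonneg_left (hfj j) (norm_nonneg _)
      _ = r * (∑ a, ∑ j, |c a i j (x + t • v)|) * N := by
          rw [← Finset.mul_sum, mul_assoc, Finset.sum_mul]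
          simp only [Finset.sum_mul]
      _ ≤ (r * C) * N := by
          refine mul_le_mul_of_nonneg_right (mul_le_mul_of_nonneg_left (le_trans ?_ hCt) hr.le) hN0
          refine Finset.sum_le_sum fun a _ => ?_
          exact Finset.single_le_sum (f := fun i => ∑ j, |c a i j (x + t • v)|)
            (fun _ _ => by positivity) (Finset.mem_univ i)
  have hg := norm_le_gronwallBound_of_norm_deriv_right_le (δ := 0) (K := r * C) (ε := 0)
    (fun t ht => (hder t ht).continuousAt.continuousWithinAt)
    (fun t ht => (hder t ⟨ht.1, ht.2.le⟩).hasDerivWithinAt)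
    (by simp only [zero_smul, add_zero, h0]; exact norm_zero.le) hbound 1
    (by simp)
  rw [gronwallBound_ε0_δ0] at hg
  have hg' := norm_le_zero_iff.1 hg
  intro i
  have := congrFun hg' i
  simpa [hv] using this

/-- The coefficients of the closed linear system satisfied by `(u, grad u, ρ)`. -/
noncomputable def jetCoeff (G : Coord d → Matrix (Fin d) (Fin d) ℝ) (a : Fin d) :
    Unit ⊕ Fin d ⊕ Unit → Unit ⊕ Fin d ⊕ Unit → Coord d → ℝ
  | .inl _, .inr (.inl b), y => G y a b
  | .inr (.inl k), .inl _, y => -schoutenUp G y k a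
  | .inr (.inl k), .inr (.inl m), y => -conn G a y k m
  | .inr (.inl k), .inr (.inr _), _ => -(1 : Matrix (Fin d) (Fin d) ℝ) k a
  | .inr (.inr _), .inr (.inl m), y => schoutenMat G y a m
  | _, _, _ => 0

/-- The components of `(u, grad u, ρ)`. -/
noncomputable def jet (G : Coord d → Matrix (Fin d) (Fin d) ℝ) (u : Coord d → ℝ) :
    Unit ⊕ Fin d ⊕ Unit → Coord d → ℝ
  | .inl _, y => u y
  | .inr (.inl k), y => grad G u y k
  | .inr (.inr _), y => rho G u y

/-- `IsSolutionOn.cov_grad` and `IsSolutionOn.pd_rho` close up the system for `(u, grad u, ρ)`, so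
its zeros propagate. -/
theorem IsSolutionOn.eventually_eq_zero (h : IsSolutionOn G u U) (hx : x ∈ U) (h0 : u x = 0)
    (h1 : ∀ a, pd a u x = 0) (h2 : rho G u x = 0) : ∀ᶠ y in 𝓝 x, u y = 0 := by
  have hU := h.isOpen
  have key := eventually_eq_zero_of_linear_system (f := jet G u) (c := jetCoeff G) hU ?_ ?_ ?_ hx ?_
  · filter_upwards [key] with y hy
    exact hy (.inl ())
  · rintro (_ | k | _)
    · exact h.smooth_u
    · exact h.smooth_grad k
    · exact h.smooth_rho
  · rintro a (_ | k | _) (_ | m | _)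
    · exact continuousOn_const
    · exact (h.smooth a m).continuousOn
    · exact continuousOn_const
    · exact (h.smooth_schoutenUp hU k a).continuousOn.neg
    · exact (h.smooth_conn hU a k m).continuousOn.neg
    · exact continuousOn_const
    · exact continuousOn_const
    · exact (h.smooth_schoutenMat hU a m).continuousOn
    · exact continuousOn_const
  · rintro y hy a (_ | k | _)
    · simp only [Fintype.sum_sum_type, jetCoeff, jet, Finset.univ_unique, Finset.sum_const_zero,
        zero_mul, zero_add, add_zero]
      exact (congrFun (h.lower_grad hy) a).symm
    · simp only [Fintype.sum_sum_type, jetCoeff, jet, Finset.univ_unique, Finset.sum_singleton]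
      have h3 := congrFun (h.cov_grad hy a) k
      simp only [Pi.add_apply, vpd_apply, Matrix.mulVec, dotProduct] at h3
      have h4 : pd a (jet G u (.inr (.inl k))) y = pd a (fun z => grad G u z k) y := rfl
      rw [h4, eq_sub_of_add_eq h3]
      simp only [neg_mul, Finset.sum_neg_distrib]
      ring
    · simp only [Fintype.sum_sum_type, jetCoeff, jet, Finset.univ_unique, Finset.sum_const_zero,
        zero_mul, zero_add, add_zero]
      exact h.pd_rho hy a
  · have hg : grad G u x = 0 := by
      rw [grad, show (fun b => pd b u x) = 0 from funext h1, Matrix.mulVec_zero]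
    rintro (_ | k | _)
    · exact h0
    · exact congrFun hg k
    · exact h2

/-- The components of the jet are continuous and vanish wherever `u` vanishes locally, hence also at
limits of such points. This makes the interior of the zero set closed. -/
theorem IsSolutionOn.jet_eq_zero_of_frequently (h : IsSolutionOn G u U) (hx : x ∈ U)
    (h0 : ∃ᶠ y in 𝓝 x, ∀ᶠ z in 𝓝 y, u z = 0) :
    u x = 0 ∧ (∀ a, pd a u x = 0) ∧ rho G u x = 0 := by
  have key : ∀ f : Coord d → ℝ, SmoothOn U f → (∀ y, (∀ᶠ z in 𝓝 y, u z = 0) → f y = 0) →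
      f x = 0 := by
    intro f hf hfz
    by_contra hne
    have hc : ContinuousAt f x := hf.continuousOn.continuousAt (h.isOpen.mem_nhds hx)
    obtain ⟨y, hy1, hy2⟩ := (h0.and_eventually (hc.eventually_ne hne)).exists
    exact hy2 (hfz y hy1)
  have hpd : ∀ a y, (∀ᶠ z in 𝓝 y, u z = 0) → pd a u y = 0 := by
    intro a y hy
    rw [pd_congr (g := fun _ => 0) hy, pd_const]
  refine ⟨key u h.smooth_u fun y hy => hy.self_of_nhds,
    fun a => key _ (h.smooth_u.pd h.isOpen a) fun y hy => hpd a y hy,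
    key _ h.smooth_rho fun y hy => ?_⟩
  have hh : ∀ a b, hess G u a b y = 0 := by
    intro a b
    have h1 : pd a (pd b u) y = 0 := by
      rw [pd_congr (g := fun _ => 0), pd_const]
      filter_upwards [hy.eventually_nhds] with z hz using hpd b z hz
    simp [hess, h1, hpd _ y hy]
  simp [rho, laplacian, trace, hh, hy.self_of_nhds]

theorem eventually_eq_of_fderiv_eq_zero {f : Coord d → ℝ} (hU : IsOpen U) (hf : SmoothOn U f)
    (h : ∀ y ∈ U, ∀ a, pd a f y = 0) (hx : x ∈ U) : ∀ᶠ y in 𝓝 x, f y = f x := by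
  obtain ⟨r, hr, hrU⟩ := Metric.isOpen_iff.1 hU x hx
  filter_upwards [Metric.ball_mem_nhds x hr] with y hy
  exact (convex_ball x r).is_const_of_fderivWithin_eq_zero (𝕜 := ℝ)
    (fun z hz => (hf.differentiableAt hU (hrU hz)).differentiableWithinAt)
    (fun z hz => by
      rw [fderivWithin_of_isOpen Metric.isOpen_ball hz]
      exact fderiv_eq_zero_of_pd (h z (hrU hz))) hy (Metric.mem_ball_self hr)

end UniqueContinuation

/-! ### Density of the regular set, constancy of `S`, and curvature of the rescaled metric. -/

section Global

set_option linter.unusedSectionVars false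

variable {d : ℕ} {M : Type*} [TopologicalSpace M] [ChartedSpace (EuclideanSpace ℝ (Fin d)) M]
  [IsManifold (𝓡 d) ∞ M] {φ : OpenPartialHomeomorph M (EuclideanSpace ℝ (Fin d))}
  {g : Metric d M} {s : M → ℝ} {p : M}

theorem isChartAround_chartAt (p : M) :
    IsChartAround (chartAt (EuclideanSpace ℝ (Fin d)) p) p :=
  ⟨IsManifold.chart_mem_maximalAtlas p, mem_chart_source _ p⟩

theorem eventually_of_eventually_symm (hφ : p ∈ φ.source) {P : M → Prop}
    (h : ∀ᶠ y in 𝓝 (φ p), P (φ.symm y)) : ∀ᶠ q in 𝓝 p, P q := by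
  filter_upwards [(φ.continuousAt hφ).eventually h, φ.open_source.mem_nhds hφ] with q hq hq'
  rwa [φ.left_inv hq'] at hq

theorem eventually_symm_of_eventually (hφ : p ∈ φ.source) {P : M → Prop}
    (h : ∀ᶠ q in 𝓝 p, P q) : ∀ᶠ y in 𝓝 (φ p), P (φ.symm y) := by
  have h1 : Filter.Tendsto φ.symm (𝓝 (φ p)) (𝓝 p) := by
    have := φ.symm.continuousAt (x := φ p) (φ.map_source hφ)
    rwa [ContinuousAt, φ.left_inv hφ] at this
  exact h1.eventually h

/-- An almost Einstein scale does not vanish on any open set. -/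
theorem IsAlmostEinstein.not_eventually_eq_zero [ConnectedSpace M] (hd : 3 ≤ d)
    (hs : IsAlmostEinstein g s) (p : M) : ¬ ∀ᶠ q in 𝓝 p, s q = 0 := by
  -- The interior of the zero set is open and closed; by connectedness a single point of it would
  -- give `s = 0` everywhere.
  set Z : Set M := {p | ∀ᶠ q in 𝓝 p, s q = 0} with hZ
  have hopen : IsOpen Z := isOpen_iff_mem_nhds.2 fun p hp =>
    (Filter.Eventually.eventually_nhds hp : ∀ᶠ q in 𝓝 p, ∀ᶠ q' in 𝓝 q, s q' = 0)
  have hclosed : IsClosed Z := by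
    refine isClosed_of_closure_subset fun q hq => ?_
    have hφ := isChartAround_chartAt (d := d) q
    set φ := chartAt (EuclideanSpace ℝ (Fin d)) q
    have hsol := hs.isSolutionOn hd hφ.1
    have hx := φ.map_source hφ.2
    have hfreq : ∃ᶠ y in 𝓝 (φ q), ∀ᶠ z in 𝓝 y, (s ∘ φ.symm) z = 0 := by
      intro hcon
      have h1 : ∀ᶠ q' in 𝓝 q, ¬ ∀ᶠ z in 𝓝 (φ q'), (s ∘ φ.symm) z = 0 :=
        (φ.continuousAt hφ.2).eventually hcon
      obtain ⟨q', hq', hq'', hqs⟩ := ((mem_closure_iff_frequently.1 hq).and_eventually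
        (h1.and (φ.open_source.mem_nhds hφ.2))).exists
      exact hq'' (eventually_symm_of_eventually (P := fun q => s q = 0) hqs hq')
    obtain ⟨h0, h1, h2⟩ := hsol.jet_eq_zero_of_frequently hx hfreq
    exact eventually_of_eventually_symm (P := fun q => s q = 0) hφ.2
      (hsol.eventually_eq_zero hx h0 h1 h2)
  intro hp
  have huniv := (IsClopen.eq_univ ⟨hclosed, hopen⟩ ⟨p, hp⟩ : Z = Set.univ)
  obtain ⟨q, hq⟩ := hs.nontrivial
  have : q ∈ Z := huniv ▸ Set.mem_univ q
  exact hq (Filter.Eventually.self_of_nhds (p := fun q => s q = 0) this)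

theorem IsAlmostEinstein.dense [ConnectedSpace M] (hd : 3 ≤ d) (hs : IsAlmostEinstein g s) :
    Dense {p | s p ≠ 0} := by
  intro p
  rw [mem_closure_iff_frequently]
  intro h
  exact hs.not_eventually_eq_zero hd p (by simpa using h)

/-- The two-jet of an almost Einstein scale does not vanish. -/
theorem IsAlmostEinstein.rho_ne_zero [ConnectedSpace M] (hd : 3 ≤ d) (hs : IsAlmostEinstein g s)
    (hφ : IsChartAround φ p) (h0 : s p = 0) (h1 : ∀ a, pd a (s ∘ φ.symm) (φ p) = 0) :
    rho (coeff g.inner φ) (s ∘ φ.symm) (φ p) ≠ 0 := by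
  intro h2
  refine hs.not_eventually_eq_zero hd p
    (eventually_of_eventually_symm (P := fun q => s q = 0) hφ.2 ?_)
  exact (hs.isSolutionOn hd hφ.1).eventually_eq_zero (φ.map_source hφ.2)
    (by simpa [φ.left_inv hφ.2] using h0) h1 h2

theorem IsAlmostEinstein.scalarS_eq (hd : 3 ≤ d) (hs : IsAlmostEinstein g s)
    (hφ : IsChartAround φ p) :
    scalarS g.inner s p = localS (coeff g.inner φ) (s ∘ φ.symm) (φ p) :=
  hs.localS_eq hd (isChartAround_chartAt p) hφ

theorem IsAlmostEinstein.isLocallyConstant_scalarS (hd : 3 ≤ d) (hs : IsAlmostEinstein g s) :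
    IsLocallyConstant (scalarS g.inner s) := by
  rw [IsLocallyConstant.iff_eventually_eq]
  intro p
  have hφ := isChartAround_chartAt (d := d) p
  set φ := chartAt (EuclideanSpace ℝ (Fin d)) p
  have hsol := hs.isSolutionOn hd hφ.1
  have h1 := eventually_eq_of_fderiv_eq_zero hsol.isOpen hsol.smooth_localS
    (fun y hy a => hsol.pd_localS hy a) (φ.map_source hφ.2)
  filter_upwards [(φ.continuousAt hφ.2).eventually h1, φ.open_source.mem_nhds hφ.2] with q hq hq'
  rw [hs.scalarS_eq hd ⟨hφ.1, hq'⟩, hs.scalarS_eq hd hφ, hq]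

theorem IsAlmostEinstein.localS_eq_const [ConnectedSpace M] (hd : 3 ≤ d)
    (hs : IsAlmostEinstein g s) (p₀ : M) (hφ : IsChartAround φ p) :
    localS (coeff g.inner φ) (s ∘ φ.symm) (φ p) = scalarS g.inner s p₀ := by
  rw [← hs.scalarS_eq hd hφ]
  exact (hs.isLocallyConstant_scalarS hd).apply_eq_of_preconnectedSpace p p₀

theorem IsAlmostEinstein.ricciEqOn (hd : 3 ≤ d) (hs : IsAlmostEinstein g s) {c : ℝ}
    (hc : ∀ p φ, IsChartAround φ p → localS (coeff g.inner φ) (s ∘ φ.symm) (φ p) = c) :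
    RicciEqOn (rescaled g.inner s) (((d : ℝ) - 1) * c) (singularSet s)ᶜ := by
  intro p hp φ hφ a b
  rw [coeff_rescaled, (hs.isSolutionOn hd hφ.1).ricci_rescale (φ.map_source hφ.2)
    (by simpa [singularSet, φ.left_inv hφ.2] using hp), hc p φ hφ]

theorem IsAlmostEinstein.scalarCurvature_eq (hd : 3 ≤ d) (hs : IsAlmostEinstein g s) {c : ℝ}
    (hc : ∀ p φ, IsChartAround φ p → localS (coeff g.inner φ) (s ∘ φ.symm) (φ p) = c)
    (hp : p ∈ (singularSet s)ᶜ) :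
    scalarCurvature (rescaled g.inner s) p = (d : ℝ) * ((d : ℝ) - 1) * c := by
  have hφ := isChartAround_chartAt (d := d) p
  rw [scalarCurvature, coeff_rescaled, (hs.isSolutionOn hd hφ.1).scal_rescale
    (OpenPartialHomeomorph.map_source _ hφ.2)
    (by simpa [singularSet, OpenPartialHomeomorph.left_inv _ hφ.2] using hp), hc p _ hφ]

theorem IsMetricOn.gradSq_nonneg {U : Set (Coord d)} {x : Coord d}
    {G : Coord d → Matrix (Fin d) (Fin d) ℝ} {u : Coord d → ℝ} (hG : IsMetricOn G U)
    (hx : x ∈ U) : 0 ≤ gradSq G u x := by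
  have h := (hG.posDef x hx).inv.posSemidef.dotProduct_mulVec_nonneg (fun b => pd b u x)
  rw [IsMetricOn.gradSq_eq]
  simpa [grad] using h

theorem IsMetricOn.pd_eq_zero_of_gradSq {U : Set (Coord d)} {x : Coord d}
    {G : Coord d → Matrix (Fin d) (Fin d) ℝ} {u : Coord d → ℝ} (hG : IsMetricOn G U)
    (hx : x ∈ U) (h0 : gradSq G u x = 0) (a : Fin d) : pd a u x = 0 := by
  by_contra hne
  have h := (hG.posDef x hx).inv.dotProduct_mulVec_pos (x := fun b => pd b u x)
    (fun h => hne (congrFun h a))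
  rw [IsMetricOn.gradSq_eq] at h0
  simp only [star_trivial] at h
  exact h.ne' h0

/-- The source of the trichotomy: the sign of `S` decides whether zeros are impossible, critical or
regular. -/
theorem IsAlmostEinstein.gradSq_eq_neg (hd : 3 ≤ d) {c : ℝ}
    (hc : ∀ p φ, IsChartAround φ p → localS (coeff g.inner φ) (s ∘ φ.symm) (φ p) = c)
    (hφ : IsChartAround φ p) (h0 : s p = 0) :
    gradSq (coeff g.inner φ) (s ∘ φ.symm) (φ p) = -c := by
  have h1 := hc p φ hφ
  rw [AlmostEinstein.localS_eq hd] at h1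
  simp only [Function.comp, φ.left_inv hφ.2, h0] at h1 ⊢
  linarith

theorem mfderiv_eq_zero_iff (hs : ContMDiff (𝓡 d) 𝓘(ℝ) ∞ s) (hφ : IsChartAround φ p) :
    mfderiv (𝓡 d) 𝓘(ℝ) s p = 0 ↔ ∀ a, pd a (s ∘ φ.symm) (φ p) = 0 := by
  have hx := φ.map_source hφ.2
  have hsd : MDifferentiableAt (𝓡 d) 𝓘(ℝ) s (φ.symm (φ p)) :=
    (hs _).mdifferentiableAt (by simp)
  have hl := φ.left_inv hφ.2
  constructor
  · intro h a
    have h1 := mfderiv_comp_apply (φ p) hsd (mdifferentiableAt_symm hφ.1 hx)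
      (EuclideanSpace.single a (1 : ℝ) : Coord d)
    rw [mfderiv_eq_fderiv, hl, h] at h1
    exact h1
  · intro h
    have h2 := fderiv_eq_zero_of_pd h
    have h3 : MDifferentiableAt (𝓡 d) 𝓘(ℝ) (s ∘ φ.symm) (φ p) :=
      hsd.comp _ (mdifferentiableAt_symm hφ.1 hx)
    have h4 : s =ᶠ[𝓝 p] ((s ∘ φ.symm) ∘ φ) := by
      filter_upwards [φ.open_source.mem_nhds hφ.2] with q hq
      simp [φ.left_inv hq]
    have h5 := mfderiv_comp p h3
      ((contMDiffAt_of_mem_maximalAtlas hφ.1 hφ.2).mdifferentiableAt (by simp))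
    rw [h4.mfderiv_eq, h5, mfderiv_eq_fderiv, h2]
    ext v
    rfl

end Global

/-! ### Critical zeros of an almost Einstein scale -/

section CriticalZero

variable {d : ℕ} {U : Set (Coord d)} {x : Coord d} {G : Coord d → Matrix (Fin d) (Fin d) ℝ}
  {u : Coord d → ℝ}

theorem IsMetricOn.smooth_weyl (hG : IsMetricOn G U) (hU : IsOpen U) (a b c e : Fin d) :
    SmoothOn U (weyl G a b c e) := by
  have hP := hG.smooth_schouten hU
  have hg := hG.smooth
  have hR : SmoothOn U (riemann G a b c e) :=
    SmoothOn.sum fun m _ => (hg c m).mul (hG.smooth_riemannUp hU a b m e)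
  exact (hR.sub (((hg c a).mul (hP b e)).sub ((hg c b).mul (hP a e)))).sub
    (((hg e b).mul (hP a c)).sub ((hg e a).mul (hP b c)))

theorem IsMetricOn.smooth_cotton (hG : IsMetricOn G U) (hU : IsOpen U) (a b c : Fin d) :
    SmoothOn U (cotton G a b c) := by
  have hP := hG.smooth_schouten hU
  have hΓ := hG.smooth_christoffel hU
  have h : ∀ a b c, SmoothOn U (cov2 G (schouten G) a b c) := fun a b c =>
    ((hP b c).pd hU a).sub (SmoothOn.sum fun m _ =>
      ((hΓ m a b).mul (hP m c)).add ((hΓ m a c).mul (hP b m)))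
  exact (h b c a).sub (h c b a)

/-- Inherited from the skewness of the curvature endomorphisms; the two Schouten brackets are
exchanged up to sign. -/
theorem IsMetricOn.weyl_skew (hG : IsMetricOn G U) (hU : IsOpen U) (hx : x ∈ U)
    (a b c e : Fin d) : weyl G a b e c x = -weyl G a b c e x := by
  have h1 := congrFun (congrFun (hG.curv_skew hU hx a b) c) e
  have h2 : riemann G a b c e x = -riemann G a b e c x := by
    have e1 : riemann G a b c e x = (G x * curv G a b x) c e := rfl
    rw [e1, h1, Matrix.neg_apply, riemann, Matrix.mul_apply]
    congr 1
    exact Finset.sum_congr rfl fun m _ => by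
      rw [hG.symm hx e m, Matrix.transpose_apply, curv_apply, mul_comm]
  rw [weyl, weyl, h2]
  ring

theorem IsMetricOn.cottonUp_eq (hG : IsMetricOn G U) (hU : IsOpen U) (hx : x ∈ U)
    (k a b : Fin d) : cottonUp G k a b x = ∑ c, (G x)⁻¹ k c * cotton G c a b x := by
  have h1 : (G x).mulVec (fun k => cottonUp G k a b x) = fun c => cotton G c a b x := by
    ext c
    exact hG.lower_cottonUp hU hx c a b
  have h2 := congrArg (((G x)⁻¹).mulVec ·) h1
  simp only [Matrix.mulVec_mulVec, hG.inv_mul hx, Matrix.one_mulVec] at h2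
  exact congrFun h2 k

/-- `x` is a critical zero of the solution `u`. -/
structure IsCriticalZero (G : Coord d → Matrix (Fin d) (Fin d) ℝ) (u : Coord d → ℝ)
    (U : Set (Coord d)) (x : Coord d) : Prop extends IsSolutionOn G u U where
  mem : x ∈ U
  zero : u x = 0
  pd_zero : ∀ a, pd a u x = 0
  rho_ne : rho G u x ≠ 0

theorem IsCriticalZero.grad_eq_zero (h : IsCriticalZero G u U x) : grad G u x = 0 := by
  rw [grad, show (fun b => pd b u x) = 0 from funext h.pd_zero, Matrix.mulVec_zero]

/-- With `u` and `grad u` both zero, `IsSolutionOn.cov_grad` leaves only the multiple `-ρ` of the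
identity. -/
theorem IsCriticalZero.pd_grad (h : IsCriticalZero G u U x) (a k : Fin d) :
    pd a (fun y => grad G u y k) x = -(rho G u x * (1 : Matrix (Fin d) (Fin d) ℝ) k a) := by
  have h1 := congrFun (h.cov_grad h.mem a) k
  rw [h.grad_eq_zero, Matrix.mulVec_zero, add_zero, h.zero, vpd_apply] at h1
  rw [h1]
  ring

/-- The gradient has invertible derivative `-ρ` at `x`, so it is nonzero at nearby points other than
`x`. Since `S = 0`, any zero of `u` is a zero of the gradient. -/
theorem IsCriticalZero.eventually_ne_zero (h : IsCriticalZero G u U x)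
    (hS : ∀ y ∈ U, localS G u y = 0) : ∀ᶠ y in 𝓝[≠] x, u y ≠ 0 := by
  have hder : HasFDerivAt (fun y => (WithLp.toLp 2 (grad G u y) : Coord d))
      ((-rho G u x) • ContinuousLinearMap.id ℝ (Coord d)) x := by
    rw [← hasFDerivWithinAt_univ, hasFDerivWithinAt_euclidean]
    intro k
    rw [hasFDerivWithinAt_univ]
    have h1 := ((h.smooth_grad k).differentiableAt h.isOpen h.mem).hasFDerivAt
    refine h1.congr_fderiv ?_
    ext v
    simp only [fderiv_apply_eq_sum_pd, h.pd_grad]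
    simp [Matrix.one_apply, mul_comm]
  have h2 := hder.eventually_ne (c := 0) ⟨‖rho G u x‖₊⁻¹,
    AddMonoidHomClass.antilipschitz_of_bound _ fun z => by
      have := norm_ne_zero_iff.2 h.rho_ne
      simp only [smul_apply, ContinuousLinearMap.id_apply, norm_smul, norm_neg, NNReal.coe_inv,
        coe_nnnorm]
      rw [← mul_assoc, inv_mul_cancel₀ this, one_mul]⟩
  filter_upwards [h2, nhdsWithin_le_nhds (h.isOpen.mem_nhds h.mem)] with y hy hyU h0
  apply hy
  have h3 := hS y hyU
  rw [localS_eq h.three_le, h0] at h3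
  have h4 : ∀ a, pd a u y = 0 := h.pd_eq_zero_of_gradSq hyU (by linarith)
  rw [grad, show (fun b => pd b u y) = 0 from funext h4, Matrix.mulVec_zero]
  rfl

/-- A function of the form `∑ₑ Tₑ Vᵉ` with `V = grad u` has derivatives `-ρ T` at a critical
zero. -/
theorem IsCriticalZero.pd_sum_grad (h : IsCriticalZero G u U x) {T : Fin d → Coord d → ℝ}
    (hT : ∀ e, SmoothOn U (T e)) (f : Fin d) :
    pd f (fun y => ∑ e, T e y * grad G u y e) x = -(rho G u x * T f x) := by
  have d1 := fun e => (hT e).differentiableAt h.isOpen h.mem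
  have d2 := fun e => (h.smooth_grad e).differentiableAt h.isOpen h.mem
  rw [pd_sum (fun e _ => (d1 e).fun_mul (d2 e)),
    Finset.sum_congr rfl fun e _ => pd_mul (d1 e) (d2 e) f]
  simp [h.pd_grad, h.grad_eq_zero, Matrix.one_apply, mul_comm]

/-- The second derivatives of `∑ₑ Tₑ Vᵉ` at a critical zero where `T` vanishes. -/
theorem IsCriticalZero.pd_pd_sum_grad (h : IsCriticalZero G u U x) {T : Fin d → Coord d → ℝ}
    (hT : ∀ e, SmoothOn U (T e)) (h0 : ∀ e, T e x = 0) (e f : Fin d) :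
    pd e (pd f (fun y => ∑ c, T c y * grad G u y c)) x
      = -(rho G u x * (pd f (T e) x + pd e (T f) x)) := by
  have hU := h.isOpen
  have d1 := fun c y (hy : y ∈ U) => (hT c).differentiableAt hU hy
  have d2 := fun c y (hy : y ∈ U) => (h.smooth_grad c).differentiableAt hU hy
  have d3 := fun c => ((hT c).pd hU f).differentiableAt hU h.mem
  have d4 := fun c => ((h.smooth_grad c).pd hU f).differentiableAt hU h.mem
  have h1 : Set.EqOn (pd f (fun y => ∑ c, T c y * grad G u y c))
      (fun y => ∑ c, (pd f (T c) y * grad G u y c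
        + T c y * pd f (fun z => grad G u z c) y)) U := by
    intro y hy
    rw [pd_sum (fun c _ => (d1 c y hy).fun_mul (d2 c y hy))]
    exact Finset.sum_congr rfl fun c _ => pd_mul (d1 c y hy) (d2 c y hy) f
  rw [pd_congr_of_eqOn hU h.mem h1, pd_sum (fun c _ => ((d3 c).fun_mul (d2 c x h.mem)).fun_add
    ((d1 c x h.mem).fun_mul (d4 c)))]
  have h2 : ∀ c, pd e (fun y => pd f (T c) y * grad G u y c
        + T c y * pd f (fun z => grad G u z c) y) x
      = -(rho G u x * (1 : Matrix (Fin d) (Fin d) ℝ) c e) * pd f (T c) x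
        + -(rho G u x * (1 : Matrix (Fin d) (Fin d) ℝ) c f) * pd e (T c) x := by
    intro c
    rw [pd_add ((d3 c).fun_mul (d2 c x h.mem)) ((d1 c x h.mem).fun_mul (d4 c)),
      pd_mul (d3 c) (d2 c x h.mem), pd_mul (d1 c x h.mem) (d4 c), h.pd_grad, h.pd_grad, h0,
      h.grad_eq_zero]
    simp
    ring
  simp only [h2, Finset.sum_add_distrib, Matrix.one_apply]
  simp
  ring

/-- Differentiate `C(V) = -uA` at `x`: the left side gives `-ρC`, the right side zero since `u` and
`du` vanish. -/
theorem IsCriticalZero.weyl_eq_zero (h : IsCriticalZero G u U x) (a b c e : Fin d) :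
    weyl G a b c e x = 0 := by
  have hU := h.isOpen
  have h1 := h.pd_sum_grad (fun e => h.smooth_weyl hU a b c e) e
  have d1 := h.smooth_u.differentiableAt hU h.mem
  have d2 := (h.smooth_cotton hU c a b).differentiableAt hU h.mem
  rw [pd_congr_of_eqOn hU h.mem (fun y hy => h.weyl_grad hy a b c), pd_neg, pd_mul d1 d2,
    h.zero, h.pd_zero] at h1
  have h2 : rho G u x * weyl G a b c e x = 0 := by linarith
  exact (mul_eq_zero.1 h2).resolve_left h.rho_ne

/-- Contracting `C(V) = -uA` with `V` again kills the left side by skewness of `C`, and off `x` one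
may divide by `u`. At `x` itself `V = 0`. -/
theorem IsCriticalZero.cotton_grad (h : IsCriticalZero G u U x)
    (hne : ∀ᶠ y in 𝓝[≠] x, u y ≠ 0) (a b : Fin d) :
    ∀ᶠ y in 𝓝 x, ∑ c, cotton G c a b y * grad G u y c = 0 := by
  filter_upwards [eventually_nhdsWithin_iff.1 hne, h.isOpen.mem_nhds h.mem] with y hy hyU
  by_cases hyx : y = x
  · subst hyx
    simp [h.grad_eq_zero]
  have h1 : ∑ c, ∑ e, weyl G a b c e y * grad G u y e * grad G u y c = 0 :=
    sum_sum_eq_zero_of_skew fun c e => by rw [h.weyl_skew h.isOpen hyU a b c e]; ring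
  simp only [← Finset.sum_mul, h.weyl_grad hyU] at h1
  have h2 : u y * ∑ c, cotton G c a b y * grad G u y c = 0 := by
    rw [← neg_eq_zero, ← h1, Finset.mul_sum, ← Finset.sum_neg_distrib]
    exact Finset.sum_congr rfl fun c _ => by ring
  exact (mul_eq_zero.1 h2).resolve_left (hy hyx)

/-- The first derivatives of `A(V) = 0` at `x` are `-ρA`. -/
theorem IsCriticalZero.cotton_eq_zero (h : IsCriticalZero G u U x)
    (hne : ∀ᶠ y in 𝓝[≠] x, u y ≠ 0) (c a b : Fin d) : cotton G c a b x = 0 := by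
  have h1 := h.pd_sum_grad (fun e => h.smooth_cotton h.isOpen e a b) c
  rw [pd_congr (g := fun _ => 0) (h.cotton_grad hne a b), pd_const] at h1
  have h2 : rho G u x * cotton G c a b x = 0 := by linarith
  exact (mul_eq_zero.1 h2).resolve_left h.rho_ne

/-- The second derivatives of `A(V) = 0` at `x`, where `A` and `V` vanish, are `-ρ` times the
symmetrised derivative of `A`. -/
theorem IsCriticalZero.pd_cotton_skew (h : IsCriticalZero G u U x)
    (hne : ∀ᶠ y in 𝓝[≠] x, u y ≠ 0) (e f a b : Fin d) :
    pd f (cotton G e a b) x = -pd e (cotton G f a b) x := by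
  have h1 := h.pd_pd_sum_grad (fun e => h.smooth_cotton h.isOpen e a b)
    (fun e => h.cotton_eq_zero hne e a b) e f
  rw [pd_congr (g := fun _ => 0), pd_const] at h1
  · have h2 : rho G u x * (pd f (cotton G e a b) x + pd e (cotton G f a b) x) = 0 := by linarith
    have := (mul_eq_zero.1 h2).resolve_left h.rho_ne
    linarith
  · filter_upwards [(h.cotton_grad hne a b).eventually_nhds] with y hy
    rw [pd_congr (g := fun _ => 0) hy, pd_const]

/-- As `C = 0` and `A = 0` at `x`, only `g^{cf} ∂_f A_{acb}` remains. Skewness turns it into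
`-g^{cf} ∂_a A_{fcb}`, the derivative of a trace of `A` that vanishes identically. -/
theorem IsCriticalZero.bach_eq_zero (h : IsCriticalZero G u U x)
    (hne : ∀ᶠ y in 𝓝[≠] x, u y ≠ 0) (a b : Fin d) : bach G a b x = 0 := by
  have hU := h.isOpen
  have hc0 := h.cotton_eq_zero hne
  have htr : Set.EqOn (fun y => ∑ k, ∑ c, (G y)⁻¹ k c * cotton G c k b y) (fun _ => 0) U := by
    intro y hy
    simp only [← h.cottonUp_eq hU hy]
    exact h.trace_cottonUp hU h.three_le hy b
  have d1 := fun k c => (h.smooth_inv k c).differentiableAt hU h.mem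
  have d2 := fun k c => (h.smooth_cotton hU c k b).differentiableAt hU h.mem
  have h1 := pd_congr_of_eqOn hU h.mem htr a
  rw [pd_const, pd_sum (fun k _ => DifferentiableAt.fun_sum fun c _ =>
    (d1 k c).fun_mul (d2 k c))] at h1
  have h2 : ∀ k, pd a (fun y => ∑ c, (G y)⁻¹ k c * cotton G c k b y) x
      = ∑ c, (G x)⁻¹ k c * pd a (cotton G c k b) x := by
    intro k
    rw [pd_sum (fun c _ => (d1 k c).fun_mul (d2 k c))]
    exact Finset.sum_congr rfl fun c _ => by rw [pd_mul (d1 k c) (d2 k c), hc0]; ring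
  simp only [h2] at h1
  have h3 : ∀ c f, (G x)⁻¹ c f * cov3 G (cotton G) f a c b x
      = -((G x)⁻¹ c f * pd a (cotton G f c b) x) := by
    intro c f
    rw [cov3]
    simp only [hc0, mul_zero, add_zero, Finset.sum_const_zero, sub_zero]
    rw [h.pd_cotton_skew hne a f c b]
    ring
  rw [bach]
  simp only [h.weyl_eq_zero, mul_zero, Finset.sum_const_zero, add_zero, h3,
    Finset.sum_neg_distrib, h1, neg_zero]

end CriticalZero

/-! ### Regular zeros: slice charts and umbilicity -/

section Slice

variable {d : ℕ} {M : Type*} [TopologicalSpace M] [ChartedSpace (EuclideanSpace ℝ (Fin d)) M]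
  [IsManifold (𝓡 d) ∞ M] {φ : OpenPartialHomeomorph M (EuclideanSpace ℝ (Fin d))}
  {g : Metric d M} {s : M → ℝ} {p : M}

theorem trans_mem_maximalAtlas (hφ : φ ∈ IsManifold.maximalAtlas (𝓡 d) ∞ M)
    {e : OpenPartialHomeomorph (EuclideanSpace ℝ (Fin d)) (EuclideanSpace ℝ (Fin d))}
    (he : ContDiffOn ℝ ∞ e e.source) (he' : ContDiffOn ℝ ∞ e.symm e.target) :
    φ.trans e ∈ IsManifold.maximalAtlas (𝓡 d) ∞ M := by
  apply OpenPartialHomeomorph.mem_maximalAtlas_of_contMDiffOn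
  · rw [OpenPartialHomeomorph.trans_source]
    exact he.contMDiffOn.comp
      ((contMDiffOn_of_mem_maximalAtlas hφ).mono Set.inter_subset_left) (fun _ hx => hx.2)
  · rw [OpenPartialHomeomorph.trans_target]
    exact (contMDiffOn_symm_of_mem_maximalAtlas hφ).comp
      (he'.contMDiffOn.mono Set.inter_subset_left) (fun _ hx => hx.2)

/-- Every chart can be restricted to one whose target is a ball. -/
theorem exists_ball_chart (hφ : IsChartAround φ p) :
    ∃ (ψ : OpenPartialHomeomorph M (EuclideanSpace ℝ (Fin d))) (r : ℝ), 0 < r ∧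
      IsChartAround ψ p ∧ (∀ q, ψ q = φ q) ∧ ψ.source ⊆ φ.source ∧
      ψ.target = Metric.ball (ψ p) r := by
  obtain ⟨r, hr, hrt⟩ := Metric.isOpen_iff.1 φ.open_target (φ p) (φ.map_source hφ.2)
  set ψ := (φ.symm.restrOpen (Metric.ball (φ p) r) Metric.isOpen_ball).symm with hψ
  have hcoe : ∀ q, ψ q = φ q := fun q => rfl
  have htarget : ψ.target = Metric.ball (φ p) r := by
    have : ψ.target = φ.target ∩ Metric.ball (φ p) r := rfl
    rw [this, Set.inter_eq_right.2 hrt]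
  have hsource : ψ.source = φ.source ∩ φ ⁻¹' Metric.ball (φ p) r := by
    ext q
    constructor
    · intro hq
      have h1 : ψ q ∈ ψ.target := ψ.map_source hq
      have h2 : φ.symm (φ q) = q := ψ.left_inv hq
      rw [htarget] at h1
      refine ⟨?_, h1⟩
      rw [← h2]
      exact φ.map_target (hrt h1)
    · rintro ⟨hq1, hq2⟩
      have h1 : ψ.symm (φ q) ∈ ψ.source := ψ.map_target (by rw [htarget]; exact hq2)
      have h2 : ψ.symm (φ q) = q := φ.left_inv hq1
      rwa [h2] at h1
  refine ⟨ψ, r, hr, ⟨?_, ?_⟩, hcoe, by rw [hsource]; exact Set.inter_subset_left, htarget⟩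
  · apply OpenPartialHomeomorph.mem_maximalAtlas_of_contMDiffOn
    · exact (contMDiffOn_of_mem_maximalAtlas hφ.1).mono
        (by rw [hsource]; exact Set.inter_subset_left)
    · exact (contMDiffOn_symm_of_mem_maximalAtlas hφ.1).mono (by rw [htarget]; exact hrt)
  · rw [hsource]
    exact ⟨hφ.2, Metric.mem_ball_self hr⟩

/-- The coordinate change that replaces the `i`-th coordinate by `u`. -/
noncomputable def straighten (u : Coord d → ℝ) (i : Fin d) (y : Coord d) : Coord d :=
  y + (u y - y i) • EuclideanSpace.single i (1 : ℝ)

theorem straighten_apply_self (u : Coord d → ℝ) (i : Fin d) (y : Coord d) :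
    straighten u i y i = u y := by
  simp [straighten]

/-- The differential is `id + (du - dx_i) ⊗ e_i`. A kernel vector has `v_j = 0` for `j ≠ i`, and
then `∂_i u · v_i = 0`. -/
theorem exists_hasFDerivAt_straighten {u : Coord d → ℝ} {i : Fin d} {y : Coord d}
    (hu : DifferentiableAt ℝ u y) (h0 : pd i u y ≠ 0) :
    ∃ L : Coord d ≃L[ℝ] Coord d, HasFDerivAt (straighten u i) (L : Coord d →L[ℝ] Coord d) y := by
  set A : Coord d →L[ℝ] Coord d := ContinuousLinearMap.id ℝ (Coord d)
    + (fderiv ℝ u y - EuclideanSpace.proj i).smulRight (EuclideanSpace.single i (1 : ℝ)) with hA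
  have hder : HasFDerivAt (straighten u i) A y :=
    (hasFDerivAt_id y).add ((hu.hasFDerivAt.sub
      (EuclideanSpace.proj i : Coord d →L[ℝ] ℝ).hasFDerivAt).smul_const _)
  have hinj : Function.Injective (A : Coord d →ₗ[ℝ] Coord d) := by
    rw [← LinearMap.ker_eq_bot, LinearMap.ker_eq_bot']
    intro v hv
    have h1 : ∀ j, v j + (fderiv ℝ u y v - v i) * (EuclideanSpace.single i (1 : ℝ) : Coord d) j
        = 0 := fun j => congrFun (congrArg WithLp.ofLp hv) j
    have h2 : ∀ j, j ≠ i → v j = 0 := fun j hj => by simpa [hj] using h1 j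
    have h3 : fderiv ℝ u y v = 0 := by simpa using h1 i
    rw [fderiv_apply_eq_sum_pd, Finset.sum_eq_single i (fun j _ hj => by simp [h2 j hj])
      (by simp)] at h3
    ext j
    by_cases hj : j = i
    · subst hj
      simpa [h0] using h3
    · simpa using h2 j hj
  refine ⟨(LinearEquiv.ofInjectiveEndo _ hinj).toContinuousLinearEquiv, ?_⟩
  refine hder.congr_fderiv ?_
  ext v
  simp

/-- Near a regular zero of `s` there is a smooth chart with `s` as one of its coordinates. -/
theorem exists_slice_chart (hs : ContMDiff (𝓡 d) 𝓘(ℝ) ∞ s)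
    (h0 : mfderiv (𝓡 d) 𝓘(ℝ) s p ≠ 0) :
    ∃ (ψ : OpenPartialHomeomorph M (EuclideanSpace ℝ (Fin d))) (i : Fin d) (r : ℝ), 0 < r ∧
      IsChartAround ψ p ∧ (∀ q ∈ ψ.source, ψ q i = s q) ∧ ψ.target = Metric.ball (ψ p) r := by
  have hφ := isChartAround_chartAt (d := d) p
  set φ := chartAt (EuclideanSpace ℝ (Fin d)) p
  obtain ⟨i, hi⟩ : ∃ i, pd i (s ∘ φ.symm) (φ p) ≠ 0 := by
    by_contra hcon
    push Not at hcon
    exact h0 ((mfderiv_eq_zero_iff hs hφ).2 hcon)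
  set u := s ∘ φ.symm with hu
  have hus : SmoothOn φ.target u := smoothOn_comp_symm hs hφ.1
  have hx := φ.map_source hφ.2
  -- On `W` the differential is invertible at every point, so the local inverse is smooth on its
  -- whole domain and not only at the image of `p`.
  set W := φ.target ∩ pd i u ⁻¹' {0}ᶜ with hW
  have hWo : IsOpen W := (hus.pd φ.open_target i).continuousOn.isOpen_inter_preimage
    φ.open_target isOpen_compl_singleton
  have hxW : φ p ∈ W := ⟨hx, hi⟩
  have hcd : ContDiffOn ℝ ∞ (straighten u i) φ.target :=
    contDiffOn_id.add ((hus.sub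
      (EuclideanSpace.proj i : Coord d →L[ℝ] ℝ).contDiff.contDiffOn).smul contDiffOn_const)
  have hcda : ∀ y ∈ W, ContDiffAt ℝ ∞ (straighten u i) y := fun y hy =>
    hcd.contDiffAt (φ.open_target.mem_nhds hy.1)
  have hL : ∀ y ∈ W, ∃ L : Coord d ≃L[ℝ] Coord d,
      HasFDerivAt (straighten u i) (L : Coord d →L[ℝ] Coord d) y := fun y hy =>
    exists_hasFDerivAt_straighten (hus.differentiableAt φ.open_target hy.1) hy.2
  obtain ⟨L, hL0⟩ := hL _ hxW
  set e₀ := (hcda _ hxW).toOpenPartialHomeomorph (straighten u i) hL0 (by simp)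
  set e := e₀.restrOpen W hWo with he
  have hes : e.source ⊆ W := fun y hy => hy.2
  have hcoe : ∀ y, e y = straighten u i y := fun y => rfl
  have hc1 : ContDiffOn ℝ ∞ e e.source := fun y hy => (hcda y (hes hy)).contDiffWithinAt
  have hc2 : ContDiffOn ℝ ∞ e.symm e.target := by
    intro y hy
    have hy' := hes (e.map_target hy)
    obtain ⟨L', hL'⟩ := hL _ hy'
    exact (e.contDiffAt_symm hy hL' (hcda _ hy')).contDiffWithinAt
  have hp : p ∈ (φ.trans e).source := by
    rw [OpenPartialHomeomorph.trans_source]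
    exact ⟨hφ.2, (hcda _ hxW).mem_toOpenPartialHomeomorph_source hL0 (by simp), hxW⟩
  have hcoord : ∀ q ∈ φ.source, (φ.trans e) q i = s q := by
    intro q hq
    have h1 : (φ.trans e) q i = straighten u i (φ q) i := rfl
    rw [h1, straighten_apply_self, hu, Function.comp, φ.left_inv hq]
  -- A ball as target makes the part `s ≥ 0` of the chart domain the image of a convex set.
  obtain ⟨ψ, r, hr, hψ, hψc, hψs, hψt⟩ :=
    exists_ball_chart (φ := φ.trans e) (p := p) ⟨trans_mem_maximalAtlas hφ.1 hc1 hc2, hp⟩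
  refine ⟨ψ, i, r, hr, hψ, fun q hq => ?_, hψt⟩
  rw [hψc]
  exact hcoord q (hψs hq).1

theorem pd_eq_zero_of_eventually_line {f : Coord d → ℝ} {y : Coord d} {j : Fin d}
    (hf : DifferentiableAt ℝ f y)
    (h : ∀ᶠ t in 𝓝 (0 : ℝ), f (y + t • EuclideanSpace.single j (1 : ℝ)) = 0) : pd j f y = 0 := by
  have h1 := hf.hasFDerivAt.hasLineDerivAt (EuclideanSpace.single j (1 : ℝ))
  have h2 : HasDerivAt (fun t : ℝ => f (y + t • EuclideanSpace.single j (1 : ℝ))) 0 0 :=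
    (hasDerivAt_const 0 (0 : ℝ)).congr_of_eventuallyEq h
  exact HasDerivAt.unique h1 h2

/-- If a function vanishes on an open part of a coordinate hyperplane, then so do its derivatives
in the directions of the hyperplane. -/
theorem pd_eq_zero_of_eq_zero_on_hyperplane {U : Set (Coord d)} (hU : IsOpen U)
    {f : Coord d → ℝ} (hf : SmoothOn U f) {i j : Fin d} (hj : j ≠ i)
    (h0 : ∀ y ∈ U, y i = 0 → f y = 0) {y : Coord d} (hy : y ∈ U) (hyi : y i = 0) :
    pd j f y = 0 := by
  apply pd_eq_zero_of_eventually_line (hf.differentiableAt hU hy)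
  have hc : Continuous fun t : ℝ => y + t • EuclideanSpace.single j (1 : ℝ) := by fun_prop
  have h1 : ∀ᶠ t in 𝓝 (0 : ℝ), y + t • EuclideanSpace.single j (1 : ℝ) ∈ U :=
    hc.continuousAt.eventually (hU.mem_nhds (by simpa using hy))
  filter_upwards [h1] with t ht
  exact h0 _ ht (by simp [hyi, hj.symm])

theorem isHypersurface_singularSet (hs : ContMDiff (𝓡 d) 𝓘(ℝ) ∞ s)
    (h0 : ∀ p, s p = 0 → mfderiv (𝓡 d) 𝓘(ℝ) s p ≠ 0) : IsHypersurface d (singularSet s) := by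
  intro p hp
  obtain ⟨ψ, i, r, -, hψ, hψs, -⟩ := exists_slice_chart hs (h0 p hp)
  exact ⟨ψ, i, ⟨hψ.1, fun q hq => by rw [hψs q hq]; rfl⟩, hψ.2⟩

theorem IsAlmostEinstein.mfderiv_ne_zero (hd : 3 ≤ d) {c : ℝ} (hneg : c < 0)
    (hs : IsAlmostEinstein g s)
    (hc : ∀ p φ, IsChartAround φ p → localS (coeff g.inner φ) (s ∘ φ.symm) (φ p) = c)
    (h0 : s p = 0) : mfderiv (𝓡 d) 𝓘(ℝ) s p ≠ 0 := by
  have hφ := isChartAround_chartAt (d := d) p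
  intro h
  have h1 := (mfderiv_eq_zero_iff hs.smooth hφ).1 h
  have h2 := IsAlmostEinstein.gradSq_eq_neg hd hc hφ h0
  simp [gradSq, trace, h1] at h2
  linarith

/-- In a slice chart `u` and `∂_k u` with `k ≠ i` vanish on the hyperplane, so the tangential
Hessian is `-Γ^i_{jk} ∂_i u`, while `IsSolutionOn.hess_eq` makes it `-ρ g_{jk}`. Dividing by `∂_i u
≠ 0` gives the factor `H`. -/
theorem IsAlmostEinstein.isTotallyUmbilic (hd : 3 ≤ d) {c : ℝ} (hneg : c < 0)
    (hs : IsAlmostEinstein g s)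
    (hc : ∀ p φ, IsChartAround φ p → localS (coeff g.inner φ) (s ∘ φ.symm) (φ p) = c) :
    IsTotallyUmbilicHypersurface g.inner (singularSet s) := by
  have hne := fun p (h0 : s p = 0) => hs.mfderiv_ne_zero (p := p) hd hneg hc h0
  refine ⟨isHypersurface_singularSet hs.smooth hne, fun φ i hφ q hq => ?_⟩
  have hsol := hs.isSolutionOn hd hφ.1
  have hx := φ.map_source hq.2
  have hi : φ q i = 0 := (hφ.2 q hq.2).1 hq.1
  have hzero : ∀ y ∈ φ.target, y i = 0 → (s ∘ φ.symm) y = 0 := by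
    intro y hy hyi
    have := (hφ.2 (φ.symm y) (φ.map_target hy)).2 (by rwa [φ.right_inv hy])
    exact this
  set u := s ∘ φ.symm
  set G := coeff g.inner φ
  have hpd : ∀ j, j ≠ i → ∀ y ∈ φ.target, y i = 0 → pd j u y = 0 := fun j hj y hy hyi =>
    pd_eq_zero_of_eq_zero_on_hyperplane φ.open_target hsol.smooth_u hj hzero hy hyi
  have hpi : pd i u (φ q) ≠ 0 := by
    intro h
    refine hne q hq.1 ((mfderiv_eq_zero_iff hs.smooth ⟨hφ.1, hq.2⟩).2 fun a => ?_)
    by_cases ha : a = i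
    · rw [ha]; exact h
    · exact hpd a ha _ hx hi
  refine ⟨rho G u (φ q) / (pd i u (φ q) * Real.sqrt ((G (φ q))⁻¹ i i)), fun j k hj hk => ?_⟩
  have h1 := hsol.hess_eq hx j k
  have h2 : pd j (pd k u) (φ q) = 0 := pd_eq_zero_of_eq_zero_on_hyperplane φ.open_target
    (hsol.smooth_u.pd φ.open_target k) hj (hpd k hk) hx hi
  rw [hess, h2, hzero _ hx hi, Finset.sum_eq_single i
    (fun m _ hm => by rw [hpd m hm _ hx hi, mul_zero]) (by simp)] at h1
  have h3 : christoffel G i j k (φ q) = rho G u (φ q) / pd i u (φ q) * G (φ q) j k := by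
    field_simp
    linarith
  rw [secondFundamentalForm, h3, div_mul_eq_div_div]
  ring

end Slice

/-! ### Compact manifolds: decomposition into Poincaré-Einstein pieces -/

section Compact

set_option linter.unusedSectionVars false

variable {d : ℕ} {M : Type*} [TopologicalSpace M] [ChartedSpace (EuclideanSpace ℝ (Fin d)) M]
  [IsManifold (𝓡 d) ∞ M] {g : Metric d M} {s : M → ℝ} {p : M}

/-- At an interior point the zero would be a local minimum of `s`, hence critical. -/
theorem notMem_interior_of_regular_zero (hs : ContMDiff (𝓡 d) 𝓘(ℝ) ∞ s)
    (h0 : s p = 0) (h1 : mfderiv (𝓡 d) 𝓘(ℝ) s p ≠ 0) {K : Set M} (hK : ∀ q ∈ K, 0 ≤ s q) :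
    p ∉ interior K := by
  intro hp
  have hφ := isChartAround_chartAt (d := d) p
  refine h1 ((mfderiv_eq_zero_iff hs hφ).2 fun a => ?_)
  have hmin : IsLocalMin (s ∘ (chartAt (EuclideanSpace ℝ (Fin d)) p).symm)
      (chartAt (EuclideanSpace ℝ (Fin d)) p p) := by
    refine (eventually_symm_of_eventually hφ.2 (P := fun q => 0 ≤ s q)
      (Filter.mem_of_superset (mem_interior_iff_mem_nhds.1 hp) hK)).mono fun y hy => ?_
    simpa [h0] using hy
  rw [pd, hmin.fderiv_eq_zero]
  rfl

/-- The points of `{s ≥ 0}` near a point `p` of this set lie in the component of `p`. -/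
theorem exists_nhds_inter_subset_component (hs : ContMDiff (𝓡 d) 𝓘(ℝ) ∞ s)
    (hreg : ∀ p, s p = 0 → mfderiv (𝓡 d) 𝓘(ℝ) s p ≠ 0) (hp : 0 ≤ s p) :
    ∃ V ∈ 𝓝 p, V ∩ {q | 0 ≤ s q} ⊆ connectedComponentIn {q | 0 ≤ s q} p ∧
      (s p = 0 → ∃ (ψ : OpenPartialHomeomorph M (EuclideanSpace ℝ (Fin d))) (i : Fin d),
        IsChartAround ψ p ∧ ψ.source = V ∧ ∀ q ∈ ψ.source, ψ q i = s q) := by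
  rcases hp.eq_or_lt with h0 | hpos
  · obtain ⟨ψ, i, r, hr, hψ, hψs, hψt⟩ := exists_slice_chart hs (hreg p h0.symm)
    refine ⟨ψ.source, ψ.open_source.mem_nhds hψ.2, ?_, fun _ => ⟨ψ, i, hψ, rfl, hψs⟩⟩
    have himage : ψ.source ∩ {q | 0 ≤ s q} = ψ.symm '' (ψ.target ∩ {y | 0 ≤ y i}) := by
      ext q
      constructor
      · rintro ⟨hq, hq'⟩
        refine ⟨ψ q, ⟨ψ.map_source hq, ?_⟩, ψ.left_inv hq⟩
        simpa [hψs q hq] using hq'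
      · rintro ⟨y, ⟨hy, hyi⟩, rfl⟩
        refine ⟨ψ.map_target hy, ?_⟩
        have := hψs _ (ψ.map_target hy)
        rw [ψ.right_inv hy] at this
        simpa [← this] using hyi
    -- A ball cut by a half-space is convex, so the points of the chart with `s ≥ 0` form a
    -- connected set containing `p`.
    have hconv : Convex ℝ (ψ.target ∩ {y : EuclideanSpace ℝ (Fin d) | 0 ≤ y i}) := by
      rw [hψt]
      exact (convex_ball _ _).inter
        (convex_halfSpace_ge (EuclideanSpace.proj (𝕜 := ℝ) i).isLinear 0)
    have hpre : IsPreconnected (ψ.source ∩ {q | 0 ≤ s q}) := by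
      rw [himage]
      exact hconv.isPreconnected.image _ (ψ.continuousOn_symm.mono Set.inter_subset_left)
    exact hpre.subset_connectedComponentIn ⟨hψ.2, hp⟩ Set.inter_subset_right
  · have := ChartedSpace.locallyConnectedSpace (EuclideanSpace ℝ (Fin d)) M
    have ho : IsOpen {q | 0 < s q} := isOpen_lt continuous_const hs.continuous
    refine ⟨connectedComponentIn {q | 0 < s q} p,
      ho.connectedComponentIn.mem_nhds (mem_connectedComponentIn hpos), ?_,
      fun h => absurd h hpos.ne'⟩
    refine Set.inter_subset_left.trans
      (isPreconnected_connectedComponentIn.subset_connectedComponentIn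
        (mem_connectedComponentIn hpos) ?_)
    exact (connectedComponentIn_subset _ _).trans fun q hq =>
      (show 0 < s q from hq).le

/-- The pieces are the connected components of `{s ≥ 0}`. Each point has a neighbourhood meeting
this set in one component only, so compactness gives finiteness, and each component inherits the
local half-space structure. -/
theorem isFiniteUnionOfPoincareEinstein [ConnectedSpace M] [CompactSpace M]
    (hs : ContMDiff (𝓡 d) 𝓘(ℝ) ∞ s) (hreg : ∀ p, s p = 0 → mfderiv (𝓡 d) 𝓘(ℝ) s p ≠ 0)
    (hric : RicciEqOn (rescaled g.inner s) (-((d : ℝ) - 1)) (singularSet s)ᶜ) :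
    IsFiniteUnionOfPoincareEinstein g s {p | 0 ≤ s p} (singularSet s) := by
  set N := {p | 0 ≤ s p} with hN
  have hNc : IsClosed N := isClosed_le continuous_const hs.continuous
  choose! V hV hVK hVψ using fun p (hp : p ∈ N) =>
    exists_nhds_inter_subset_component (p := p) hs hreg hp
  have hmem : ∀ p q, q ∈ connectedComponentIn N p →
      connectedComponentIn N q = connectedComponentIn N p :=
    fun p q hq => (connectedComponentIn_eq hq).symm
  refine ⟨(connectedComponentIn N) '' N, ?_, ?_, ?_, ?_⟩
  · obtain ⟨t, htN, htc⟩ := hNc.isCompact.elim_nhds_subcover V hV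
    refine (t.finite_toSet.image (connectedComponentIn N)).subset ?_
    rintro _ ⟨q, hq, rfl⟩
    obtain ⟨p, hp, hqp⟩ := Set.mem_iUnion₂.1 (htc hq)
    exact ⟨p, hp, (hmem p q (hVK p (htN p hp) ⟨hqp, hq⟩)).symm⟩
  · rintro _ ⟨p, hp, rfl⟩ _ ⟨q, hq, rfl⟩ hpq
    refine Set.disjoint_left.2 fun x hxp hxq => hpq ?_
    rw [← hmem p x hxp, ← hmem q x hxq]
  · refine Set.Subset.antisymm (Set.sUnion_subset ?_) fun p hp =>
      ⟨_, ⟨p, hp, rfl⟩, mem_connectedComponentIn hp⟩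
    rintro _ ⟨p, -, rfl⟩
    exact connectedComponentIn_subset _ _
  rintro _ ⟨p, hp, rfl⟩
  set K := connectedComponentIn N p with hK
  have hKN : K ⊆ N := connectedComponentIn_subset _ _
  have hKV : ∀ q ∈ K, V q ∩ N ⊆ K := fun q hq => by
    rw [hK, ← hmem p q hq]
    exact hVK q (hKN hq)
  have hKc : IsClosed K := by
    refine isClosed_of_closure_subset ?_
    exact (isPreconnected_connectedComponentIn.closure).subset_connectedComponentIn
      (subset_closure (mem_connectedComponentIn hp)) (hNc.closure_subset_iff.2 hKN)
  have hinterior : ∀ q ∈ K, s q ≠ 0 → q ∈ interior K := by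
    intro q hq hq0
    have hpos : 0 < s q := lt_of_le_of_ne (hKN hq) hq0.symm
    refine mem_interior_iff_mem_nhds.2 (Filter.mem_of_superset (Filter.inter_mem (hV q (hKN hq))
      ((isOpen_lt continuous_const hs.continuous).mem_nhds hpos)) fun x hx => ?_)
    exact hKV q hq ⟨hx.1, (show 0 < s x from hx.2).le⟩
  have hbd : ∀ q, s q = 0 → q ∉ interior K := fun q hq =>
    notMem_interior_of_regular_zero hs hq (hreg q hq) fun x hx => hKN hx
  have hfr : frontier K = K ∩ singularSet s := by
    rw [hKc.frontier_eq]
    ext q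
    refine ⟨fun hq => ⟨hq.1, by_contra fun h => hq.2 (hinterior q hq.1 h)⟩,
      fun hq => ⟨hq.1, hbd q hq.2⟩⟩
  refine ⟨⟨⟨p, mem_connectedComponentIn hp⟩, isPreconnected_connectedComponentIn⟩, ?_, hfr, ?_⟩
  · refine ⟨hKc.isCompact, fun q hq => ?_, hs, fun q hq => hKN hq, fun q hq => ?_, fun q hq => ?_,
      fun q hq => ?_⟩
    · by_cases h0 : s q = 0
      · obtain ⟨ψ, i, hψ, hψV, hψs⟩ := hVψ q (hKN hq) h0
        refine Or.inr ⟨ψ, i, hψ, by rw [hψs q hψ.2, h0], fun x hx => ?_⟩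
        rw [hψs x hx]
        exact ⟨fun h => hKN h, fun h => hKV q hq ⟨hψV ▸ hx, h⟩⟩
      · exact Or.inl (hinterior q hq h0)
    · rw [hfr]
      exact ⟨fun h => ⟨hq, h⟩, fun h => h.2⟩
    · rw [hfr] at hq
      exact hreg q hq.2
    · exact hric q fun h => hbd q h hq
  · rintro ⟨z, hz⟩
    -- A piece without boundary is open and closed, hence all of `M`; but a regular zero is never
    -- interior to a set where `s ≥ 0`.
    by_contra hemp
    rw [Set.not_nonempty_iff_eq_empty, ← isClopen_iff_frontier_eq_empty] at hemp
    have huniv := hemp.eq_univ ⟨p, mem_connectedComponentIn hp⟩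
    have : z ∈ interior K := by rw [huniv, interior_univ]; trivial
    exact hbd z hz this

theorem rescaled_neg (h : BilinField d M) (s : M → ℝ) : rescaled h (-s) = rescaled h s := by
  funext p
  simp [rescaled]

theorem IsAlmostEinstein.isFiniteUnionOfPoincareEinstein [ConnectedSpace M] [CompactSpace M]
    (hd : 3 ≤ d) (hs : IsAlmostEinstein g s)
    (hc : ∀ p φ, IsChartAround φ p → localS (coeff g.inner φ) (s ∘ φ.symm) (φ p) = -1) :
    IsFiniteUnionOfPoincareEinstein g s {p | s p < 0}ᶜ (singularSet s) ∧
      IsFiniteUnionOfPoincareEinstein g (-s) {p | 0 < s p}ᶜ (singularSet s) := by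
  have hreg := fun p (h0 : s p = 0) => hs.mfderiv_ne_zero (p := p) hd (by norm_num) hc h0
  have hric := hs.ricciEqOn hd hc
  rw [mul_neg_one] at hric
  constructor
  · have := AlmostEinstein.isFiniteUnionOfPoincareEinstein hs.smooth hreg hric
    convert this using 1
    ext p
    simp
  -- The second half is the first one for `-s`, which has the same zeros and the same rescaled
  -- metric.
  · have hsing : singularSet (-s) = singularSet s := by
      ext p
      simp [singularSet]
    have := AlmostEinstein.isFiniteUnionOfPoincareEinstein (g := g) (s := -s) hs.smooth.neg
      (fun p h0 h1 => ?_) (by rwa [rescaled_neg, hsing])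
    · rw [hsing] at this
      convert this using 1
      ext p
      simp
    · refine hreg p (neg_eq_zero.1 h0) ?_
      rw [mfderiv_neg] at h1
      exact neg_eq_zero.1 h1

end Compact

/-! ### Hadamard's lemma -/

section Hadamard

variable {E F : Type} [NormedAddCommGroup E] [NormedSpace ℝ E] [FiniteDimensional ℝ E]
  [NormedAddCommGroup F] [NormedSpace ℝ F]

/-- Differentiation under the integral sign; the dominating constant comes from compactness of a
closed ball times `[0,1]`. -/
theorem hasFDerivAt_integral_unitInterval {f : E × ℝ → F} (hf : ContDiff ℝ 1 f) (x : E) :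
    HasFDerivAt (fun x => ∫ θ in (0 : ℝ)..1, f (x, θ))
      (∫ θ in (0 : ℝ)..1, (fderiv ℝ f (x, θ)).comp (ContinuousLinearMap.inl ℝ E ℝ)) x := by
  have hdf : Continuous fun q : E × ℝ =>
      (fderiv ℝ f q).comp (ContinuousLinearMap.inl ℝ E ℝ) :=
    (hf.continuous_fderiv one_ne_zero).clm_comp continuous_const
  have : ProperSpace E := FiniteDimensional.proper ℝ E
  obtain ⟨C, hC⟩ := ((isCompact_closedBall x 1).prod
    (isCompact_Icc (a := (0 : ℝ)) (b := 1))).exists_bound_of_continuousOn hdf.continuousOn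
  refine intervalIntegral.hasFDerivAt_integral_of_dominated_of_fderiv_le (𝕜 := ℝ)
    (F := fun x θ => f (x, θ))
    (F' := fun x θ => (fderiv ℝ f (x, θ)).comp (ContinuousLinearMap.inl ℝ E ℝ))
    (bound := fun _ => C) (Metric.closedBall_mem_nhds x one_pos) ?_ ?_ ?_ ?_ ?_ ?_
  · exact Filter.Eventually.of_forall fun y =>
      (hf.continuous.comp (by fun_prop : Continuous fun θ : ℝ => (y, θ))).aestronglyMeasurable
  · exact (hf.continuous.comp
      (by fun_prop : Continuous fun θ : ℝ => (x, θ))).intervalIntegrable _ _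
  · exact (hdf.comp (by fun_prop : Continuous fun θ : ℝ => (x, θ))).aestronglyMeasurable
  · refine Filter.Eventually.of_forall fun θ hθ y hy => hC (y, θ) ⟨hy, ?_⟩
    rw [Set.uIoc_of_le zero_le_one] at hθ
    exact Set.Ioc_subset_Icc_self hθ
  · exact continuous_const.intervalIntegrable _ _
  · refine Filter.Eventually.of_forall fun θ _ y _ => ?_
    exact ((hf.differentiable one_ne_zero (y, θ)).hasFDerivAt).comp y
      (hasFDerivAt_prodMk_left y θ)

/-- `F` is quantified inside the induction because each derivative moves to the new target `E →L[ℝ]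
F`. -/
theorem contDiff_integral_unitInterval (n : ℕ) : ∀ {F : Type} [NormedAddCommGroup F]
    [NormedSpace ℝ F] {f : E × ℝ → F}, ContDiff ℝ ∞ f →
      ContDiff ℝ n (fun x => ∫ θ in (0 : ℝ)..1, f (x, θ)) := by
  induction n with
  | zero =>
    intro F _ _ f hf
    refine contDiff_zero.2 (continuous_iff_continuousAt.2 fun x => ?_)
    exact (hasFDerivAt_integral_unitInterval (hf.of_le (by simp)) x).continuousAt
  | succ n ih =>
    intro F _ _ f hf
    push_cast
    exact contDiff_succ_iff_hasFDerivAt.2 ⟨_, ih ((hf.fderiv_right (m := ∞) (by simp)).clm_comp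
      contDiff_const), fun x => hasFDerivAt_integral_unitInterval (hf.of_le (by simp)) x⟩

/-- **Hadamard's lemma**. -/
theorem exists_contDiff_eq_apply_self [CompleteSpace F] {f : E → F} (hf : ContDiff ℝ ∞ f)
    (h0 : f 0 = 0) :
    ∃ A : E → E →L[ℝ] F, ContDiff ℝ ∞ A ∧ A 0 = fderiv ℝ f 0 ∧ ∀ x, f x = A x x := by
  have hdf : ContDiff ℝ ∞ (fderiv ℝ f) := hf.fderiv_right (by simp)
  -- `A` is the mean of the differential over the segment from `0` to `x`.
  refine ⟨fun x => ∫ θ in (0 : ℝ)..1, fderiv ℝ f (θ • x), ?_, by simp, fun x => ?_⟩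
  · exact contDiff_infty.2 fun n => contDiff_integral_unitInterval n
      (f := fun q : E × ℝ => fderiv ℝ f (q.2 • q.1)) (hdf.comp (contDiff_snd.smul contDiff_fst))
  · have hc : Continuous fun θ : ℝ => fderiv ℝ f (θ • x) :=
      hdf.continuous.comp (by fun_prop)
    have h1 : ∀ θ ∈ Set.uIcc (0 : ℝ) 1,
        HasDerivAt (fun θ : ℝ => f (θ • x)) (fderiv ℝ f (θ • x) x) θ := by
      intro θ _
      have h2 : HasDerivAt (fun θ : ℝ => θ • x) x θ := by
        simpa using (hasDerivAt_id θ).smul_const x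
      exact (hf.differentiable (by simp) (θ • x)).hasFDerivAt.comp_hasDerivAt θ h2
    have h3 := intervalIntegral.integral_eq_sub_of_hasDerivAt h1
      ((hc.clm_apply continuous_const).intervalIntegrable _ _)
    rw [ContinuousLinearMap.intervalIntegral_apply (hc.intervalIntegrable _ _), h3]
    simp [h0]

/-- A smooth function with vanishing value and differential at the origin is a quadratic form with
smooth coefficients. -/
theorem exists_contDiff_eq_quadratic {u : E → ℝ} (hu : ContDiff ℝ ∞ u) (h0 : u 0 = 0)
    (h1 : fderiv ℝ u 0 = 0) :
    ∃ B : E → E →L[ℝ] E →L[ℝ] ℝ, ContDiff ℝ ∞ B ∧ (∀ x, u x = B x x x) ∧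
      ∀ x, 2 * B 0 x x = fderiv ℝ (fderiv ℝ u) 0 x x := by
  obtain ⟨A, hA, hA0, hAu⟩ := exists_contDiff_eq_apply_self hu h0
  obtain ⟨B, hB, hB0, hBA⟩ := exists_contDiff_eq_apply_self hA (hA0.trans h1)
  refine ⟨B, hB, fun x => by rw [hAu, hBA], fun x => ?_⟩
  have hdA : ∀ y, HasFDerivAt A (fderiv ℝ A y) y := fun y =>
    (hA.differentiable (by simp) y).hasFDerivAt
  have hddA : HasFDerivAt (fderiv ℝ A) (fderiv ℝ (fderiv ℝ A) 0) 0 :=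
    ((hA.fderiv_right (m := ∞) (by simp)).differentiable (by simp) 0).hasFDerivAt
  -- Differentiating `u y = A y y` twice at the origin gives `2 A'(0) x x`, and `B 0 = A'(0)`; hence
  -- the factor `2`.
  have h2 : ∀ v, (fun y => fderiv ℝ u y v) = fun y => A y v + fderiv ℝ A y v y := by
    intro v
    funext y
    have := ((hdA y).clm_apply (hasFDerivAt_id y)).congr_of_eventuallyEq
      (Filter.Eventually.of_forall hAu)
    rw [this.fderiv]
    simp
  have h3 : HasFDerivAt (fun y => fderiv ℝ u y x) ((fderiv ℝ (fderiv ℝ u) 0).flip x) 0 := by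
    have := ((hu.fderiv_right (m := ∞) (by simp)).differentiable (by simp) 0).hasFDerivAt.clm_apply
      (hasFDerivAt_const x 0)
    simpa using this
  have h4 := ((hdA 0).clm_apply (hasFDerivAt_const x 0)).add
    ((hddA.clm_apply (hasFDerivAt_const x 0)).clm_apply (hasFDerivAt_id 0))
  have h5 := congrArg (fun T : E →L[ℝ] ℝ => T x)
    (h3.unique (h4.congr_of_eventuallyEq (Filter.Eventually.of_forall (congrFun (h2 x)))))
  simp at h5
  rw [hB0, h5]
  ring

/-- A bump function extends the germ to the whole space, where Hadamard's lemma is stated. -/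
theorem exists_contDiff_eventuallyEq {U : Set E} (hU : IsOpen U) {u : E → ℝ} {x : E} (hx : x ∈ U)
    (hu : ContDiffOn ℝ ∞ u U) : ∃ v : E → ℝ, ContDiff ℝ ∞ v ∧ v =ᶠ[𝓝 x] u := by
  obtain ⟨r, hr, hrU⟩ := Metric.isOpen_iff.1 hU x hx
  let χ : ContDiffBump x := ⟨r / 4, r / 2, by positivity, by linarith⟩
  refine ⟨fun y => χ y * u y, contDiff_iff_contDiffAt.2 fun y => ?_, ?_⟩
  · by_cases hy : y ∈ tsupport χ
    · rw [χ.tsupport_eq] at hy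
      have hyU : y ∈ U := hrU (Metric.closedBall_subset_ball (by simp [χ]; linarith) hy)
      exact χ.contDiff.contDiffAt.mul (hu.contDiffAt (hU.mem_nhds hyU))
    · refine contDiffAt_const (c := (0 : ℝ)) |>.congr_of_eventuallyEq ?_
      filter_upwards [(isClosed_tsupport χ).isOpen_compl.mem_nhds hy] with z hz
      rw [image_eq_zero_of_notMem_tsupport hz, zero_mul]
  · filter_upwards [χ.eventuallyEq_one] with y hy
    rw [hy]
    simp

end Hadamard

/-! ### Decay estimates -/

section Decay

variable {E H : Type*} [NormedAddCommGroup E] [NormedSpace ℝ E] [NormedAddCommGroup H]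
  [NormedSpace ℝ H]

theorem iteratedFDeriv_comp_affine {Φ : H → ℝ} {Ω : Set H} (hΩ : IsOpen Ω)
    (hΦ : ContDiffOn ℝ ∞ Φ Ω) (q : H) (T : E →L[ℝ] H) {y : E} (hy : q + T y ∈ Ω) (k : ℕ) :
    iteratedFDeriv ℝ k (fun y => Φ (q + T y)) y
      = (iteratedFDeriv ℝ k Φ (q + T y)).compContinuousLinearMap fun _ => T := by
  set Ω' := (fun z => q + z) ⁻¹' Ω with hΩ'
  have hΩ'o : IsOpen Ω' := hΩ.preimage (by fun_prop)
  have hTo : IsOpen (T ⁻¹' Ω') := hΩ'o.preimage T.continuous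
  have hΦ' : ContDiffOn ℝ ∞ (fun z => Φ (q + z)) Ω' :=
    hΦ.comp (contDiff_const.add contDiff_id).contDiffOn (fun z hz => hz)
  have h1 := T.iteratedFDerivWithin_comp_right hΦ' hΩ'o.uniqueDiffOn hTo.uniqueDiffOn
    (x := y) hy (i := k) (by exact_mod_cast le_top)
  rw [iteratedFDerivWithin_of_isOpen k hTo hy, iteratedFDerivWithin_of_isOpen k hΩ'o hy,
    iteratedFDeriv_comp_add_left] at h1
  exact h1

/-- Let `f` be a function near infinity such that `f (ε⁻¹ z)` extends to a smooth function of
`(ε, z)` near the part `ε = 0`, `‖z‖ = 1` of the boundary, where it vanishes. Then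
`∂^k f = O(|y|^{-1-k})`. -/
theorem exists_norm_iteratedFDeriv_le {f : E → ℝ} {Φ : ℝ × E → ℝ} {Ω : Set (ℝ × E)}
    [FiniteDimensional ℝ E]
    (hΩ : IsOpen Ω) (hΦ : ContDiffOn ℝ ∞ Φ Ω) {δ : ℝ} (hδ : 0 < δ)
    (hK : ∀ ε z, ε ∈ Set.Icc 0 δ → ‖z‖ = 1 → (ε, z) ∈ Ω)
    (h0 : ∀ z, (0, z) ∈ Ω → Φ (0, z) = 0)
    (hf : ∀ ε z, 0 < ε → (ε, z) ∈ Ω → f (ε⁻¹ • z) = Φ (ε, z)) (k : ℕ) :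
    ∃ C : ℝ, ∀ y, δ⁻¹ < ‖y‖ → ‖iteratedFDeriv ℝ k f y‖ ≤ C * ‖y‖ ^ (-1 - (k : ℝ)) := by
  have : ProperSpace E := FiniteDimensional.proper ℝ E
  set T := ContinuousLinearMap.inr ℝ ℝ E
  -- `Ψ` is the `k`-th derivative of `Φ` in the `z` variable. It vanishes at `ε = 0` because `Φ`
  -- does, so the mean value inequality in `ε` bounds it by `Cε` on the unit sphere.
  set Ψ : ℝ × E → ContinuousMultilinearMap ℝ (fun _ : Fin k => E) ℝ := fun q =>
    (iteratedFDeriv ℝ k Φ q).compContinuousLinearMap fun _ => T with hΨ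
  have hΨs : ContDiffOn ℝ 1 Ψ Ω := by
    have h1 : ContDiffOn ℝ 1 (iteratedFDeriv ℝ k Φ) Ω := by
      intro q hq
      exact ((hΦ.contDiffAt (hΩ.mem_nhds hq)).iteratedFDeriv_right
        (by exact_mod_cast le_top)).contDiffWithinAt
    exact (ContinuousMultilinearMap.compContinuousLinearMapL (F := ℝ)
      (fun _ : Fin k => T)).contDiff.comp_contDiffOn h1
  have hΨ0 : ∀ z, (0, z) ∈ Ω → Ψ (0, z) = 0 := by
    intro z hz
    have h1 := iteratedFDeriv_comp_affine hΩ hΦ 0 T (y := z) (by simpa [T] using hz) k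
    have h2 : (fun y => Φ (0 + T y)) =ᶠ[𝓝 z] fun _ => 0 := by
      have : ∀ᶠ y in 𝓝 z, ((0 : ℝ), y) ∈ Ω :=
        (by fun_prop : Continuous fun y : E => ((0 : ℝ), y)).continuousAt.eventually
          (hΩ.mem_nhds hz)
      filter_upwards [this] with y hy
      simpa [T] using h0 y hy
    rw [Filter.EventuallyEq.eq_of_nhds (h2.iteratedFDeriv ℝ k)] at h1
    simp only [zero_add, iteratedFDeriv_fun_zero] at h1
    simpa [hΨ, T] using h1.symm
  have hcompact : IsCompact (Set.Icc (0 : ℝ) δ ×ˢ Metric.sphere (0 : E) 1) :=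
    isCompact_Icc.prod (isCompact_sphere 0 1)
  have hsub : Set.Icc (0 : ℝ) δ ×ˢ Metric.sphere (0 : E) 1 ⊆ Ω := fun q hq =>
    hK q.1 q.2 hq.1 (by simpa using hq.2)
  obtain ⟨C, hC⟩ := hcompact.exists_bound_of_continuousOn
    ((hΨs.continuousOn_fderiv_of_isOpen hΩ le_rfl).mono hsub)
  refine ⟨C, fun y hy => ?_⟩
  have hypos : 0 < ‖y‖ := (inv_pos.2 hδ).trans hy
  set ε := ‖y‖⁻¹ with hε
  have hεpos : 0 < ε := inv_pos.2 hypos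
  have hεδ : ε ≤ δ := by
    rw [hε]
    exact (inv_lt_of_inv_lt₀ hδ hy).le
  have hz : ‖ε • y‖ = 1 := by
    rw [norm_smul, Real.norm_of_nonneg hεpos.le, hε, inv_mul_cancel₀ hypos.ne']
  have hmem : ∀ t ∈ Set.Icc 0 ε, (t, ε • y) ∈ Set.Icc (0 : ℝ) δ ×ˢ Metric.sphere (0 : E) 1 :=
    fun t ht => ⟨⟨ht.1, ht.2.trans hεδ⟩, by simpa using hz⟩
  have hΨb : ‖Ψ (ε, ε • y)‖ ≤ C * ε := by
    have h1 := (convex_Icc (0 : ℝ) ε |>.prod (convex_singleton (ε • y)))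
      |>.norm_image_sub_le_of_norm_hasFDerivWithin_le (f := Ψ) (f' := fderiv ℝ Ψ) (C := C)
      (x := (0, ε • y)) (y := (ε, ε • y)) ?_ ?_ ⟨Set.left_mem_Icc.2 hεpos.le, rfl⟩
      ⟨Set.right_mem_Icc.2 hεpos.le, rfl⟩
    · rw [hΨ0 _ (hsub (hmem 0 (Set.left_mem_Icc.2 hεpos.le))), sub_zero] at h1
      simpa [Prod.norm_def, abs_of_pos hεpos, max_eq_left hεpos.le] using h1
    · rintro ⟨t, z⟩ ⟨ht, rfl⟩
      exact ((hΨs.contDiffAt (hΩ.mem_nhds (hsub (hmem t ht)))).differentiableAt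
        one_ne_zero).hasFDerivAt.hasFDerivWithinAt
    · rintro ⟨t, z⟩ ⟨ht, rfl⟩
      exact hC _ (hmem t ht)
  have hΩy : (ε, ε • y) ∈ Ω := hsub (hmem ε (Set.right_mem_Icc.2 hεpos.le))
  -- With `ε = ‖y‖⁻¹` fixed, `f` is `Φ` after scaling by `ε`, so `k` derivatives bring the factor `ε
  -- ^ k` besides the `ε` from `Ψ`.
  have heq : f =ᶠ[𝓝 y] fun z => Φ ((ε, 0) + (ε • T) z) := by
    have : ∀ᶠ z in 𝓝 y, (ε, ε • z) ∈ Ω :=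
      (by fun_prop : Continuous fun z : E => (ε, ε • z)).continuousAt.eventually (hΩ.mem_nhds hΩy)
    filter_upwards [this] with z hz
    have := hf ε (ε • z) hεpos hz
    rw [inv_smul_smul₀ hεpos.ne'] at this
    simpa [T] using this
  have hder : iteratedFDeriv ℝ k f y = ε ^ k • Ψ (ε, ε • y) := by
    rw [Filter.EventuallyEq.eq_of_nhds (heq.iteratedFDeriv ℝ k),
      iteratedFDeriv_comp_affine hΩ hΦ _ _ (by simpa [T] using hΩy)]
    ext m
    have h1 : ((ε, 0) + (ε • T) y : ℝ × E) = (ε, ε • y) := by simp [T]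
    rw [h1]
    simp only [hΨ, ContinuousMultilinearMap.compContinuousLinearMap_apply, smul_apply]
    have h2 := (iteratedFDeriv ℝ k Φ (ε, ε • y)).map_smul_univ (fun _ => ε) (fun i => T (m i))
    simpa using h2
  rw [hder, norm_smul, norm_pow, Real.norm_of_nonneg hεpos.le]
  have h3 : ‖y‖ ^ (-1 - (k : ℝ)) = ε * ε ^ k := by
    rw [Real.rpow_sub hypos, Real.rpow_neg_one, Real.rpow_natCast, hε, inv_pow, div_eq_mul_inv]
  rw [h3]
  calc ε ^ k * ‖Ψ (ε, ε • y)‖ ≤ ε ^ k * (C * ε) := by gcongr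
    _ = C * (ε * ε ^ k) := by ring

end Decay

/-! ### Inversions -/

section Inversion

open EuclideanGeometry

variable {d : ℕ} {ϱ : ℝ} {z : Coord d}

theorem norm_inversion (ϱ : ℝ) (z : Coord d) : ‖inversion 0 ϱ z‖ = ϱ ^ 2 / ‖z‖ := by
  simpa using dist_inversion_center (0 : Coord d) z ϱ

/-- Homogeneity of degree `-1`: infinity becomes the face `ε = 0` in the variables `(ε, z)`. -/
theorem inversion_inv_smul (ϱ : ℝ) (z : Coord d) {ε : ℝ} (hε : 0 < ε) :
    inversion 0 ϱ (ε⁻¹ • z) = ε • inversion 0 ϱ z := by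
  simp only [inversion, dist_zero_right, vsub_eq_sub, sub_zero, vadd_eq_add, add_zero, norm_smul,
    norm_inv, Real.norm_of_nonneg hε.le, smul_smul]
  congr 1
  rw [← div_div, div_inv_eq_mul]
  field_simp

theorem contDiffOn_inversion (ϱ : ℝ) :
    ContDiffOn ℝ ∞ (inversion (0 : Coord d) ϱ) {0}ᶜ :=
  ContDiffOn.inversion contDiffOn_const contDiffOn_const contDiffOn_id (fun _ h => h)

theorem jacobian_inversion (hz : z ≠ 0) (i a : Fin d) :
    jacobian (inversion 0 ϱ) z i a = (ϱ / ‖z‖) ^ 2 *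
      ((ℝ ∙ z)ᗮ.reflection (EuclideanSpace.single a (1 : ℝ)) : Coord d) i := by
  have h1 := (EuclideanSpace.proj i : Coord d →L[ℝ] ℝ).hasFDerivAt.comp z
    (hasFDerivAt_inversion (R := ϱ) hz)
  have h2 : pd a (fun y => inversion 0 ϱ y i) z = _ :=
    congrArg (fun T : Coord d →L[ℝ] ℝ => T (EuclideanSpace.single a (1 : ℝ))) h1.fderiv
  rw [jacobian_apply, h2]
  simp

theorem jacobian_inversion_inv_smul (hz : z ≠ 0) {ε : ℝ} (hε : 0 < ε) :
    jacobian (inversion 0 ϱ) (ε⁻¹ • z) = ε ^ 2 • jacobian (inversion 0 ϱ) z := by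
  ext i a
  have h1 : (ℝ ∙ (ε⁻¹ • z)) = ℝ ∙ z :=
    Submodule.span_singleton_smul_eq (IsUnit.mk0 _ (inv_ne_zero hε.ne')) z
  rw [Matrix.smul_apply, jacobian_inversion hz,
    jacobian_inversion (smul_ne_zero (inv_ne_zero hε.ne') hz), smul_eq_mul, norm_smul, norm_inv,
    Real.norm_of_nonneg hε.le]
  simp only [h1]
  rw [← div_div, div_inv_eq_mul]
  field_simp

/-- Inversions are conformal: their differential is a reflection scaled by `(ϱ/‖z‖)²`. -/
theorem transpose_jacobian_inversion_mul (hz : z ≠ 0) :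
    (jacobian (inversion 0 ϱ) z).transpose * jacobian (inversion 0 ϱ) z
      = (ϱ / ‖z‖) ^ 4 • (1 : Matrix (Fin d) (Fin d) ℝ) := by
  ext i j
  have h1 := ((ℝ ∙ z)ᗮ.reflection).inner_map_map (EuclideanSpace.single i (1 : ℝ))
    (EuclideanSpace.single j (1 : ℝ) : Coord d)
  rw [PiLp.inner_apply, EuclideanSpace.inner_single_left] at h1
  simp only [RCLike.inner_apply, conj_trivial, PiLp.single_apply, one_mul] at h1
  simp only [Matrix.mul_apply, Matrix.transpose_apply, jacobian_inversion hz, Matrix.smul_apply,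
    Matrix.one_apply, smul_eq_mul]
  rw [← h1, Finset.mul_sum]
  exact Finset.sum_congr rfl fun k _ => by ring

end Inversion

/-! ### Quadratic form of the scale at a critical zero and decay of the inverted metric. -/

section Asymptotics

open EuclideanGeometry

variable {d : ℕ} {U : Set (Coord d)} {G : Coord d → Matrix (Fin d) (Fin d) ℝ} {u : Coord d → ℝ}

/-- At a critical zero the Hessian equation reads `∂∂u = -ρδ`, which fixes the leading quadratic
form. -/
theorem IsCriticalZero.exists_quadratic (h : IsCriticalZero G u U 0) (hG : G 0 = 1) :
    ∃ B : Coord d → Coord d →L[ℝ] Coord d →L[ℝ] ℝ, ContDiff ℝ ∞ B ∧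
      (∀ᶠ x in 𝓝 0, u x = B x x x) ∧ ∀ x, 2 * B 0 x x = -rho G u 0 * ‖x‖ ^ 2 := by
  obtain ⟨v, hv, hvu⟩ := exists_contDiff_eventuallyEq h.isOpen h.mem h.smooth_u
  have hpd : ∀ a, ∀ᶠ y in 𝓝 0, pd a v y = pd a u y := fun a =>
    hvu.eventually_nhds.mono fun y hy => pd_congr hy a
  have h1 : fderiv ℝ v 0 = 0 := fderiv_eq_zero_of_pd fun a => by
    rw [(hpd a).self_of_nhds, h.pd_zero]
  obtain ⟨B, hB, hBv, hB0⟩ := exists_contDiff_eq_quadratic hv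
    (by rw [hvu.self_of_nhds, h.zero]) h1
  refine ⟨B, hB, hvu.mono fun x hx => by rw [← hx, hBv], fun x => ?_⟩
  have hdv : ContDiff ℝ ∞ (fderiv ℝ v) := hv.fderiv_right (by simp)
  have hess : ∀ a b, pd a (pd b v) 0 = -rho G u 0 * (1 : Matrix (Fin d) (Fin d) ℝ) a b := by
    intro a b
    have h2 := h.hess_eq h.mem a b
    rw [AlmostEinstein.hess, h.zero, hG] at h2
    simp only [h.pd_zero, mul_zero, Finset.sum_const_zero] at h2
    rw [pd_congr (hpd b) a]
    linarith
  have h3 : HasFDerivAt (fun y => fderiv ℝ v y x) ((fderiv ℝ (fderiv ℝ v) 0).flip x) 0 := by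
    have := (hdv.differentiable (by simp) 0).hasFDerivAt.clm_apply (hasFDerivAt_const x 0)
    simpa using this
  have h4 : fderiv ℝ (fderiv ℝ v) 0 x x = fderiv ℝ (fun y => fderiv ℝ v y x) 0 x := by
    rw [h3.fderiv]; rfl
  have hdb : ∀ b, DifferentiableAt ℝ (pd b v) 0 := fun b =>
    (hdv.clm_apply contDiff_const).differentiable (by simp) 0
  rw [hB0, h4, fderiv_apply_eq_sum_pd]
  have h5 : ∀ a, pd a (fun y => fderiv ℝ v y x) 0 = -rho G u 0 * x a := by
    intro a
    have : (fun y => fderiv ℝ v y x) = fun y => ∑ b, x b * pd b v y := by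
      funext y
      exact fderiv_apply_eq_sum_pd ..
    rw [this, pd_sum (fun b _ => (hdb b).const_mul _)]
    simp only [pd_const_mul (hdb _), hess, Matrix.one_apply]
    simp [mul_comm]
  simp only [h5, EuclideanSpace.norm_sq_eq, Finset.mul_sum, Real.norm_eq_abs, sq_abs]
  exact Finset.sum_congr rfl fun a _ => by ring

/-- If `G` and the quadratic form `B` are smooth near the origin, `G 0 = 1` and
`B 0 = (a / 2) |·|²`, then the pull-back of `B⁻² G` under the inversion of radius `√(2 / |a|)` is
asymptotic to the Euclidean metric. -/
theorem exists_decay_inversion {W : Set (Coord d)} (hW : IsOpen W) (h0W : 0 ∈ W)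
    (hG : MSmoothOn W G) (hG0 : G 0 = 1) {B : Coord d → Coord d →L[ℝ] Coord d →L[ℝ] ℝ}
    (hB : ContDiff ℝ ∞ B) {a : ℝ} (ha : a ≠ 0) (hB0 : ∀ x, 2 * B 0 x x = a * ‖x‖ ^ 2)
    {ϱ : ℝ} (hϱ : ϱ ^ 2 = 2 / |a|) :
    ∃ δ : ℝ, 0 < δ ∧ (∀ y, δ⁻¹ < ‖y‖ → inversion 0 ϱ y ∈ W) ∧
      ∀ h : Coord d → Matrix (Fin d) (Fin d) ℝ,
        (∀ y, y ≠ 0 → inversion 0 ϱ y ∈ W → h y =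
          ((B (inversion 0 ϱ y) (inversion 0 ϱ y) (inversion 0 ϱ y)) ^ 2)⁻¹ •
            ((jacobian (inversion 0 ϱ) y).transpose * G (inversion 0 ϱ y)
              * jacobian (inversion 0 ϱ) y)) →
        ∀ (i j : Fin d) (k : ℕ), ∃ C : ℝ, ∀ y, δ⁻¹ < ‖y‖ →
          ‖iteratedFDeriv ℝ k (fun z => h z i j - (1 : Matrix (Fin d) (Fin d) ℝ) i j) y‖
            ≤ C * ‖y‖ ^ (-1 - (k : ℝ)) := by
  set ι := inversion (0 : Coord d) ϱ with hι
  set Ω₀ : Set (ℝ × Coord d) := Prod.snd ⁻¹' {0}ᶜ with hΩ₀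
  have hΩ₀o : IsOpen Ω₀ := isOpen_compl_singleton.preimage continuous_snd
  have hιs : ContDiffOn ℝ ∞ (fun q : ℝ × Coord d => ι q.2) Ω₀ :=
    (contDiffOn_inversion ϱ).comp contDiff_snd.contDiffOn fun q hq => hq
  have hxs : ContDiffOn ℝ ∞ (fun q : ℝ × Coord d => q.1 • ι q.2) Ω₀ :=
    contDiff_fst.contDiffOn.smul hιs
  -- At `x = ε • ι z` one has `B x x x = ε² Q(ε, z)`. In `B⁻²` this gives `ε⁻⁴`, cancelled by `ε²`
  -- from each of the two Jacobians, so the pulled-back metric extends smoothly to `ε = 0` where `Q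
  -- ≠ 0`.
  set Q : ℝ × Coord d → ℝ := fun q => B (q.1 • ι q.2) (ι q.2) (ι q.2) with hQ
  have hQs : ContDiffOn ℝ ∞ Q Ω₀ := ((hB.comp_contDiffOn hxs).clm_apply hιs).clm_apply hιs
  set Ω := Ω₀ ∩ (fun q => (q.1 • ι q.2, Q q)) ⁻¹' (W ×ˢ {0}ᶜ) with hΩ
  have hΩo : IsOpen Ω := (hxs.continuousOn.prodMk hQs.continuousOn).isOpen_inter_preimage hΩ₀o
    (hW.prod isOpen_compl_singleton)
  have hQ0 : ∀ z : Coord d, Q (0, z) = a / 2 * (ϱ ^ 2 / ‖z‖) ^ 2 := by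
    intro z
    have h1 := hB0 (ι z)
    rw [hι, norm_inversion, ← hι] at h1
    simp only [hQ, zero_smul]
    linarith
  have hϱ0 : 0 < ϱ ^ 2 := by rw [hϱ]; positivity
  have hsub : ({0} : Set ℝ) ×ˢ Metric.sphere (0 : Coord d) 1 ⊆ Ω := by
    rintro ⟨ε, z⟩ ⟨rfl, hz⟩
    have hz1 : ‖z‖ = 1 := by simpa using hz
    refine ⟨fun h => ?_, by simpa using h0W, ?_⟩
    · have : z = 0 := h
      simp [this] at hz1
    · simp only [Set.mem_compl_iff, Set.mem_singleton_iff]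
      rw [hQ0, hz1]
      positivity
  -- Compactness of the sphere gives a range of `ε` that works for all directions `z`.
  obtain ⟨V, V', hV, -, hV0, hV', hVV⟩ := generalized_tube_lemma isCompact_singleton
    (isCompact_sphere (0 : Coord d) 1) hΩo hsub
  obtain ⟨r, hr, hrV⟩ := Metric.isOpen_iff.1 hV 0 (hV0 rfl)
  have hK : ∀ ε z, ε ∈ Set.Icc 0 (r / 2) → ‖z‖ = 1 → (ε, z) ∈ Ω := by
    intro ε z hε hz
    refine hVV ⟨hrV ?_, hV' (by simpa using hz)⟩
    rw [Metric.mem_ball, Real.dist_eq, sub_zero, abs_of_nonneg hε.1]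
    linarith [hε.2]
  refine ⟨r / 2, by positivity, fun y hy => ?_, fun h hh i j k => ?_⟩
  · have hypos : 0 < ‖y‖ := (inv_pos.2 (by positivity)).trans hy
    have h1 := hK ‖y‖⁻¹ (‖y‖⁻¹ • y)
      ⟨(inv_pos.2 hypos).le, (inv_lt_of_inv_lt₀ (by positivity) hy).le⟩
      (by rw [norm_smul, norm_inv, norm_norm, inv_mul_cancel₀ hypos.ne'])
    have h2 : ‖y‖⁻¹ • ι (‖y‖⁻¹ • y) ∈ W := h1.2.1
    rwa [hι, ← inversion_inv_smul _ _ (inv_pos.2 hypos), smul_smul,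
      inv_mul_cancel₀ (inv_ne_zero hypos.ne'), one_smul] at h2
  · refine exists_norm_iteratedFDeriv_le (Ω := Ω) (δ := r / 2)
      (Φ := fun q => ((Q q) ^ 2)⁻¹ * ((jacobian ι q.2).transpose * G (q.1 • ι q.2)
        * jacobian ι q.2) i j - (1 : Matrix (Fin d) (Fin d) ℝ) i j)
      hΩo ?_ (by positivity) hK ?_ ?_ k
    · have hJ : ∀ m l, ContDiffOn ℝ ∞ (fun q : ℝ × Coord d => jacobian ι q.2 m l) Ω := fun m l =>
        (smooth_jacobian isOpen_compl_singleton (contDiffOn_inversion ϱ) m l).comp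
          contDiff_snd.contDiffOn fun q hq => hq.1
      have hGs : ∀ m l, ContDiffOn ℝ ∞ (fun q : ℝ × Coord d => G (q.1 • ι q.2) m l) Ω :=
        fun m l => (hG m l).comp (hxs.mono Set.inter_subset_left) fun q hq => hq.2.1
      simp only [Matrix.mul_apply, Matrix.transpose_apply]
      refine ContDiffOn.sub (ContDiffOn.mul (ContDiffOn.inv
        ((hQs.mono Set.inter_subset_left).pow 2) fun q hq => pow_ne_zero 2 hq.2.2) ?_)
        contDiffOn_const
      exact ContDiffOn.sum fun l _ => ContDiffOn.mul
        (ContDiffOn.sum fun m _ => (hJ m i).mul (hGs m l)) (hJ l j)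
    · intro z hz
      have hz0 : z ≠ 0 := hz.1
      simp only [zero_smul, hG0, mul_one, transpose_jacobian_inversion_mul hz0, hι, hQ0,
        Matrix.smul_apply, smul_eq_mul]
      have hzn : ‖z‖ ≠ 0 := norm_ne_zero_iff.2 hz0
      -- The limit at infinity is exactly `δ` because the radius satisfies `a² ϱ⁴ = 4`.
      have h2 : ((a / 2 * (ϱ ^ 2 / ‖z‖) ^ 2) ^ 2)⁻¹ * (ϱ / ‖z‖) ^ 4 = 1 := by
        have h3 : a ^ 2 * (ϱ ^ 2) ^ 2 = 4 := by
          rw [hϱ, div_pow, sq_abs]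
          field_simp
          norm_num
        rw [inv_mul_eq_one₀ (by positivity)]
        field_simp
        nlinarith [h3]
      rw [← mul_assoc, h2, one_mul, sub_self]
    · intro ε z hε hz
      have hz0 : z ≠ 0 := hz.1
      have h1 := inversion_inv_smul ϱ z hε
      have h2 := hh (ε⁻¹ • z) (smul_ne_zero (inv_ne_zero hε.ne') hz0)
        (by rw [hι, h1]; exact hz.2.1)
      rw [h2, hι, h1, jacobian_inversion_inv_smul hz0 hε]
      simp only [Matrix.transpose_smul, Matrix.smul_mul, Matrix.mul_smul, Matrix.smul_apply,
        smul_eq_mul, map_smul, smul_apply, hQ, hι]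
      field_simp

end Asymptotics

/-! ### Asymptotically Euclidean ends -/

section NormalChart

-- Write `A = wᵀw` with `w` invertible and take `J = w⁻¹`.
open scoped MatrixOrder in
theorem exists_transpose_mul_mul_eq_one {d : ℕ} {A : Matrix (Fin d) (Fin d) ℝ} (hA : A.PosDef) :
    ∃ J K : Matrix (Fin d) (Fin d) ℝ, J * K = 1 ∧ K * J = 1 ∧ J.transpose * A * J = 1 := by
  obtain ⟨y, hy, rfl⟩ := CStarAlgebra.isStrictlyPositive_iff_eq_star_mul_self.mp
    hA.isStrictlyPositive
  obtain ⟨w, rfl⟩ := hy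
  refine ⟨(w⁻¹ : (Matrix (Fin d) (Fin d) ℝ)ˣ), w, w.inv_mul, w.mul_inv, ?_⟩
  have h1 : star (w : Matrix (Fin d) (Fin d) ℝ) = (w : Matrix (Fin d) (Fin d) ℝ).transpose := by
    rw [Matrix.star_eq_conjTranspose, Matrix.conjTranspose_eq_transpose_of_trivial]
  rw [h1, mul_assoc, mul_assoc, w.mul_inv, mul_one, ← Matrix.transpose_mul, w.mul_inv,
    Matrix.transpose_one]

/-- The affine coordinate change `x ↦ K (x - x₀)`. -/
noncomputable def affineChange {d : ℕ} {J K : Matrix (Fin d) (Fin d) ℝ} (h1 : J * K = 1)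
    (h2 : K * J = 1) (x₀ : Coord d) : Coord d ≃ₜ Coord d where
  toFun x := Matrix.toEuclideanLin K (x - x₀)
  invFun x := x₀ + Matrix.toEuclideanLin J x
  left_inv x := by
    ext i
    simp [Matrix.toLpLin_apply, Matrix.mulVec_mulVec, h1]
  right_inv x := by
    ext i
    simp [Matrix.toLpLin_apply, Matrix.mulVec_mulVec, h2]
  continuous_toFun := (LinearMap.continuous_of_finiteDimensional _).comp (by fun_prop)
  continuous_invFun := continuous_const.add (LinearMap.continuous_of_finiteDimensional _)

variable {d : ℕ} {M : Type*} [TopologicalSpace M] [ChartedSpace (EuclideanSpace ℝ (Fin d)) M]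
  [IsManifold (𝓡 d) ∞ M]

/-- An affine change of coordinates normalises the metric at `p` alone. Its first derivatives need
not vanish, since decay of order one suffices. -/
theorem exists_normal_chart (g : Metric d M) (p : M) :
    ∃ ψ : OpenPartialHomeomorph M (EuclideanSpace ℝ (Fin d)), IsChartAround ψ p ∧ ψ p = 0 ∧
      coeff g.inner ψ 0 = 1 := by
  have hφ := isChartAround_chartAt (d := d) p
  set φ := chartAt (EuclideanSpace ℝ (Fin d)) p
  have hx := φ.map_source hφ.2
  obtain ⟨J, K, h1, h2, h3⟩ :=
    exists_transpose_mul_mul_eq_one ((isMetricOn_coeff g hφ.1).posDef _ hx)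
  set e := (affineChange h1 h2 (φ p)).toOpenPartialHomeomorph with he
  have hJs : ContDiff ℝ ∞ (Matrix.toEuclideanLin J) :=
    (LinearMap.toContinuousLinearMap (Matrix.toEuclideanLin J)).contDiff
  have hKs : ContDiff ℝ ∞ (Matrix.toEuclideanLin K) :=
    (LinearMap.toContinuousLinearMap (Matrix.toEuclideanLin K)).contDiff
  have hsymm : ∀ z, e.symm z = φ p + Matrix.toEuclideanLin J z := fun z => rfl
  have hc1 : ContDiff ℝ ∞ e := hKs.comp (contDiff_id.sub contDiff_const)
  have hc2 : ContDiff ℝ ∞ e.symm := contDiff_const.add hJs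
  refine ⟨φ.trans e, ⟨trans_mem_maximalAtlas hφ.1 hc1.contDiffOn hc2.contDiffOn, ?_⟩, ?_, ?_⟩
  · rw [OpenPartialHomeomorph.trans_source]
    exact ⟨hφ.2, trivial⟩
  · have : (φ.trans e) p = Matrix.toEuclideanLin K (φ p - φ p) := rfl
    rw [this, sub_self, map_zero]
  · have h4 : e.symm 0 = φ p := by rw [hsymm, map_zero, add_zero]
    have h5 : jacobian e.symm 0 = J := by
      ext i a
      have hd : HasFDerivAt (fun y => e.symm y i) ((EuclideanSpace.proj i : Coord d →L[ℝ] ℝ).comp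
          (LinearMap.toContinuousLinearMap (Matrix.toEuclideanLin J))) 0 :=
        (EuclideanSpace.proj i : Coord d →L[ℝ] ℝ).hasFDerivAt.comp 0
          ((LinearMap.toContinuousLinearMap (Matrix.toEuclideanLin J)).hasFDerivAt.const_add _)
      rw [jacobian_apply, pd, hd.fderiv]
      simp [Matrix.toLpLin_apply]
    have h6 : coeff g.inner (φ.trans e) 0 = pullback g.inner (φ.symm ∘ e.symm) 0 := rfl
    rw [h6, pullback_comp _ (mdifferentiableAt_symm hφ.1 (by rwa [h4]))
      (hc2.differentiable (by simp) 0), h4, h5]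
    exact h3

end NormalChart

/-! ### The asymptotically Euclidean end at a critical zero. -/

section ALE

open EuclideanGeometry

set_option linter.unusedSectionVars false

variable {d : ℕ} {M : Type*} [TopologicalSpace M] [ChartedSpace (EuclideanSpace ℝ (Fin d)) M]
  [IsManifold (𝓡 d) ∞ M] {ψ : OpenPartialHomeomorph M (EuclideanSpace ℝ (Fin d))}

/-- The diffeomorphism from `{|y| > R}` to a punctured neighbourhood that is given by the inverse
of a chart and an inversion. -/
noncomputable def invertedChart (hψ : ψ ∈ IsManifold.maximalAtlas (𝓡 d) ∞ M) {ϱ R : ℝ}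
    (hϱ : 0 < ϱ) (hR : 0 < R) (hmem : ∀ y, R < ‖y‖ → inversion 0 ϱ y ∈ ψ.target) :
    PartialDiffeomorph (𝓡 d) (𝓡 d) (Coord d) M ∞ where
  toFun := ψ.symm ∘ inversion 0 ϱ
  invFun := inversion 0 ϱ ∘ ψ
  source := {y | R < ‖y‖}
  target := ψ.source ∩ ψ ⁻¹' (Metric.ball 0 (ϱ ^ 2 / R) \ {0})
  map_source' y hy := by
    have hy' : R < ‖y‖ := hy
    refine ⟨ψ.map_target (hmem y hy), ?_⟩
    rw [Set.mem_preimage, Function.comp, ψ.right_inv (hmem y hy)]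
    refine ⟨?_, ?_⟩
    · rw [mem_ball_zero_iff, norm_inversion]
      gcongr
    · intro h
      have := (inversion_eq_center hϱ.ne').1 h
      rw [this, norm_zero] at hy'
      exact absurd hy' hR.le.not_gt
  map_target' q hq := by
    have h0 : 0 < ‖ψ q‖ := norm_pos_iff.2 hq.2.2
    have h1 : ‖ψ q‖ < ϱ ^ 2 / R := mem_ball_zero_iff.1 hq.2.1
    show R < ‖inversion 0 ϱ (ψ q)‖
    rw [norm_inversion, lt_div_iff₀ h0]
    rw [lt_div_iff₀ hR] at h1
    linarith
  left_inv' y hy := by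
    simp only [Function.comp]
    rw [ψ.right_inv (hmem y hy), inversion_inversion _ hϱ.ne']
  right_inv' q hq := by
    simp only [Function.comp]
    rw [inversion_inversion _ hϱ.ne', ψ.left_inv hq.1]
  open_source := isOpen_lt continuous_const continuous_norm
  open_target := ψ.isOpen_inter_preimage (Metric.isOpen_ball.sdiff isClosed_singleton)
  contMDiffOn_toFun := by
    refine (contMDiffOn_symm_of_mem_maximalAtlas hψ).comp
      ((contDiffOn_inversion ϱ).mono fun y hy => ?_).contMDiffOn fun y hy => hmem y hy
    exact norm_pos_iff.1 (hR.trans hy)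
  contMDiffOn_invFun := by
    refine (contDiffOn_inversion ϱ).contMDiffOn.comp
      ((contMDiffOn_of_mem_maximalAtlas hψ).mono Set.inter_subset_left) fun q hq => hq.2.2

/-- Inversion in a chart with `g = δ` at `p` sends `p` to infinity, and `s⁻²` compensates its
conformal factor to leading order. -/
theorem IsAlmostEinstein.isALENear [ConnectedSpace M] (hd : 3 ≤ d) {g : Metric d M} {s : M → ℝ}
    (hs : IsAlmostEinstein g s) {p : M} (h0 : s p = 0) (h1 : mfderiv (𝓡 d) 𝓘(ℝ) s p = 0) :
    IsALENear (rescaled g.inner s) p := by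
  obtain ⟨ψ, hψ, hψp, hψ1⟩ := exists_normal_chart g p
  have hsol := hs.isSolutionOn hd hψ.1
  have ht : (0 : Coord d) ∈ ψ.target := hψp ▸ ψ.map_source hψ.2
  have hp : ψ.symm 0 = p := by rw [← hψp, ψ.left_inv hψ.2]
  have hpd := (mfderiv_eq_zero_iff hs.smooth hψ).1 h1
  have hρ := hs.rho_ne_zero hd hψ h0 hpd
  rw [hψp] at hpd hρ
  set u := s ∘ ψ.symm with hu
  set G := coeff g.inner ψ with hG
  have hcrit : IsCriticalZero G u ψ.target 0 :=
    { hsol with mem := ht, zero := by simp [hu, hp, h0], pd_zero := hpd, rho_ne := hρ }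
  obtain ⟨B, hB, hBu, hB0⟩ := hcrit.exists_quadratic hψ1
  obtain ⟨W, hWB, hWo, h0W⟩ := eventually_nhds_iff.1 hBu
  have ha : -rho G u 0 ≠ 0 := neg_ne_zero.2 hρ
  set ϱ := Real.sqrt (2 / |(-rho G u 0)|) with hϱ
  have hϱpos : 0 < ϱ := Real.sqrt_pos.2 (by positivity)
  obtain ⟨δ, hδ, hδW, hdecay⟩ := exists_decay_inversion (G := G) (hWo.inter ψ.open_target)
    ⟨h0W, ht⟩ (fun i j => (hsol.smooth i j).mono Set.inter_subset_right) hψ1 hB ha hB0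
    (Real.sq_sqrt (by positivity) : ϱ ^ 2 = _)
  have hδ' : 0 < δ⁻¹ := inv_pos.2 hδ
  have hmem : ∀ y, δ⁻¹ < ‖y‖ → inversion 0 ϱ y ∈ ψ.target := fun y hy => (hδW y hy).2
  set Θ := invertedChart hψ.1 hϱpos hδ' hmem with hΘ
  have himage : (ψ.symm ∘ inversion 0 ϱ) '' {y | δ⁻¹ < ‖y‖} = Θ.target :=
    Θ.toPartialEquiv.image_source_eq_target
  have hinj : Set.InjOn (ψ.symm ∘ inversion 0 ϱ) {y | δ⁻¹ < ‖y‖} := Θ.toPartialEquiv.injOn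
  -- A punctured ball needs no quotient, so `Γ` is trivial; the decay rate is `τ = 1`.
  refine ⟨⊥, δ⁻¹, 1, ψ.symm ∘ inversion 0 ϱ, inferInstance,
    fun γ hγ _ _ _ => Subgroup.mem_bot.1 hγ, hδ', one_pos,
    fun y => ⟨Θ, y.2, fun _ _ => rfl⟩, fun y z hy hz => ?_, ?_, ?_, ?_, ?_⟩
  · constructor
    · exact fun h => ⟨1, Subgroup.one_mem _, hinj hy hz h⟩
    · rintro ⟨γ, hγ, h⟩
      rw [Subgroup.mem_bot.1 hγ] at h
      exact congrArg _ h
  · rw [himage]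
    exact fun h => h.2.2 hψp
  · rw [himage]
    have hb : ψ.source ∩ ψ ⁻¹' Metric.ball 0 (ϱ ^ 2 / δ⁻¹) ∈ 𝓝 p :=
      (ψ.isOpen_inter_preimage Metric.isOpen_ball).mem_nhds
        ⟨hψ.2, by rw [Set.mem_preimage, hψp]; exact Metric.mem_ball_self (by positivity)⟩
    refine Filter.mem_of_superset hb fun q hq => ?_
    by_cases hq0 : ψ q = 0
    · left
      rw [← ψ.left_inv hq.1, hq0, hp]
    · exact Or.inr ⟨hq.1, hq.2, hq0⟩
  · have h2 : Filter.Tendsto (inversion (0 : Coord d) ϱ) (Bornology.cobounded _) (𝓝 0) := by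
      rw [tendsto_zero_iff_norm_tendsto_zero]
      simp only [norm_inversion]
      exact tendsto_const_nhds.div_atTop tendsto_norm_cobounded_atTop
    have h3 := (ψ.continuousAt_symm ht).tendsto
    rw [hp] at h3
    exact h3.comp h2
  · refine hdecay _ fun y hy hyW => ?_
    have hdiff : DifferentiableAt ℝ (inversion 0 ϱ) y :=
      (hasFDerivAt_inversion (R := ϱ) hy).differentiableAt
    rw [pullback_comp _ (mdifferentiableAt_symm hψ.1 hyW.2) hdiff, ← hWB _ hyW.1]
    have h4 : pullback (rescaled g.inner s) ψ.symm (inversion 0 ϱ y)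
        = ((u (inversion 0 ϱ y)) ^ 2)⁻¹ • G (inversion 0 ϱ y) := rfl
    rw [h4, Matrix.mul_smul, Matrix.smul_mul]

end ALE

/-- `S = 0` gives `|ds|² = 0` at the zero, and unique continuation then gives `ρ ≠ 0`. -/
theorem IsAlmostEinstein.isCriticalZero {d : ℕ} {M : Type*} [TopologicalSpace M]
    [ChartedSpace (EuclideanSpace ℝ (Fin d)) M] [IsManifold (𝓡 d) ∞ M] [ConnectedSpace M]
    {φ : OpenPartialHomeomorph M (EuclideanSpace ℝ (Fin d))} {g : Metric d M} {s : M → ℝ} {p : M}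
    (hd : 3 ≤ d) (hs : IsAlmostEinstein g s)
    (hc : ∀ p φ, IsChartAround φ p → localS (coeff g.inner φ) (s ∘ φ.symm) (φ p) = 0)
    (hφ : IsChartAround φ p) (h0 : s p = 0) :
    IsCriticalZero (coeff g.inner φ) (s ∘ φ.symm) φ.target (φ p) := by
  have hx := φ.map_source hφ.2
  have hsol := hs.isSolutionOn hd hφ.1
  have h1 := IsAlmostEinstein.gradSq_eq_neg hd hc hφ h0
  rw [neg_zero] at h1
  have hpd := hsol.pd_eq_zero_of_gradSq hx h1
  exact { hsol with
    mem := hx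
    zero := by simpa [φ.left_inv hφ.2] using h0
    pd_zero := hpd
    rho_ne := hs.rho_ne_zero hd hφ h0 hpd }

end AlmostEinstein

theorem theorem1p2 {d : ℕ} (hd : 3 ≤ d) {M : Type*} [TopologicalSpace M] [T2Space M]
    [SecondCountableTopology M] [ConnectedSpace M]
    [ChartedSpace (EuclideanSpace ℝ (Fin d)) M] [IsManifold (𝓡 d) ∞ M]
    (g : Bundle.ContMDiffRiemannianMetric (𝓡 d) ∞ (EuclideanSpace ℝ (Fin d))
      (TangentSpace (𝓡 d) : M → Type _))
    (s : M → ℝ) (hs : AlmostEinstein.IsAlmostEinstein g s) :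
    IsOpen {p | s p ≠ 0} ∧ Dense {p | s p ≠ 0} ∧
    ∃ c : ℝ, AlmostEinstein.IsAlmostScalarConstant g s c ∧
      AlmostEinstein.IsEinsteinOn (AlmostEinstein.rescaled g.inner s)
        (AlmostEinstein.singularSet s)ᶜ ∧
      (∀ p ∈ (AlmostEinstein.singularSet s)ᶜ,
        AlmostEinstein.scalarCurvature (AlmostEinstein.rescaled g.inner s) p
          = (d : ℝ) * ((d : ℝ) - 1) * c) ∧
      (0 < c → AlmostEinstein.singularSet s = ∅) ∧
      (c = 0 → ∀ p ∈ AlmostEinstein.singularSet s,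
        (∀ᶠ q in 𝓝[≠] p, q ∉ AlmostEinstein.singularSet s) ∧
        mfderiv (𝓡 d) 𝓘(ℝ) s p = 0 ∧
        AlmostEinstein.IsALENear (AlmostEinstein.rescaled g.inner s) p ∧
        AlmostEinstein.WeylVanishesAt g.inner p ∧
        AlmostEinstein.CottonVanishesAt g.inner p ∧
        AlmostEinstein.BachVanishesAt g.inner p) ∧
      (c < 0 → AlmostEinstein.singularSet s = ∅ ∨
        AlmostEinstein.IsTotallyUmbilicHypersurface g.inner (AlmostEinstein.singularSet s)) ∧
      (CompactSpace M → c = -1 →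
        AlmostEinstein.IsFiniteUnionOfPoincareEinstein g s {p | s p < 0}ᶜ
          (AlmostEinstein.singularSet s) ∧
        AlmostEinstein.IsFiniteUnionOfPoincareEinstein g (-s) {p | 0 < s p}ᶜ
          (AlmostEinstein.singularSet s)) := by
  obtain ⟨p₀, -⟩ := hs.nontrivial
  have hc : ∀ p φ, AlmostEinstein.IsChartAround φ p →
      AlmostEinstein.localS (AlmostEinstein.coeff g.inner φ) (s ∘ φ.symm) (φ p)
        = AlmostEinstein.scalarS g.inner s p₀ := fun p φ hφ => hs.localS_eq_const hd p₀ hφ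
  refine ⟨isOpen_ne_fun hs.smooth.continuous continuous_const, hs.dense hd,
    AlmostEinstein.scalarS g.inner s p₀, ⟨hs.smooth, hs.nontrivial, fun p => ?_⟩,
    ⟨_, hs.ricciEqOn hd hc⟩, fun p hp => hs.scalarCurvature_eq hd hc hp, fun hpos => ?_,
    -- For `c < 0` the second alternative can always be chosen: the empty set satisfies the
    -- hypersurface conditions vacuously.
    fun hzero p hp => ?_, fun hneg => Or.inr (hs.isTotallyUmbilic hd hneg hc), fun _ hone => ?_⟩
  · exact hc p _ (AlmostEinstein.isChartAround_chartAt p)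
  -- A zero would satisfy `|ds|² = -c < 0`.
  · refine Set.eq_empty_of_forall_notMem fun p hp => ?_
    have hφ := AlmostEinstein.isChartAround_chartAt (d := d) p
    have h1 := AlmostEinstein.IsAlmostEinstein.gradSq_eq_neg hd hc hφ hp
    have h2 := (AlmostEinstein.isMetricOn_coeff g hφ.1).gradSq_nonneg
      (u := s ∘ (chartAt (EuclideanSpace ℝ (Fin d)) p).symm)
      (OpenPartialHomeomorph.map_source _ hφ.2)
    linarith
  · rw [hzero] at hc
    have hcrit : ∀ φ, AlmostEinstein.IsChartAround φ p → AlmostEinstein.IsCriticalZero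
        (AlmostEinstein.coeff g.inner φ) (s ∘ φ.symm) φ.target (φ p) :=
      fun φ hφ => hs.isCriticalZero hd hc hφ hp
    have hne : ∀ φ, AlmostEinstein.IsChartAround φ p →
        ∀ᶠ y in 𝓝[≠] φ p, (s ∘ φ.symm) y ≠ 0 := fun φ hφ =>
      (hcrit φ hφ).eventually_ne_zero fun y hy => by
        simpa [φ.right_inv hy] using hc (φ.symm y) φ ⟨hφ.1, φ.map_target hy⟩
    have hφ := AlmostEinstein.isChartAround_chartAt (d := d) p
    have hd0 := (AlmostEinstein.mfderiv_eq_zero_iff hs.smooth hφ).2 (hcrit _ hφ).pd_zero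
    refine ⟨?_, hd0, hs.isALENear hd hp hd0, fun φ hφ => (hcrit φ hφ).weyl_eq_zero,
      fun φ hφ => (hcrit φ hφ).cotton_eq_zero (hne φ hφ),
      fun φ hφ => (hcrit φ hφ).bach_eq_zero (hne φ hφ)⟩
    -- Isolatedness is known in coordinates; injectivity of the chart carries it over to `M`.
    have h1 := eventually_nhdsWithin_iff.1 (hne _ hφ)
    set φ := chartAt (EuclideanSpace ℝ (Fin d)) p
    refine eventually_nhdsWithin_iff.2 ?_
    filter_upwards [(φ.continuousAt hφ.2).eventually h1, φ.open_source.mem_nhds hφ.2]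
      with q hq hq' hqp h0
    refine hq (fun h => hqp (φ.injOn hq' hφ.2 h)) ?_
    rw [Function.comp, φ.left_inv hq']
    exact h0
  · rw [hone] at hc
    exact hs.isFiniteUnionOfPoincareEinstein hd hc
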